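/- Let $\mathbb{k}$ be a field of characteristic zero. Jordan algebras are commutative, not necessarily unital $\mathbb{k}$-algebras satisfying $(ab)(aa)=a(b(aa))$, and $\mathrm{Jord}(V)$ denotes the free Jordan algebra on a vector space $V$. For a Jordan algebra $J$ let $D_{a,b}=[L_a,L_b]$, i.e. $D_{a,b}(c)=a(bc)-b(ac)$, let $$\mathcal{B}(J)=\Lambda^2(J)/\langle ab\wedge c+bc\wedge a+ca\wedge b : a,b,c\in J\rangle ,$$ and let $\mathsf{TAG}(J)=\mathfrak{sl}_2\otimes J\oplus\mathcal{B}(J)$ be the Tits–Allison–Gao Lie algebra, with the bracket $$[x\otimes a,y\otimes b]=[x,y]\otimes ab+\tfrac12\mathrm{tr}(\mathrm{ad}_x\mathrm{ad}_y)\,a\wedge b,\qquad [a\wedge b,x\otimes c]=x\otimes D_{a,b}(c),$$ $$[a\wedge b,c\wedge d]=D_{a,b}(c)\wedge d+c\wedge D_{a,b}(d);$$ it is a functor from Jordan algebras to Lie algebras. A sequence $\mathcal{K}=\{\mathcal{K}(n)\}_{n\ge0}$ of right $S_n$-modules defines the analytic functor $\mathcal{K}(V)=\bigoplus_n\mathcal{K}(n)\otimes_{\mathbb{k}S_n}V^{\otimes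 n}$. A twisted Lie algebra is a Lie algebra in the symmetric monoidal category of such sequences with the Cauchy product, i.e. a sequence $\mathfrak{g}$ with $S_n\times S_m$-equivariant brackets $\mathfrak{g}(n)\otimes\mathfrak{g}(m)\to\mathfrak{g}(n+m)$ which satisfy skew-symmetry and the Jacobi identity up to the block permutations that restore the order of the arguments; then each $\mathfrak{g}(V)$ is a Lie algebra, functorially in $V$. Let $\mathrm{Jord}(n)\subset\mathrm{Jord}(x_1,\ldots,x_n)$ and $\mathcal{B}(\mathrm{Jord})(n)\subset\mathcal{B}(\mathrm{Jord}(x_1,\ldots,x_n))$ be the subspaces of elements of degree exactly one in each $x_i$ (they are spanned by the multilinear words $w$, respectively by $w'\wedge w''$ with $w'w''$ multilinear), with $S_n$ permuting the generators. The Jordan operad $\mathrm{Jord}$ is the monad $V\mapsto\mathrm{Jord}(V)$ on vector spaces; a right module over it is a functor $F$ with an action $F(\mathrm{Jord}(V))\to F(V)$ that is natural in $V$, unital and associative. Let $$\mathcal{TAG}(n)=\mathfrak{sl}_2\otimes\mathrm{Jord}(n)\oplus\mathcal{B}(\mathrm{Jord})(n)\subset\mathsf{TAG}(\mathrm{Jord}(x_1,\ldots,x_n)).$$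 The bracket $\mathcal{TAG}(n)\otimes\mathcal{TAG}(m)\to\mathcal{TAG}(n+m)$, $p\otimes q\mapsto[p(x_1,\ldots,x_n),q(x_{n+1},\ldots,x_{n+m})]$, is well defined and makes $\mathcal{TAG}$ a twisted Lie algebra. Moreover, the following statements hold. 1. The functor $V\mapsto\mathrm{Jord}(V)$ is naturally isomorphic to the analytic functor of the sequence $\{\mathrm{Jord}(n)\}$, through the evaluation $a\otimes v_1\otimes\cdots\otimes v_n\mapsto a(v_1,\ldots,v_n)$. 2. The evaluation $p\otimes v_1\otimes\cdots\otimes v_n\mapsto p(v_1,\ldots,v_n)$ defines an isomorphism of Lie algebras, natural in the vector space $V$, $$\mathcal{TAG}(V)\cong\mathsf{TAG}(\mathrm{Jord}(V)).$$ 3. The analytic functor $\mathcal{TAG}$ is a right module over $\mathrm{Jord}$, with the action by homomorphisms of Lie algebras $\mathcal{TAG}(\mathrm{Jord}(V))\to\mathcal{TAG}(V)$ which corresponds under the isomorphism of 2 to the homomorphism $\mathsf{TAG}(\mathrm{Jord}(\mathrm{Jord}(V)))\to\mathsf{TAG}(\mathrm{Jord}(V))$ induced by the composition map $\mathrm{Jord}(\mathrm{Jord}(V))\to\mathrm{Jord}(V)$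 of the operad. 4. For a Jordan algebra $J$ (respectively a Lie algebra $L$) let $\mathsf{1}_J$ (respectively $\mathsf{1}_L$) be the constant analytic functor with this value, a left module over $\mathrm{Jord}$ (respectively over the operad $\mathrm{Lie}$). For a left $\mathrm{Jord}$-module $\mathcal{L}$, the relative composition product $\mathcal{TAG}\circ_{\mathrm{Jord}}\mathcal{L}$ is the coequalizer of the two maps $\mathcal{TAG}(\mathrm{Jord}(\mathcal{L}))\rightrightarrows\mathcal{TAG}(\mathcal{L})$ given by the right action of $\mathrm{Jord}$ on $\mathcal{TAG}$ and the left action on $\mathcal{L}$, with the Lie bracket induced from $\mathcal{TAG}(\mathcal{L})$. Then there is an isomorphism of left $\mathrm{Lie}$-modules, natural in the Jordan algebra $J$, $$\mathcal{TAG}\circ_{\mathrm{Jord}}\mathsf{1}_J\cong\mathsf{1}_{\mathsf{TAG}(J)}.$$ -/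

import Mathlib

open CategoryTheory TensorProduct DirectSum

universe u

noncomputable section

/-! ### Jordan algebras and free Jordan algebras -/

namespace FreeJordan

variable (k : Type u) [Field k] (V : Type u) [AddCommGroup V] [Module k V]

/-- The relations on the free nonassociative algebra on the set `V` that define the free Jordan
algebra on the vector space `V`. -/
inductive Rel : FreeNonUnitalNonAssocAlgebra k V → FreeNonUnitalNonAssocAlgebra k V → Prop
  | of_add (v w : V) : Rel (.of k (v + w)) (.of k v + .of k w)
  | of_smul (t : k) (v : V) : Rel (.of k (t • v)) (t • .of k v)
  | comm (a b : FreeNonUnitalNonAssocAlgebra k V) : Rel (a * b) (b * a)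
  | jordan (a b : FreeNonUnitalNonAssocAlgebra k V) :
      Rel (a * b * (a * a)) (a * (b * (a * a)))
  | smul (t : k) {a b : FreeNonUnitalNonAssocAlgebra k V} : Rel a b → Rel (t • a) (t • b)
  | add_right {a b : FreeNonUnitalNonAssocAlgebra k V} (c : FreeNonUnitalNonAssocAlgebra k V) :
      Rel a b → Rel (a + c) (b + c)
  | mul_left (a : FreeNonUnitalNonAssocAlgebra k V) {b c : FreeNonUnitalNonAssocAlgebra k V} :
      Rel b c → Rel (a * b) (a * c)
  | mul_right {a b : FreeNonUnitalNonAssocAlgebra k V} (c : FreeNonUnitalNonAssocAlgebra k V) :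
      Rel a b → Rel (a * c) (b * c)

variable {k V}

theorem Rel.addLeft (a : FreeNonUnitalNonAssocAlgebra k V) {b c : FreeNonUnitalNonAssocAlgebra k V}
    (h : Rel k V b c) : Rel k V (a + b) (a + c) := by
  rw [add_comm _ b, add_comm _ c]; exact h.add_right _

theorem Rel.neg {a b : FreeNonUnitalNonAssocAlgebra k V} (h : Rel k V a b) :
    Rel k V (-a) (-b) := by
  simpa only [neg_one_smul] using h.smul (-1)

theorem Rel.subLeft (a : FreeNonUnitalNonAssocAlgebra k V) {b c : FreeNonUnitalNonAssocAlgebra k V}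
    (h : Rel k V b c) : Rel k V (a - b) (a - c) := by
  simpa only [sub_eq_add_neg] using h.neg.addLeft a

theorem Rel.subRight {a b : FreeNonUnitalNonAssocAlgebra k V}
    (c : FreeNonUnitalNonAssocAlgebra k V) (h : Rel k V a b) : Rel k V (a - c) (b - c) := by
  simpa only [sub_eq_add_neg] using h.add_right (-c)

theorem Rel.smulOfTower {S : Type*} [Monoid S] [DistribMulAction S k] [IsScalarTower S k k] (t : S)
    (a b : FreeNonUnitalNonAssocAlgebra k V) (h : Rel k V a b) : Rel k V (t • a) (t • b) := by
  rw [← smul_one_smul k t a, ← smul_one_smul k t b]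
  exact h.smul _

end FreeJordan

/-- The free (nonunital) Jordan algebra `Jord(V)` on a vector space `V`. -/
def FreeJordan (k : Type u) [Field k] (V : Type u) [AddCommGroup V] [Module k V] : Type u :=
  Quot (FreeJordan.Rel k V)

namespace FreeJordan

variable (k : Type u) [Field k] (V : Type u) [AddCommGroup V] [Module k V]

instance {S : Type*} [Monoid S] [DistribMulAction S k] [IsScalarTower S k k] :
    SMul S (FreeJordan k V) where smul t := Quot.map (t • ·) (Rel.smulOfTower t)
instance : Zero (FreeJordan k V) where zero := Quot.mk _ 0
instance : Add (FreeJordan k V) where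
  add := Quot.map₂ (· + ·) (fun _ _ _ => Rel.addLeft _) fun _ _ _ => Rel.add_right _
instance : Neg (FreeJordan k V) where neg := Quot.map Neg.neg fun _ _ => Rel.neg
instance : Sub (FreeJordan k V) where
  sub := Quot.map₂ Sub.sub (fun _ _ _ => Rel.subLeft _) fun _ _ _ => Rel.subRight _
instance : AddGroup (FreeJordan k V) :=
  Function.Surjective.addGroup (Quot.mk _) Quot.mk_surjective rfl (fun _ _ => rfl)
    (fun _ => rfl) (fun _ _ => rfl) (fun _ _ => rfl) fun _ _ => rfl
instance : AddCommSemigroup (FreeJordan k V) :=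
  Function.Surjective.addCommSemigroup (Quot.mk _) Quot.mk_surjective fun _ _ => rfl
instance : AddCommGroup (FreeJordan k V) :=
  { (inferInstance : AddGroup (FreeJordan k V)),
    (inferInstance : AddCommSemigroup (FreeJordan k V)) with }
instance : Module k (FreeJordan k V) :=
  Function.Surjective.module k ⟨⟨Quot.mk (Rel k V), rfl⟩, fun _ _ => rfl⟩
    Quot.mk_surjective (fun _ _ => rfl)
instance : Mul (FreeJordan k V) where
  mul := Quot.map₂ (· * ·) (fun _ _ _ => Rel.mul_left _) fun _ _ _ => Rel.mul_right _

instance : NonUnitalNonAssocCommRing (FreeJordan k V) :=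
  { (inferInstance : AddCommGroup (FreeJordan k V)),
    (inferInstance : Mul (FreeJordan k V)) with
    left_distrib := by
      rintro ⟨a⟩ ⟨b⟩ ⟨c⟩; exact congrArg (Quot.mk _) (mul_add a b c)
    right_distrib := by
      rintro ⟨a⟩ ⟨b⟩ ⟨c⟩; exact congrArg (Quot.mk _) (add_mul a b c)
    zero_mul := by rintro ⟨a⟩; exact congrArg (Quot.mk _) (zero_mul a)
    mul_zero := by rintro ⟨a⟩; exact congrArg (Quot.mk _) (mul_zero a)
    mul_comm := by rintro ⟨a⟩ ⟨b⟩; exact Quot.sound (Rel.comm a b) }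

instance : IsScalarTower k (FreeJordan k V) (FreeJordan k V) where
  smul_assoc := by rintro t ⟨a⟩ ⟨b⟩; exact congrArg (Quot.mk _) (smul_mul_assoc t a b)
instance : SMulCommClass k (FreeJordan k V) (FreeJordan k V) where
  smul_comm := by rintro t ⟨a⟩ ⟨b⟩; exact congrArg (Quot.mk _) (mul_smul_comm t a b).symm
instance : IsCommJordan (FreeJordan k V) where
  lmul_comm_rmul_rmul := by rintro ⟨a⟩ ⟨b⟩; exact Quot.sound (Rel.jordan a b)

/-- The inclusion of the generators `V → Jord(V)`. -/
def ι : V →ₗ[k] FreeJordan k V where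
  toFun v := Quot.mk _ (.of k v)
  map_add' v w := Quot.sound (Rel.of_add v w)
  map_smul' t v := Quot.sound (Rel.of_smul t v)

/-- The quotient map from the free nonassociative algebra. -/
def mk : FreeNonUnitalNonAssocAlgebra k V →ₙₐ[k] FreeJordan k V where
  toFun := Quot.mk _
  map_smul' _ _ := rfl
  map_zero' := rfl
  map_add' _ _ := rfl
  map_mul' _ _ := rfl

variable {k V}
variable {A : Type u} [NonUnitalNonAssocCommRing A] [Module k A] [IsScalarTower k A A]
  [SMulCommClass k A A]

theorem hom_ext {F G : FreeJordan k V →ₙₐ[k] A} (h : ∀ v, F (ι k V v) = G (ι k V v)) : F = G := by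
  have : F.comp (mk k V) = G.comp (mk k V) :=
    FreeNonUnitalNonAssocAlgebra.hom_ext k h
  ext ⟨a⟩
  exact DFunLike.congr_fun this a

variable [IsCommJordan A]

/-- The universal property of `Jord(V)`: a linear map from `V` to a Jordan algebra extends to
a homomorphism of algebras. -/
def lift (f : V →ₗ[k] A) : FreeJordan k V →ₙₐ[k] A where
  toFun c := Quot.liftOn c (FreeNonUnitalNonAssocAlgebra.lift k f) (by
    intro a b h
    induction h with
    | of_add v w => simp [FreeNonUnitalNonAssocAlgebra.lift_of_apply]
    | of_smul t v => simp [FreeNonUnitalNonAssocAlgebra.lift_of_apply]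
    | comm a b => simp [mul_comm]
    | jordan a b => simpa using IsCommJordan.lmul_comm_rmul_rmul _ _
    | smul t _ h => simp [h]
    | add_right c _ h => simp [h]
    | mul_left c _ h => simp [h]
    | mul_right c _ h => simp [h])
  map_smul' := by rintro t ⟨a⟩; exact map_smul (FreeNonUnitalNonAssocAlgebra.lift k f) t a
  map_zero' := map_zero (FreeNonUnitalNonAssocAlgebra.lift k f)
  map_add' := by rintro ⟨a⟩ ⟨b⟩; exact map_add (FreeNonUnitalNonAssocAlgebra.lift k f) a b
  map_mul' := by rintro ⟨a⟩ ⟨b⟩; exact map_mul (FreeNonUnitalNonAssocAlgebra.lift k f) a b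

@[simp]
theorem lift_ι (f : V →ₗ[k] A) (v : V) : lift f (ι k V v) = f v :=
  FreeNonUnitalNonAssocAlgebra.lift_of_apply (R := k) (f : V → A) v

/-- Substitution of generators: the homomorphism `Jord(V) → Jord(W)` induced by `V → W`. -/
def map {W : Type u} [AddCommGroup W] [Module k W] (f : V →ₗ[k] W) :
    FreeJordan k V →ₙₐ[k] FreeJordan k W :=
  lift ((ι k W).comp f)

end FreeJordan

/-- The category of Jordan algebras over `k`. -/
structure JordAlg (k : Type u) [Field k] where
  carrier : Type u
  [ring : NonUnitalNonAssocCommRing carrier]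
  [module : Module k carrier]
  [tower : IsScalarTower k carrier carrier]
  [smulComm : SMulCommClass k carrier carrier]
  [jordan : IsCommJordan carrier]

namespace JordAlg

attribute [instance] ring module tower smulComm jordan

variable (k : Type u) [Field k]

/-- Homomorphisms of Jordan algebras. -/
@[ext]
structure Hom {k : Type u} [Field k] (A B : JordAlg k) where
  hom : A.carrier →ₙₐ[k] B.carrier

instance : Category (JordAlg k) where
  Hom := Hom
  id A := ⟨NonUnitalAlgHom.id k A.carrier⟩
  comp f g := ⟨g.hom.comp f.hom⟩

variable {k} in
@[simp]
theorem id_hom (A : JordAlg k) : Hom.hom (𝟙 A) = NonUnitalAlgHom.id k A.carrier := rfl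

variable {k} in
@[simp]
theorem comp_hom {A B C : JordAlg k} (f : A ⟶ B) (g : B ⟶ C) :
    Hom.hom (f ≫ g) = (Hom.hom g).comp (Hom.hom f) := rfl

/-- The underlying vector space of a Jordan algebra. -/
def forget : JordAlg k ⥤ ModuleCat.{u} k where
  obj A := ModuleCat.of k A.carrier
  map f := ModuleCat.ofHom (f.hom : _ →ₗ[k] _)

/-- The free Jordan algebra functor `V ↦ Jord(V)`. -/
def free : ModuleCat.{u} k ⥤ JordAlg k where
  obj V := ⟨FreeJordan k V⟩
  map f := ⟨FreeJordan.map f.hom⟩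
  map_id V := Hom.ext (FreeJordan.hom_ext fun v => by simp [FreeJordan.map])
  map_comp f g := Hom.ext (FreeJordan.hom_ext fun v => by simp [FreeJordan.map])

/-- The free Jordan algebra functor is left adjoint to the forgetful functor. -/
def adj : free k ⊣ forget k :=
  Adjunction.mkOfHomEquiv
    { homEquiv V A :=
        { toFun f := ModuleCat.ofHom (FreeJordan.ι k V) ≫ (forget k).map f
          invFun g := ⟨FreeJordan.lift (A := A.carrier) g.hom⟩
          left_inv f := Hom.ext (FreeJordan.hom_ext fun v => FreeJordan.lift_ι (k := k) (A := A.carrier) _ v)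
          right_inv g := by
            ext v
            let g' : V →ₗ[k] A.carrier := g.hom
            exact FreeJordan.lift_ι g' v }
      homEquiv_naturality_left_symm {V W A} f g := Hom.ext (FreeJordan.hom_ext fun v => by
        refine (FreeJordan.lift_ι (k := k) (A := A.carrier) _ v).trans ?_
        let g' : W →ₗ[k] A.carrier := g.hom
        have h : FreeJordan.lift g' (FreeJordan.map f.hom (FreeJordan.ι k V v)) = g' (f.hom v) := by
          simp [FreeJordan.map]
        exact h.symm)
      homEquiv_naturality_right f g := rfl }

end JordAlg

/-- The Jordan operad, viewed as a monad: `V ↦ Jord(V)`, with unit `V → Jord(V)` the inclusion of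
generators and multiplication `Jord(Jord(V)) → Jord(V)` the homomorphism that is the identity on
the generators `Jord(V)`. -/
abbrev jordMonad (k : Type u) [Field k] : Monad (ModuleCat.{u} k) := (JordAlg.adj k).toMonad


/-! ### Analytic functors -/

/-- A sequence `{K(n)}` of representations of the symmetric groups `S_n`, given as a functor on the
groupoid whose objects are the sets `Fin n`, with bijections as morphisms. There are no bijections
`Fin n ≃ Fin m` unless `n = m`, so this is the same as a right `S_n`-module `K(n)` for each `n`,
with `x · σ = map σ⁻¹ x`. -/
structure SymSeq (k : Type u) [Field k] where
  obj : ℕ → Type u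
  [addCommGroup : ∀ n, AddCommGroup (obj n)]
  [module : ∀ n, Module k (obj n)]
  map : ∀ {n m : ℕ}, (Fin n ≃ Fin m) → obj n →ₗ[k] obj m
  map_refl : ∀ n, map (Equiv.refl (Fin n)) = LinearMap.id
  map_trans : ∀ {n m l : ℕ} (σ : Fin n ≃ Fin m) (τ : Fin m ≃ Fin l),
    map (σ.trans τ) = map τ ∘ₗ map σ

namespace SymSeq

attribute [instance] addCommGroup module

variable {k : Type u} [Field k] (K : SymSeq k)
  (V W X : Type u) [AddCommGroup V] [Module k V] [AddCommGroup W] [Module k W]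
  [AddCommGroup X] [Module k X]

/-- The relations `(x · σ) ⊗ v = x ⊗ (σ · v)` that define `K(n) ⊗_{k S_n} V^{⊗ n}`, written as
`map σ x ⊗ σ · v = x ⊗ v`, where `σ · v` permutes the tensor factors. -/
def coinvRel (n : ℕ) : Submodule k (K.obj n ⊗[k] (⨂[k]^n V)) :=
  Submodule.span k {z | ∃ (σ : Fin n ≃ Fin n) (x : K.obj n) (v : ⨂[k]^n V),
    z = K.map σ x ⊗ₜ PiTensorProduct.reindex k (fun _ => V) σ v - x ⊗ₜ v}

/-- The value `K(V) = ⨁ₙ K(n) ⊗_{k S_n} V^{⊗ n}` of the analytic functor of `K` on `V`. -/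
def Eval : Type u :=
  ⨁ n : ℕ, ((K.obj n ⊗[k] (⨂[k]^n V)) ⧸ K.coinvRel V n)

instance : AddCommGroup (K.Eval V) :=
  inferInstanceAs (AddCommGroup (⨁ n : ℕ, ((K.obj n ⊗[k] (⨂[k]^n V)) ⧸ K.coinvRel V n)))

instance : Module k (K.Eval V) :=
  inferInstanceAs (Module k (⨁ n : ℕ, ((K.obj n ⊗[k] (⨂[k]^n V)) ⧸ K.coinvRel V n)))

/-- The class in `K(V)` of an element of `K(n) ⊗ V^{⊗ n}`. -/
def cls (n : ℕ) : (K.obj n ⊗[k] (⨂[k]^n V)) →ₗ[k] K.Eval V :=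
  DirectSum.lof k ℕ (fun n => (K.obj n ⊗[k] (⨂[k]^n V)) ⧸ K.coinvRel V n) n ∘ₗ
    (K.coinvRel V n).mkQ

variable {K V W X}

variable (K) in
theorem cls_map {n m : ℕ} (σ : Fin n ≃ Fin m) (x : K.obj n) (v : ⨂[k]^n V) :
    K.cls V m (K.map σ x ⊗ₜ PiTensorProduct.reindex k (fun _ => V) σ v) =
      K.cls V n (x ⊗ₜ v) := by
  obtain rfl : n = m := by simpa using Fintype.card_congr σ
  have : (K.coinvRel V n).mkQ (K.map σ x ⊗ₜ PiTensorProduct.reindex k (fun _ => V) σ v) =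
      (K.coinvRel V n).mkQ (x ⊗ₜ v) :=
    (Submodule.Quotient.eq _).2 (Submodule.subset_span ⟨σ, x, v, rfl⟩)
  exact congrArg (DirectSum.lof k ℕ
    (fun n => (K.obj n ⊗[k] (⨂[k]^n V)) ⧸ K.coinvRel V n) n) this

theorem eval_ext {Y : Type*} [AddCommGroup Y] [Module k Y] {f g : K.Eval V →ₗ[k] Y}
    (h : ∀ n (x : K.obj n) (v : ⨂[k]^n V), f (K.cls V n (x ⊗ₜ v)) = g (K.cls V n (x ⊗ₜ v))) :
    f = g := by
  refine DirectSum.linearMap_ext k fun n => ?_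
  refine Submodule.linearMap_qext _ ?_
  exact TensorProduct.ext' fun x v => h n x v

theorem eval_induction {p : K.Eval V → Prop} (z : K.Eval V)
    (h : ∀ n (x : K.obj n) (v : ⨂[k]^n V), p (K.cls V n (x ⊗ₜ v)))
    (h0 : p 0) (hadd : ∀ a b, p a → p b → p (a + b)) : p z := by
  induction z using DirectSum.induction_on with
  | zero => exact h0
  | add a b ha hb => exact hadd a b ha hb
  | of n q =>
    obtain ⟨t, rfl⟩ := Submodule.Quotient.mk_surjective _ q
    change p (K.cls V n t)
    induction t with
    | zero => rw [map_zero]; exact h0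
    | tmul x v => exact h n x v
    | add a b ha hb => rw [map_add]; exact hadd _ _ ha hb

/-- A linear map out of `K(V)` is given by compatible linear maps on `K(n) ⊗ V^{⊗ n}`. -/
def evalLift {Y : Type*} [AddCommGroup Y] [Module k Y]
    (f : ∀ n, (K.obj n ⊗[k] (⨂[k]^n V)) →ₗ[k] Y)
    (hf : ∀ n (σ : Fin n ≃ Fin n) (x : K.obj n) (v : ⨂[k]^n V),
      f n (K.map σ x ⊗ₜ PiTensorProduct.reindex k (fun _ => V) σ v) = f n (x ⊗ₜ v)) :
    K.Eval V →ₗ[k] Y :=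
  DirectSum.toModule k ℕ Y fun n => (K.coinvRel V n).liftQ (f n) (by
    refine Submodule.span_le.2 ?_
    rintro _ ⟨σ, x, v, rfl⟩
    simp [hf])

@[simp]
theorem evalLift_cls {Y : Type*} [AddCommGroup Y] [Module k Y]
    (f : ∀ n, (K.obj n ⊗[k] (⨂[k]^n V)) →ₗ[k] Y) (hf) (n : ℕ) (t : K.obj n ⊗[k] (⨂[k]^n V)) :
    evalLift f hf (K.cls V n t) = f n t := by
  exact DirectSum.toModule_lof k n _

variable (K) in
/-- The map `K(V) → K(W)` induced by a linear map `V → W`. -/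
def evalMap (f : V →ₗ[k] W) : K.Eval V →ₗ[k] K.Eval W :=
  evalLift (K := K) (fun n => K.cls W n ∘ₗ
      TensorProduct.map LinearMap.id (PiTensorProduct.map fun _ => f)) (by
    intro n σ x v
    simp only [LinearMap.comp_apply, TensorProduct.map_tmul, LinearMap.id_apply]
    rw [← K.cls_map σ x]
    congr 2
    have := PiTensorProduct.map_reindex (R := k) (fun _ : Fin n => f) σ v
    exact this)

@[simp]
theorem evalMap_cls (f : V →ₗ[k] W) (n : ℕ) (x : K.obj n) (v : ⨂[k]^n V) :
    K.evalMap f (K.cls V n (x ⊗ₜ v)) =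
      K.cls W n (x ⊗ₜ PiTensorProduct.map (fun _ => f) v) := by
  simp [evalMap]

variable (K) in
/-- The analytic functor `V ↦ K(V)` associated to `K`. -/
def functor : ModuleCat.{u} k ⥤ ModuleCat.{u} k where
  obj V := ModuleCat.of k (K.Eval V)
  map f := ModuleCat.ofHom (K.evalMap f.hom)
  map_id V := by
    refine ModuleCat.hom_ext (eval_ext fun n x v => ?_)
    simp [PiTensorProduct.map_id]
  map_comp f g := by
    refine ModuleCat.hom_ext (eval_ext fun n x v => ?_)
    simp [PiTensorProduct.map_comp]

end SymSeq

/-! ### Twisted Lie algebras -/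

/-- The category of Lie algebras over `k`. -/
structure LieAlgs (k : Type u) [Field k] where
  carrier : Type u
  [lieRing : LieRing carrier]
  [lieAlgebra : LieAlgebra k carrier]

namespace LieAlgs

attribute [instance] lieRing lieAlgebra

variable {k : Type u} [Field k]

/-- Homomorphisms of Lie algebras. -/
@[ext]
structure Hom (A B : LieAlgs k) where
  hom : A.carrier →ₗ⁅k⁆ B.carrier

instance : Category (LieAlgs k) where
  Hom := Hom
  id A := ⟨LieHom.id⟩
  comp f g := ⟨g.hom.comp f.hom⟩

@[simp]
theorem id_hom (A : LieAlgs k) : Hom.hom (𝟙 A) = LieHom.id := rfl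

@[simp]
theorem comp_hom {A B C : LieAlgs k} (f : A ⟶ B) (g : B ⟶ C) :
    Hom.hom (f ≫ g) = (Hom.hom g).comp (Hom.hom f) := rfl

end LieAlgs

/-- The juxtaposition `Fin (n + m) ≃ Fin (n' + m')` of two bijections; for permutations it is the
inclusion `S_n × S_m → S_{n + m}`. -/
def finSumCongr {n n' m m' : ℕ} (σ : Fin n ≃ Fin n') (τ : Fin m ≃ Fin m') :
    Fin (n + m) ≃ Fin (n' + m') :=
  finSumFinEquiv.symm.trans ((Equiv.sumCongr σ τ).trans finSumFinEquiv)

/-- The block permutation that moves the first block past the other two. -/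
def finRotL (n m p : ℕ) : Fin (m + (p + n)) ≃ Fin (n + (m + p)) :=
  (finCongr (Nat.add_assoc m p n).symm).trans finAddFlip

/-- The block permutation that moves the last block past the other two. -/
def finRotR (n m p : ℕ) : Fin (p + (n + m)) ≃ Fin (n + (m + p)) :=
  finAddFlip.trans (finCongr (Nat.add_assoc n m p))

/-- A twisted Lie algebra: a Lie algebra in the symmetric monoidal category of analytic functors
with the Cauchy product. It is given by `S_n × S_m`-equivariant brackets
`g(n) ⊗ g(m) → g(n + m)` which satisfy skew-symmetry and the Jacobi identity, where block
permutations put the arguments back in the original order. -/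
structure TwistedLie (k : Type u) [Field k] extends SymSeq k where
  bracket : ∀ n m, obj n →ₗ[k] obj m →ₗ[k] obj (n + m)
  equivariant : ∀ {n n' m m' : ℕ} (σ : Fin n ≃ Fin n') (τ : Fin m ≃ Fin m') (x : obj n) (y : obj m),
    bracket n' m' (map σ x) (map τ y) = map (finSumCongr σ τ) (bracket n m x y)
  skew : ∀ {n m : ℕ} (x : obj n) (y : obj m),
    bracket n m x y = - map finAddFlip (bracket m n y x)
  jacobi : ∀ {n m p : ℕ} (x : obj n) (y : obj m) (z : obj p),
    bracket n (m + p) x (bracket m p y z)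
      + map (finRotL n m p) (bracket m (p + n) y (bracket p n z x))
      + map (finRotR n m p) (bracket p (n + m) z (bracket n m x y)) = 0

namespace TwistedLie

variable {k : Type u} [Field k] (g : TwistedLie k)
  (V W : Type u) [AddCommGroup V] [Module k V] [AddCommGroup W] [Module k W]

/-- The concatenation product `V^{⊗ n} ⊗ V^{⊗ m} → V^{⊗ (n + m)}`. -/
def tmulMap (n m : ℕ) : (⨂[k]^n V) →ₗ[k] (⨂[k]^m V) →ₗ[k] (⨂[k]^(n + m) V) :=
  (TensorProduct.mk k _ _).compr₂ (TensorPower.mulEquiv (R := k) (M := V) (n := n) (m := m))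

variable {V} in
theorem tmulMap_tprod {n m : ℕ} (v : Fin n → V) (w : Fin m → V) :
    tmulMap (k := k) V n m (PiTensorProduct.tprod k v) (PiTensorProduct.tprod k w) =
      PiTensorProduct.tprod k (Fin.append v w) :=
  TensorPower.tprod_mul_tprod k v w

/-- Two linear maps on a tensor power agree if they agree on pure tensors. -/
theorem pi_induction {n : ℕ} {p : (⨂[k]^n V) → Prop} (z : ⨂[k]^n V)
    (h : ∀ (c : k) (v : Fin n → V), p (c • PiTensorProduct.tprod k v))
    (hadd : ∀ a b, p a → p b → p (a + b)) : p z :=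
  PiTensorProduct.induction_on z h hadd

variable {V} in
theorem tmulMap_reindex {n n' m m' : ℕ} (σ : Fin n ≃ Fin n') (τ : Fin m ≃ Fin m')
    (v : ⨂[k]^n V) (w : ⨂[k]^m V) :
    tmulMap V n' m' (PiTensorProduct.reindex k (fun _ => V) σ v)
        (PiTensorProduct.reindex k (fun _ => V) τ w) =
      PiTensorProduct.reindex k (fun _ => V) (finSumCongr σ τ) (tmulMap V n m v w) := by
  induction v using PiTensorProduct.induction_on with
  | add a b ha hb => simp only [map_add, LinearMap.add_apply, ha, hb]
  | smul_tprod c v =>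
    induction w using PiTensorProduct.induction_on with
    | add a b ha hb => simp only [map_add, ha, hb]
    | smul_tprod d w =>
      simp only [map_smul, LinearMap.smul_apply, PiTensorProduct.reindex_tprod, tmulMap_tprod]
      congr 3
      ext i
      obtain ⟨i, rfl⟩ := finSumFinEquiv.surjective i
      rcases i with i | i <;> simp [finSumCongr, Fin.append_left, Fin.append_right]

variable {V} in
theorem tmulMap_flip {n m : ℕ} (v : ⨂[k]^n V) (w : ⨂[k]^m V) :
    PiTensorProduct.reindex k (fun _ => V) finAddFlip (tmulMap V n m v w) = tmulMap V m n w v := by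
  induction v using PiTensorProduct.induction_on with
  | add a b ha hb => simp only [map_add, LinearMap.add_apply, ha, hb]
  | smul_tprod c v =>
    induction w using PiTensorProduct.induction_on with
    | add a b ha hb => simp only [map_add, LinearMap.add_apply, ha, hb]
    | smul_tprod d w =>
      simp only [map_smul, LinearMap.smul_apply, PiTensorProduct.reindex_tprod, tmulMap_tprod,
        smul_comm d c]
      congr 3
      ext i
      obtain ⟨i, rfl⟩ := finSumFinEquiv.surjective i
      rcases i with i | i <;> simp [finAddFlip, Fin.append_left, Fin.append_right]

variable {V} in
theorem tmulMap_assoc {n m p : ℕ} (u : ⨂[k]^n V) (v : ⨂[k]^m V) (w : ⨂[k]^p V) :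
    PiTensorProduct.reindex k (fun _ => V) (finCongr (Nat.add_assoc n m p))
      (tmulMap V (n + m) p (tmulMap V n m u v) w) = tmulMap V n (m + p) u (tmulMap V m p v w) :=
  TensorPower.mul_assoc u v w

variable {V W} in
theorem tmulMap_map (f : V →ₗ[k] W) {n m : ℕ} (v : ⨂[k]^n V) (w : ⨂[k]^m V) :
    PiTensorProduct.map (fun _ => f) (tmulMap V n m v w) =
      tmulMap W n m (PiTensorProduct.map (fun _ => f) v) (PiTensorProduct.map (fun _ => f) w) := by
  induction v using PiTensorProduct.induction_on with
  | add a b ha hb => simp only [map_add, LinearMap.add_apply, ha, hb]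
  | smul_tprod c v =>
    induction w using PiTensorProduct.induction_on with
    | add a b ha hb => simp only [map_add, ha, hb]
    | smul_tprod d w =>
      simp only [map_smul, LinearMap.smul_apply, PiTensorProduct.map_tprod, tmulMap_tprod]
      congr 3
      ext i
      obtain ⟨i, rfl⟩ := finSumFinEquiv.surjective i
      rcases i with i | i <;> simp [Fin.append_left, Fin.append_right]

/-- The bracket on `g(V)` induced by the twisted Lie algebra structure on `g`:
`[x ⊗ v, y ⊗ w] = [x, y] ⊗ (v ⊗ w)`. -/
def evalBracket : g.Eval V →ₗ[k] g.Eval V →ₗ[k] g.Eval V :=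
  SymSeq.evalLift (K := g.toSymSeq) (fun n => LinearMap.flip (SymSeq.evalLift (K := g.toSymSeq)
    (fun m => (LinearMap.flip
      ((TensorProduct.map₂ (g.bracket n m) (tmulMap V n m)).compr₂ (g.cls V (n + m)))))
    (by
      intro m σ y w
      refine TensorProduct.ext' fun x v => ?_
      simp only [LinearMap.flip_apply, LinearMap.compr₂_apply, TensorProduct.map₂_apply_tmul]
      have h := g.equivariant (Equiv.refl (Fin n)) σ x y
      have h' := tmulMap_reindex (k := k) (Equiv.refl (Fin n)) σ v w
      rw [g.map_refl, LinearMap.id_apply] at h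
      rw [PiTensorProduct.reindex_refl, LinearEquiv.refl_apply] at h'
      rw [TensorProduct.map_tmul, TensorProduct.map_tmul, h, h', g.cls_map])))
    (by
      intro n σ x v
      refine SymSeq.eval_ext fun m y w => ?_
      simp only [LinearMap.flip_apply, SymSeq.evalLift_cls, LinearMap.compr₂_apply,
        TensorProduct.map₂_apply_tmul]
      have h := g.equivariant σ (Equiv.refl (Fin m)) x y
      have h' := tmulMap_reindex (k := k) σ (Equiv.refl (Fin m)) v w
      rw [g.map_refl, LinearMap.id_apply] at h
      rw [PiTensorProduct.reindex_refl, LinearEquiv.refl_apply] at h'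
      rw [TensorProduct.map_tmul, TensorProduct.map_tmul, h, h', g.cls_map])

variable {V} in
@[simp]
theorem evalBracket_cls {n m : ℕ} (x : g.obj n) (v : ⨂[k]^n V) (y : g.obj m) (w : ⨂[k]^m V) :
    g.evalBracket V (g.cls V n (x ⊗ₜ v)) (g.cls V m (y ⊗ₜ w)) =
      g.cls V (n + m) (g.bracket n m x y ⊗ₜ tmulMap V n m v w) := by
  simp [evalBracket]

theorem evalBracket_skew (a b : g.Eval V) : g.evalBracket V a b = - g.evalBracket V b a := by
  induction a using SymSeq.eval_induction with
  | h0 => simp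
  | hadd a a' ha ha' => simp only [map_add, LinearMap.add_apply, ha, ha', neg_add_rev, add_comm]
  | h n x v =>
    induction b using SymSeq.eval_induction with
    | h0 => simp
    | hadd a a' ha ha' => simp only [map_add, LinearMap.add_apply, ha, ha', neg_add_rev, add_comm]
    | h m y w =>
      rw [evalBracket_cls, evalBracket_cls, g.skew x y, ← tmulMap_flip w v, TensorProduct.neg_tmul,
        map_neg, g.cls_map]

theorem evalBracket_jacobi (a b c : g.Eval V) :
    g.evalBracket V a (g.evalBracket V b c) + g.evalBracket V b (g.evalBracket V c a)
      + g.evalBracket V c (g.evalBracket V a b) = 0 := by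
  have key (P Q R P' Q' R' : g.Eval V) (h : P + Q + R = 0) (h' : P' + Q' + R' = 0) :
      (P + P') + (Q + Q') + (R + R') = 0 := by
    rw [← add_zero (0 : g.Eval V)]; nth_rewrite 1 [← h]; rw [← h']; abel
  induction a using SymSeq.eval_induction with
  | h0 => simp
  | hadd a a' ha ha' => 
    simp only [map_add, LinearMap.add_apply]
    exact key _ _ _ _ _ _ ha ha'
  | h n x u =>
  induction b using SymSeq.eval_induction with
  | h0 => simp
  | hadd a a' ha ha' =>
    simp only [map_add, LinearMap.add_apply]
    exact key _ _ _ _ _ _ ha ha'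
  | h m y v =>
  induction c using SymSeq.eval_induction with
  | h0 => simp
  | hadd a a' ha ha' =>
    simp only [map_add, LinearMap.add_apply]
    exact key _ _ _ _ _ _ ha ha'
  | h p z w =>
  simp only [evalBracket_cls]
  have h1 : PiTensorProduct.reindex k (fun _ => V) (finRotL n m p)
      (tmulMap V m (p + n) v (tmulMap V p n w u)) = tmulMap V n (m + p) u (tmulMap V m p v w) := by
    rw [← tmulMap_flip (tmulMap V m p v w) u, ← tmulMap_assoc v w u, finRotL,
      ← PiTensorProduct.reindex_trans]
    simp only [LinearEquiv.trans_apply]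
    congr 1
    exact (PiTensorProduct.reindex k (fun _ => V) (finCongr (Nat.add_assoc m p n))).symm_apply_apply
      (tmulMap V (m + p) n (tmulMap V m p v w) u)
  have h2 : PiTensorProduct.reindex k (fun _ => V) (finRotR n m p)
      (tmulMap V p (n + m) w (tmulMap V n m u v)) = tmulMap V n (m + p) u (tmulMap V m p v w) := by
    rw [← tmulMap_assoc u v w, ← tmulMap_flip w (tmulMap V n m u v), finRotR,
      ← PiTensorProduct.reindex_trans]
    rfl
  rw [← g.cls_map (finRotL n m p), ← g.cls_map (finRotR n m p), h1, h2,
    ← map_add, ← map_add, ← TensorProduct.add_tmul, ← TensorProduct.add_tmul, g.jacobi,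
    TensorProduct.zero_tmul, map_zero]

variable [CharZero k]

theorem evalBracket_self (a : g.Eval V) : g.evalBracket V a a = 0 := by
  have h := g.evalBracket_skew V a a
  have h2 : (2 : k) • g.evalBracket V a a = 0 := by
    rw [two_smul]; nth_rewrite 1 [h]; simp
  exact (smul_eq_zero.1 h2).resolve_left two_ne_zero

/-- The Lie algebra structure on `g(V)` induced by the twisted Lie algebra structure on `g`. -/
instance : LieRing (g.Eval V) where
  bracket a b := g.evalBracket V a b
  add_lie a b c := by simp only [map_add, LinearMap.add_apply]
  lie_add a b c := map_add _ _ _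
  lie_self a := g.evalBracket_self V a
  leibniz_lie a b c := by
    have h := g.evalBracket_jacobi V a b c
    rw [g.evalBracket_skew V c (g.evalBracket V a b), g.evalBracket_skew V c a, map_neg] at h
    rw [← sub_eq_zero]
    refine Eq.trans ?_ h
    abel

instance : LieAlgebra k (g.Eval V) where
  lie_smul _ _ _ := map_smul _ _ _

variable {V W} in
theorem evalMap_bracket (f : V →ₗ[k] W) (a b : g.Eval V) :
    g.evalMap f ⁅a, b⁆ = ⁅g.evalMap f a, g.evalMap f b⁆ := by
  change g.evalMap f (g.evalBracket V a b) = g.evalBracket W (g.evalMap f a) (g.evalMap f b)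
  induction a using SymSeq.eval_induction with
  | h0 => simp
  | hadd a a' ha ha' => simp only [map_add, LinearMap.add_apply, ha, ha']
  | h n x v =>
    induction b using SymSeq.eval_induction with
    | h0 => simp
    | hadd a a' ha ha' => simp only [map_add, ha, ha']
    | h m y w => simp [tmulMap_map]

/-- A twisted Lie algebra `g` gives the functor `V ↦ g(V)` from vector spaces to Lie algebras. -/
def lieFunctor : ModuleCat.{u} k ⥤ LieAlgs k where
  obj V := ⟨g.Eval V⟩
  map f := ⟨{ g.evalMap f.hom with map_lie' := g.evalMap_bracket f.hom _ _ }⟩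
  map_id V := LieAlgs.Hom.ext <| LieHom.ext fun a =>
    LinearMap.congr_fun (congrArg ModuleCat.Hom.hom (g.functor.map_id V)) a
  map_comp f f' := LieAlgs.Hom.ext <| LieHom.ext fun a =>
    LinearMap.congr_fun (congrArg ModuleCat.Hom.hom (g.functor.map_comp f f')) a

end TwistedLie

/-! ### The Tits-Allison-Gao Lie algebra of a Jordan algebra -/

section Sl2

attribute [local instance 100] LieRing.ofAssociativeRing

/-- The Lie algebra `sl₂` of traceless `2 × 2` matrices. -/
def Sl2 (k : Type u) [Field k] : Type u := LieAlgebra.SpecialLinear.sl (Fin 2) k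

namespace Sl2

variable (k : Type u) [Field k]

instance : LieRing (Sl2 k) := inferInstanceAs (LieRing (LieAlgebra.SpecialLinear.sl (Fin 2) k))
instance : LieAlgebra k (Sl2 k) :=
  inferInstanceAs (LieAlgebra k (LieAlgebra.SpecialLinear.sl (Fin 2) k))

theorem lie_val (x y : Sl2 k) : ⁅x, y⁆.1 = x.1 * y.1 - y.1 * x.1 := rfl
theorem add_val (x y : Sl2 k) : (x + y).1 = x.1 + y.1 := rfl
theorem sub_val (x y : Sl2 k) : (x - y).1 = x.1 - y.1 := rfl
theorem smul_val (c : k) (x : Sl2 k) : (c • x).1 = c • x.1 := rfl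

/-- The Lie bracket of `sl₂` as a bilinear map. -/
def lieBilin : Sl2 k →ₗ[k] Sl2 k →ₗ[k] Sl2 k :=
  LinearMap.mk₂ k (fun x y => ⁅x, y⁆) add_lie smul_lie lie_add (fun c x y => lie_smul c x y)

/-- The invariant form `½ tr(ad x ad y)` on `sl₂`, half of the Killing form. -/
def form : Sl2 k →ₗ[k] Sl2 k →ₗ[k] k := (1 / 2 : k) • killingForm k (Sl2 k)

variable {k}

theorem apply_one_one (x : Sl2 k) : x.1 1 1 = - x.1 0 0 := by
  have h : Matrix.trace x.1 = 0 := x.2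
  rw [Matrix.trace_fin_two] at h
  linear_combination h

variable (k) in
/-- Coordinates on `sl₂`. -/
def coord : Sl2 k ≃ₗ[k] (Fin 3 → k) where
  toFun x := ![x.1 0 0, x.1 0 1, x.1 1 0]
  map_add' x y := by ext i; fin_cases i <;> simp [add_val]
  map_smul' c x := by ext i; fin_cases i <;> simp [smul_val]
  invFun v := ⟨!![v 0, v 1; v 2, - v 0], by
    change Matrix.trace (n := Fin 2) (R := k) _ = 0
    rw [Matrix.trace_fin_two]; simp⟩
  left_inv x := by
    apply Subtype.ext
    ext i j; fin_cases i <;> fin_cases j <;> simp [apply_one_one]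
  right_inv v := by ext i; fin_cases i <;> simp

theorem coord_apply (x : Sl2 k) : coord k x = ![x.1 0 0, x.1 0 1, x.1 1 0] := rfl
theorem coord_symm_val (v : Fin 3 → k) : ((coord k).symm v).1 = !![v 0, v 1; v 2, - v 0] := rfl

theorem form_apply [CharZero k] (x y : Sl2 k) : form k x y = 2 * Matrix.trace (x.1 * y.1) := by
  have h : killingForm k (Sl2 k) x y = 4 * Matrix.trace (x.1 * y.1) := by
    rw [killingForm_apply_apply,
      LinearMap.trace_eq_matrix_trace k (Module.Basis.ofEquivFun (coord k)), Matrix.trace_fin_three]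
    simp only [LinearMap.toMatrix_apply, Module.Basis.coe_ofEquivFun, Module.Basis.ofEquivFun_repr_apply,
      LinearMap.comp_apply, LieAlgebra.ad_apply, coord_apply, lie_val, coord_symm_val]
    simp [Matrix.mul_apply, Matrix.trace_fin_two, Fin.sum_univ_two, apply_one_one,
      Matrix.vecMul, dotProduct]
    ring
  simp only [form, LinearMap.smul_apply, smul_eq_mul, h]
  ring

theorem form_comm [CharZero k] (x y : Sl2 k) : form k x y = form k y x := by
  rw [form_apply, form_apply, Matrix.trace_mul_comm]

theorem form_lie [CharZero k] (x y z : Sl2 k) : form k x ⁅y, z⁆ = form k y ⁅z, x⁆ := by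
  simp only [form_apply, lie_val, Matrix.mul_sub, Matrix.trace_sub]
  simp [Matrix.mul_apply, Matrix.trace_fin_two, Fin.sum_univ_two, apply_one_one]
  ring

theorem lie_lie_eq [CharZero k] (x y z : Sl2 k) :
    ⁅x, ⁅y, z⁆⁆ = form k x y • z - form k x z • y := by
  apply Subtype.ext
  simp only [form_apply, lie_val, sub_val, smul_val]
  ext i j
  fin_cases i <;> fin_cases j <;>
    simp [Matrix.mul_apply, Matrix.trace_fin_two, Fin.sum_univ_two, apply_one_one] <;> ring

end Sl2

end Sl2

set_option linter.unusedSectionVars false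

namespace JordanLie

theorem jordan_linearized (k : Type u) [Field k] [CharZero k] {J : Type u}
    [NonUnitalNonAssocCommRing J] [Module k J] [IsCommJordan J] (a b c d : J) :
    (a * (b * c * d) - b * c * (a * d)) + (b * (c * a * d) - c * a * (b * d))
      + (c * (a * b * d) - a * b * (c * d)) = 0 := by
  have h := DFunLike.congr_fun (two_nsmul_lie_lmul_lmul_add_add_eq_zero a b c) d
  have h2 : ((2 : ℕ) : k) • ((a * (b * c * d) - b * c * (a * d)) + (b * (c * a * d) - c * a * (b * d))
      + (c * (a * b * d) - a * b * (c * d))) = 0 := by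
    rw [Nat.cast_smul_eq_nsmul]
    exact h
  exact (smul_eq_zero.1 h2).resolve_left (by norm_num)

variable (k : Type u) [Field k] (J : Type u) [NonUnitalNonAssocCommRing J] [Module k J]
  [IsScalarTower k J J] [SMulCommClass k J J]

/-- The operators `D_{a,b} = [L_a, L_b]`, that is `D_{a,b}(c) = a(bc) - b(ac)`. -/
def D : J →ₗ[k] J →ₗ[k] Module.End k J :=
  (LinearMap.mul k (Module.End k J)).compl₁₂ (LinearMap.mul k J) (LinearMap.mul k J) -
    ((LinearMap.mul k (Module.End k J)).compl₁₂ (LinearMap.mul k J) (LinearMap.mul k J)).flip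

variable {k J} in
@[simp]
theorem D_apply (a b c : J) : D k J a b c = a * (b * c) - b * (a * c) := by
  simp [D]

/-- The subspace of `J ⊗ J` spanned by `a ⊗ a` and `ab ⊗ c + bc ⊗ a + ca ⊗ b`. -/
def wedgeRel : Submodule k (J ⊗[k] J) :=
  Submodule.span k
    ({z | ∃ a : J, z = a ⊗ₜ a} ∪
      {z | ∃ a b c : J, z = (a * b) ⊗ₜ c + (b * c) ⊗ₜ a + (c * a) ⊗ₜ b})

/-- The vector space `B(J) = Λ²(J) / (ab ∧ c + bc ∧ a + ca ∧ b)`, as a quotient of `J ⊗ J`. -/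
def B : Type u := (J ⊗[k] J) ⧸ wedgeRel k J

instance : AddCommGroup (B k J) := inferInstanceAs (AddCommGroup ((J ⊗[k] J) ⧸ wedgeRel k J))
instance : Module k (B k J) := inferInstanceAs (Module k ((J ⊗[k] J) ⧸ wedgeRel k J))

/-- The quotient map `J ⊗ J → B(J)`. -/
def mkB : J ⊗[k] J →ₗ[k] B k J := (wedgeRel k J).mkQ

/-- The element `a ∧ b` of `B(J)`. -/
def wedge : J →ₗ[k] J →ₗ[k] B k J := (TensorProduct.mk k J J).compr₂ (mkB k J)

variable {k J}

theorem mkB_tmul (a b : J) : mkB k J (a ⊗ₜ b) = wedge k J a b := rfl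

theorem wedge_self (a : J) : wedge k J a a = 0 :=
  (Submodule.Quotient.mk_eq_zero _).2 (Submodule.subset_span (Or.inl ⟨a, rfl⟩))

theorem wedge_skew (a b : J) : wedge k J a b = - wedge k J b a := by
  have h := wedge_self (k := k) (a + b)
  simp only [map_add, LinearMap.add_apply, wedge_self, zero_add, add_zero] at h
  rw [add_comm] at h
  exact eq_neg_of_add_eq_zero_left h

theorem wedge_cyclic (a b c : J) :
    wedge k J (a * b) c + wedge k J (b * c) a + wedge k J (c * a) b = 0 :=
  (Submodule.Quotient.mk_eq_zero _).2 (Submodule.subset_span (Or.inr ⟨a, b, c, rfl⟩))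

theorem B_induction {p : B k J → Prop} (z : B k J) (h : ∀ a b, p (wedge k J a b)) (h0 : p 0)
    (hadd : ∀ a b, p a → p b → p (a + b)) : p z := by
  obtain ⟨t, rfl⟩ := Submodule.Quotient.mk_surjective _ z
  change p (mkB k J t)
  induction t with
  | zero => rw [map_zero]; exact h0
  | tmul x v => exact h x v
  | add a b ha hb => rw [map_add]; exact hadd _ _ ha hb

theorem B_ext {Y : Type*} [AddCommGroup Y] [Module k Y] {f g : B k J →ₗ[k] Y}
    (h : ∀ a b, f (wedge k J a b) = g (wedge k J a b)) : f = g := by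
  ext z
  induction z using B_induction with
  | h a b => exact h a b
  | h0 => simp
  | hadd a b ha hb => simp [ha, hb]

/-- A linear map out of `B(J)`. -/
def liftB {Y : Type*} [AddCommGroup Y] [Module k Y] (f : J →ₗ[k] J →ₗ[k] Y)
    (h1 : ∀ a, f a a = 0) (h2 : ∀ a b c, f (a * b) c + f (b * c) a + f (c * a) b = 0) :
    B k J →ₗ[k] Y :=
  (wedgeRel k J).liftQ (TensorProduct.lift f) (by
    refine Submodule.span_le.2 ?_
    rintro _ (⟨a, rfl⟩ | ⟨a, b, c, rfl⟩)
    · simp [h1]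
    · simp [h2])

@[simp]
theorem liftB_wedge {Y : Type*} [AddCommGroup Y] [Module k Y] (f : J →ₗ[k] J →ₗ[k] Y)
    (h1) (h2) (a b : J) : liftB f h1 h2 (wedge k J a b) = f a b := by
  change TensorProduct.lift f (a ⊗ₜ b) = _
  simp

section Functoriality

variable {J' : Type u} [NonUnitalNonAssocCommRing J'] [Module k J']
  [IsScalarTower k J' J'] [SMulCommClass k J' J']

/-- The map `B(J) → B(J')` induced by a homomorphism `J → J'`. -/
def mapB (f : J →ₙₐ[k] J') : B k J →ₗ[k] B k J' :=
  liftB ((wedge k J').compl₁₂ (f : J →ₗ[k] J') (f : J →ₗ[k] J')) (fun a => wedge_self _)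
    (fun a b c => by simpa using wedge_cyclic (k := k) (f a) (f b) (f c))

@[simp]
theorem mapB_wedge (f : J →ₙₐ[k] J') (a b : J) :
    mapB f (wedge k J a b) = wedge k J' (f a) (f b) := by
  exact liftB_wedge _ _ _ a b

end Functoriality

variable [IsCommJordan J] [CharZero k]

variable (k J) in
/-- The linear map `B(J) → End(J)` with `a ∧ b ↦ D_{a,b}`. -/
def DB : B k J →ₗ[k] Module.End k J :=
  liftB (D k J) (fun a => by ext; simp) (fun a b c => by
    ext d
    have h := jordan_linearized k a b c d
    simp only [LinearMap.add_apply, D_apply, LinearMap.zero_apply]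
    rw [← neg_eq_zero, ← h]
    abel)

theorem DB_wedge (a b : J) : DB k J (wedge k J a b) = D k J a b := liftB_wedge _ _ _ a b

theorem D_mul (a b c d : J) : D k J a b (c * d) = D k J a b c * d + c * D k J a b d := by
  have h1 := jordan_linearized k a c d b
  have h2 := jordan_linearized k b c d a
  simp only [D_apply, mul_sub, sub_mul]
  simp only [mul_comm] at h1 h2 ⊢
  rw [← sub_eq_zero, ← sub_eq_zero.2 (h1.trans h2.symm)]
  abel

end JordanLie

namespace JordanLie

variable {k : Type u} [Field k] {J : Type u} [NonUnitalNonAssocCommRing J] [Module k J]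
  [IsScalarTower k J J] [SMulCommClass k J J]

variable (k J) in
/-- `d ↦ d ⊗ 1 + 1 ⊗ d` -/
def leibnizTensor : Module.End k J →ₗ[k] (J ⊗[k] J →ₗ[k] J ⊗[k] J) :=
  LinearMap.rTensorHom J + LinearMap.lTensorHom J

@[simp]
theorem leibnizTensor_tmul (d : Module.End k J) (a b : J) :
    leibnizTensor k J d (a ⊗ₜ b) = d a ⊗ₜ b + a ⊗ₜ d b := by
  simp [leibnizTensor]

/-- The endomorphism `a ∧ b ↦ d(a) ∧ b + a ∧ d(b)` of `B(J)` given by a derivation `d` of `J`. -/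
def derB (d : Module.End k J) (hd : ∀ a b, d (a * b) = d a * b + a * d b) :
    B k J →ₗ[k] B k J :=
  (wedgeRel k J).liftQ (mkB k J ∘ₗ leibnizTensor k J d) (by
    refine Submodule.span_le.2 ?_
    rintro _ (⟨a, rfl⟩ | ⟨a, b, c, rfl⟩)
    · simp only [SetLike.mem_coe, LinearMap.mem_ker, LinearMap.comp_apply, leibnizTensor_tmul,
        map_add, mkB_tmul]
      rw [wedge_skew]; simp
    · simp only [SetLike.mem_coe, LinearMap.mem_ker, LinearMap.comp_apply, leibnizTensor_tmul,
        map_add, mkB_tmul, hd, LinearMap.add_apply]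
      have h1 := wedge_cyclic (k := k) (d a) b c
      have h2 := wedge_cyclic (k := k) a (d b) c
      have h3 := wedge_cyclic (k := k) a b (d c)
      calc _ = (wedge k J (d a * b) c + wedge k J (b * c) (d a) + wedge k J (c * d a) b)
        + (wedge k J (a * d b) c + wedge k J (d b * c) a + wedge k J (c * a) (d b))
        + (wedge k J (a * b) (d c) + wedge k J (b * d c) a + wedge k J (d c * a) b) := by abel
        _ = 0 := by rw [h1, h2, h3]; simp)

@[simp]
theorem derB_wedge (d : Module.End k J) (hd) (a b : J) :
    derB d hd (wedge k J a b) = wedge k J (d a) b + wedge k J a (d b) := by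
  change mkB k J (leibnizTensor k J d (a ⊗ₜ b)) = _
  simp [mkB_tmul]

variable [IsCommJordan J] [CharZero k]

theorem DB_mul (ω : B k J) (a b : J) :
    DB k J ω (a * b) = DB k J ω a * b + a * DB k J ω b := by
  induction ω using B_induction with
  | h c d => simp only [DB_wedge]; exact D_mul c d a b
  | h0 => simp
  | hadd a b ha hb => simp only [map_add, LinearMap.add_apply, ha, hb, add_mul, mul_add]; abel

variable (k J) in
/-- The bilinear bracket on `B(J)`, `[a ∧ b, c ∧ d] = D_{a,b}(c) ∧ d + c ∧ D_{a,b}(d)`. -/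
def brB : B k J →ₗ[k] B k J →ₗ[k] B k J where
  toFun ω := derB (DB k J ω) (DB_mul ω)
  map_add' ω η := B_ext fun a b => by
    simp only [derB_wedge, map_add, LinearMap.add_apply]; abel
  map_smul' c ω := B_ext fun a b => by
    simp only [derB_wedge, map_smul, LinearMap.smul_apply, RingHom.id_apply, smul_add]

theorem brB_wedge (ω : B k J) (a b : J) :
    brB k J ω (wedge k J a b) = wedge k J (DB k J ω a) b + wedge k J a (DB k J ω b) :=
  derB_wedge _ (DB_mul ω) _ _

theorem wedge_cyclic' (a b c : J) :
    wedge k J (a * b) c = wedge k J a (b * c) + wedge k J b (a * c) := by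
  have h := wedge_cyclic (k := k) a b c
  rw [wedge_skew (b * c) a, wedge_skew (c * a) b, mul_comm c a] at h
  rw [← sub_eq_zero, ← h]; abel

theorem brB_skew (ω η : B k J) : brB k J ω η = - brB k J η ω := by
  induction ω using B_induction with
  | h0 => simp
  | hadd a b ha hb => simp only [map_add, LinearMap.add_apply, ha, hb]; abel
  | h a b =>
  induction η using B_induction with
  | h0 => simp
  | hadd a b ha hb => simp only [map_add, LinearMap.add_apply, ha, hb]; abel
  | h c d =>
    simp only [brB_wedge, DB_wedge, D_apply, map_sub, LinearMap.sub_apply]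
    rw [wedge_cyclic' a (b * c) d, wedge_cyclic' b (a * c) d, wedge_skew (c * (d * a)) b,
      wedge_skew (d * (c * a)) b, wedge_skew c (a * (b * d)), wedge_skew c (b * (a * d)),
      wedge_cyclic' a (b * d) c, wedge_cyclic' b (a * d) c,
      wedge_skew (b * c) (a * d), wedge_skew (a * c) (b * d)]
    simp only [mul_comm]
    abel

theorem DB_brB (ω η : B k J) (a : J) :
    DB k J (brB k J ω η) a = DB k J ω (DB k J η a) - DB k J η (DB k J ω a) := by
  induction η using B_induction with
  | h0 => simp
  | hadd a b ha hb => simp only [map_add, LinearMap.add_apply, ha, hb]; abel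
  | h c d =>
    simp only [brB_wedge, map_add, DB_wedge, LinearMap.add_apply, D_apply, map_sub, DB_mul, mul_add]
    abel

theorem brB_leibniz (ω η ζ : B k J) :
    brB k J ω (brB k J η ζ) = brB k J (brB k J ω η) ζ + brB k J η (brB k J ω ζ) := by
  induction ζ using B_induction with
  | h0 => simp
  | hadd a b ha hb => simp only [map_add, ha, hb]; abel
  | h c d =>
    simp only [brB_wedge, map_add, DB_brB, map_sub, LinearMap.sub_apply]
    abel

end JordanLie

open JordanLie in
/-- The vector space `TAG(J) = sl₂ ⊗ J ⊕ B(J)`. -/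
def TAG (k : Type u) [Field k] (J : Type u) [NonUnitalNonAssocCommRing J] [Module k J]
    [IsScalarTower k J J] [SMulCommClass k J J] : Type u :=
  (Sl2 k ⊗[k] J) × B k J

namespace TAG

open JordanLie

section

variable (k : Type u) [Field k] (J : Type u) [NonUnitalNonAssocCommRing J] [Module k J]
  [IsScalarTower k J J] [SMulCommClass k J J]

instance : AddCommGroup (TAG k J) := inferInstanceAs (AddCommGroup ((Sl2 k ⊗[k] J) × B k J))
instance : Module k (TAG k J) := inferInstanceAs (Module k ((Sl2 k ⊗[k] J) × B k J))

variable [IsCommJordan J] [CharZero k]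

/-- The component `sl₂ ⊗ J × sl₂ ⊗ J → sl₂ ⊗ J` of the bracket. -/
def mulMap : Sl2 k ⊗[k] J →ₗ[k] Sl2 k ⊗[k] J →ₗ[k] Sl2 k ⊗[k] J :=
  TensorProduct.map₂ (Sl2.lieBilin k) (LinearMap.mul k J)

/-- The component `sl₂ ⊗ J × sl₂ ⊗ J → B(J)` of the bracket. -/
def formMap : Sl2 k ⊗[k] J →ₗ[k] Sl2 k ⊗[k] J →ₗ[k] B k J :=
  (TensorProduct.map₂ (Sl2.form k) (wedge k J)).compr₂ (TensorProduct.lid k (B k J)).toLinearMap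

/-- The component `B(J) × sl₂ ⊗ J → sl₂ ⊗ J` of the bracket. -/
def actMap : B k J →ₗ[k] Sl2 k ⊗[k] J →ₗ[k] Sl2 k ⊗[k] J :=
  LinearMap.lTensorHom (Sl2 k) ∘ₗ DB k J

variable {k J}

@[simp]
theorem mulMap_tmul (x y : Sl2 k) (a b : J) :
    mulMap k J (x ⊗ₜ a) (y ⊗ₜ b) = ⁅x, y⁆ ⊗ₜ (a * b) := rfl

@[simp]
theorem formMap_tmul (x y : Sl2 k) (a b : J) :
    formMap k J (x ⊗ₜ a) (y ⊗ₜ b) = Sl2.form k x y • wedge k J a b := rfl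

@[simp]
theorem actMap_tmul (ω : B k J) (x : Sl2 k) (a : J) :
    actMap k J ω (x ⊗ₜ a) = x ⊗ₜ DB k J ω a := rfl

/-- The bracket of `TAG(J)`: the skew-symmetric bilinear map with
`[x ⊗ a, y ⊗ b] = [x,y] ⊗ ab + ½ tr(ad x ad y) a ∧ b`, `[a ∧ b, x ⊗ c] = x ⊗ D_{a,b}(c)` and
`[a ∧ b, c ∧ d] = D_{a,b}(c) ∧ d + c ∧ D_{a,b}(d)`. -/
instance : Bracket (TAG k J) (TAG k J) where
  bracket p q :=
    (mulMap k J p.1 q.1 + actMap k J p.2 q.1 - actMap k J q.2 p.1,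
      formMap k J p.1 q.1 + brB k J p.2 q.2)

theorem lie_fst (p q : TAG k J) : ⁅p, q⁆.1 =
    mulMap k J p.1 q.1 + actMap k J p.2 q.1 - actMap k J q.2 p.1 := rfl
theorem lie_snd (p q : TAG k J) : ⁅p, q⁆.2 = formMap k J p.1 q.1 + brB k J p.2 q.2 := rfl
theorem fst_add (p q : TAG k J) : (p + q).1 = p.1 + q.1 := rfl
theorem snd_add (p q : TAG k J) : (p + q).2 = p.2 + q.2 := rfl
theorem fst_smul (c : k) (p : TAG k J) : (c • p).1 = c • p.1 := rfl
theorem snd_smul (c : k) (p : TAG k J) : (c • p).2 = c • p.2 := rfl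

theorem mulMap_skew (s t : Sl2 k ⊗[k] J) : mulMap k J s t = - mulMap k J t s := by
  induction s with
  | zero => simp
  | add a b ha hb => simp only [map_add, LinearMap.add_apply, ha, hb]; abel
  | tmul x a =>
  induction t with
  | zero => simp
  | add a b ha hb => simp only [map_add, LinearMap.add_apply, ha, hb]; abel
  | tmul y b =>
    rw [mulMap_tmul, mulMap_tmul, ← lie_skew, TensorProduct.neg_tmul, mul_comm]

theorem formMap_skew (s t : Sl2 k ⊗[k] J) : formMap k J s t = - formMap k J t s := by
  induction s with
  | zero => simp
  | add a b ha hb => simp only [map_add, LinearMap.add_apply, ha, hb]; abel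
  | tmul x a =>
  induction t with
  | zero => simp
  | add a b ha hb => simp only [map_add, LinearMap.add_apply, ha, hb]; abel
  | tmul y b =>
    rw [formMap_tmul, formMap_tmul, Sl2.form_comm, wedge_skew, smul_neg]

theorem actMap_mulMap (ω : B k J) (s t : Sl2 k ⊗[k] J) :
    actMap k J ω (mulMap k J s t) =
      mulMap k J (actMap k J ω s) t + mulMap k J s (actMap k J ω t) := by
  induction s with
  | zero => simp
  | add a b ha hb => simp only [map_add, LinearMap.add_apply, ha, hb]; abel
  | tmul x a =>
  induction t with
  | zero => simp
  | add a b ha hb => simp only [map_add, ha, hb]; abel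
  | tmul y b => simp only [mulMap_tmul, actMap_tmul, DB_mul, TensorProduct.tmul_add]

theorem brB_formMap (ω : B k J) (s t : Sl2 k ⊗[k] J) :
    brB k J ω (formMap k J s t) =
      formMap k J (actMap k J ω s) t + formMap k J s (actMap k J ω t) := by
  induction s with
  | zero => simp
  | add a b ha hb => simp only [map_add, LinearMap.add_apply, ha, hb]; abel
  | tmul x a =>
  induction t with
  | zero => simp
  | add a b ha hb => simp only [map_add, ha, hb]; abel
  | tmul y b => simp only [formMap_tmul, actMap_tmul, map_smul, brB_wedge, smul_add]

theorem actMap_brB (ω η : B k J) (s : Sl2 k ⊗[k] J) :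
    actMap k J (brB k J ω η) s =
      actMap k J ω (actMap k J η s) - actMap k J η (actMap k J ω s) := by
  induction s with
  | zero => simp
  | add a b ha hb => simp only [map_add, ha, hb]; abel
  | tmul x a => simp only [actMap_tmul, DB_brB, TensorProduct.tmul_sub]

theorem jacobi_fst (s t r : Sl2 k ⊗[k] J) :
    (mulMap k J s (mulMap k J t r) - actMap k J (formMap k J t r) s)
      + (mulMap k J t (mulMap k J r s) - actMap k J (formMap k J r s) t)
      + (mulMap k J r (mulMap k J s t) - actMap k J (formMap k J s t) r) = 0 := by
  have key (P Q R P' Q' R' P₁ Q₁ R₁ P₁' Q₁' R₁' : Sl2 k ⊗[k] J)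
      (h : P - P' + (Q - Q') + (R - R') = 0) (h' : P₁ - P₁' + (Q₁ - Q₁') + (R₁ - R₁') = 0) :
      (P + P₁) - (P' + P₁') + ((Q + Q₁) - (Q' + Q₁')) + ((R + R₁) - (R' + R₁')) = 0 := by
    rw [← add_zero (0 : Sl2 k ⊗[k] J)]; nth_rewrite 1 [← h]; rw [← h']; abel
  induction s with
  | zero => simp
  | add a b ha hb =>
    simp only [map_add, LinearMap.add_apply]; exact key _ _ _ _ _ _ _ _ _ _ _ _ ha hb
  | tmul x a =>
  induction t with
  | zero => simp
  | add a b ha hb =>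
    simp only [map_add, LinearMap.add_apply]; exact key _ _ _ _ _ _ _ _ _ _ _ _ ha hb
  | tmul y b =>
  induction r with
  | zero => simp
  | add a b ha hb =>
    simp only [map_add, LinearMap.add_apply]; exact key _ _ _ _ _ _ _ _ _ _ _ _ ha hb
  | tmul z c =>
    simp only [mulMap_tmul, formMap_tmul, map_smul, LinearMap.smul_apply, actMap_tmul, DB_wedge,
      D_apply, Sl2.lie_lie_eq, TensorProduct.tmul_sub, TensorProduct.sub_tmul, smul_sub,
      ← TensorProduct.smul_tmul']
    rw [Sl2.form_comm y x, Sl2.form_comm z y, Sl2.form_comm z x]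
    rw [mul_comm c a, mul_comm c b, mul_comm b a]
    abel

theorem jacobi_snd (s t r : Sl2 k ⊗[k] J) :
    formMap k J s (mulMap k J t r) + formMap k J t (mulMap k J r s)
      + formMap k J r (mulMap k J s t) = 0 := by
  have key (P Q R P' Q' R' : B k J) (h : P + Q + R = 0) (h' : P' + Q' + R' = 0) :
      (P + P') + (Q + Q') + (R + R') = 0 := by
    rw [← add_zero (0 : B k J)]; nth_rewrite 1 [← h]; rw [← h']; abel
  induction s with
  | zero => simp
  | add a b ha hb =>
    simp only [map_add, LinearMap.add_apply]; exact key _ _ _ _ _ _ ha hb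
  | tmul x a =>
  induction t with
  | zero => simp
  | add a b ha hb =>
    simp only [map_add, LinearMap.add_apply]; exact key _ _ _ _ _ _ ha hb
  | tmul y b =>
  induction r with
  | zero => simp
  | add a b ha hb =>
    simp only [map_add, LinearMap.add_apply]; exact key _ _ _ _ _ _ ha hb
  | tmul z c =>
    simp only [mulMap_tmul, formMap_tmul]
    rw [← Sl2.form_lie x y z, Sl2.form_lie z x y, ← smul_add, ← smul_add]
    have h := wedge_cyclic (k := k) a b c
    rw [wedge_skew (a * b), wedge_skew (b * c), wedge_skew (c * a)] at h
    have h' : wedge k J a (b * c) + wedge k J b (c * a) + wedge k J c (a * b) = 0 := by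
      rw [← neg_eq_zero, ← h]; abel
    rw [h', smul_zero]

variable (k) in
theorem eq_zero_of_eq_neg {M : Type*} [AddCommGroup M] [Module k M] {x : M} (h : x = -x) :
    x = 0 := by
  have h2 : (2 : k) • x = 0 := by rw [two_smul]; nth_rewrite 1 [h]; simp
  exact (smul_eq_zero.1 h2).resolve_left two_ne_zero

instance : LieRing (TAG k J) where
  add_lie p q r := by
    refine Prod.ext ?_ ?_ <;>
      simp only [lie_fst, lie_snd, fst_add, snd_add, map_add, LinearMap.add_apply] <;> abel
  lie_add p q r := by
    refine Prod.ext ?_ ?_ <;>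
      simp only [lie_fst, lie_snd, fst_add, snd_add, map_add, LinearMap.add_apply] <;> abel
  lie_self p := by
    have h1 : mulMap k J p.1 p.1 = 0 := eq_zero_of_eq_neg k (mulMap_skew p.1 p.1)
    have h2 : formMap k J p.1 p.1 = 0 := eq_zero_of_eq_neg k (formMap_skew p.1 p.1)
    have h3 : brB k J p.2 p.2 = 0 := eq_zero_of_eq_neg k (brB_skew p.2 p.2)
    refine Prod.ext ?_ ?_
    · rw [lie_fst, h1, zero_add, sub_self]; rfl
    · rw [lie_snd, h2, h3, zero_add]; rfl
  leibniz_lie p q r := by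
    have h1 := jacobi_fst p.1 q.1 r.1
    have h2 := jacobi_snd p.1 q.1 r.1
    refine Prod.ext ?_ ?_
    · simp only [lie_fst, lie_snd, fst_add, map_add, map_sub, LinearMap.add_apply,
        LinearMap.sub_apply, actMap_brB, actMap_mulMap]
      rw [mulMap_skew r.1 p.1, formMap_skew r.1 p.1,
        mulMap_skew r.1 (mulMap k J p.1 q.1)] at h1
      rw [mulMap_skew (actMap k J r.2 p.1) q.1, ← sub_eq_zero, ← h1]
      simp only [map_neg, LinearMap.neg_apply]
      abel
    · simp only [lie_fst, lie_snd, snd_add, map_add, map_sub, LinearMap.add_apply,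
        LinearMap.sub_apply, brB_formMap]
      rw [mulMap_skew r.1 p.1, formMap_skew r.1 (mulMap k J p.1 q.1)] at h2
      rw [brB_leibniz p.2 q.2 r.2, brB_skew (formMap k J p.1 q.1) r.2, brB_formMap,
        formMap_skew (actMap k J r.2 p.1) q.1, ← sub_eq_zero, ← h2]
      simp only [map_neg]
      abel

instance : LieAlgebra k (TAG k J) where
  lie_smul c p q := by
    refine Prod.ext ?_ ?_ <;>
      simp only [lie_fst, lie_snd, fst_smul, snd_smul, map_smul, LinearMap.smul_apply, smul_add,
        smul_sub]

end

end TAG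

namespace TAG

open JordanLie

section

variable {k : Type u} [Field k] [CharZero k] {J : Type u} [NonUnitalNonAssocCommRing J] [Module k J]
  [IsScalarTower k J J] [SMulCommClass k J J] [IsCommJordan J]
  {J' : Type u} [NonUnitalNonAssocCommRing J'] [Module k J']
  [IsScalarTower k J' J'] [SMulCommClass k J' J'] [IsCommJordan J']

theorem map_DB (f : J →ₙₐ[k] J') (ω : B k J) (a : J) :
    f (DB k J ω a) = DB k J' (mapB f ω) (f a) := by
  induction ω using B_induction with
  | h0 => simp
  | hadd a b ha hb => simp only [map_add, LinearMap.add_apply, ha, hb]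
  | h c d => simp only [mapB_wedge, DB_wedge, D_apply, map_sub, map_mul]

theorem map_mulMap (f : J →ₙₐ[k] J') (s t : Sl2 k ⊗[k] J) :
    (f : J →ₗ[k] J').lTensor (Sl2 k) (mulMap k J s t) =
      mulMap k J' ((f : J →ₗ[k] J').lTensor (Sl2 k) s) ((f : J →ₗ[k] J').lTensor (Sl2 k) t) := by
  induction s with
  | zero => simp
  | add a b ha hb => simp only [map_add, LinearMap.add_apply, ha, hb]
  | tmul x a =>
  induction t with
  | zero => simp
  | add a b ha hb => simp only [map_add, ha, hb]
  | tmul y b => simp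

theorem map_formMap (f : J →ₙₐ[k] J') (s t : Sl2 k ⊗[k] J) :
    mapB f (formMap k J s t) =
      formMap k J' ((f : J →ₗ[k] J').lTensor (Sl2 k) s) ((f : J →ₗ[k] J').lTensor (Sl2 k) t) := by
  induction s with
  | zero => simp
  | add a b ha hb => simp only [map_add, LinearMap.add_apply, ha, hb]
  | tmul x a =>
  induction t with
  | zero => simp
  | add a b ha hb => simp only [map_add, ha, hb]
  | tmul y b => simp

theorem map_actMap (f : J →ₙₐ[k] J') (ω : B k J) (s : Sl2 k ⊗[k] J) :
    (f : J →ₗ[k] J').lTensor (Sl2 k) (actMap k J ω s) =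
      actMap k J' (mapB f ω) ((f : J →ₗ[k] J').lTensor (Sl2 k) s) := by
  induction s with
  | zero => simp
  | add a b ha hb => simp only [map_add, ha, hb]
  | tmul x a => simp [map_DB]

theorem map_brB (f : J →ₙₐ[k] J') (ω η : B k J) :
    mapB f (brB k J ω η) = brB k J' (mapB f ω) (mapB f η) := by
  induction η using B_induction with
  | h0 => simp
  | hadd a b ha hb => simp only [map_add, ha, hb]
  | h c d => simp only [mapB_wedge, brB_wedge, map_add, map_DB]

/-- The homomorphism `TAG(J) → TAG(J')` induced by a homomorphism `J → J'`. -/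
def map (f : J →ₙₐ[k] J') : TAG k J →ₗ⁅k⁆ TAG k J' where
  toLinearMap := LinearMap.prodMap ((f : J →ₗ[k] J').lTensor (Sl2 k)) (mapB f)
  map_lie' {p q} := by
    refine Prod.ext ?_ ?_
    · change (f : J →ₗ[k] J').lTensor (Sl2 k)
        (mulMap k J p.1 q.1 + actMap k J p.2 q.1 - actMap k J q.2 p.1) = _
      rw [map_sub, map_add, map_mulMap, map_actMap, map_actMap]
      rfl
    · change mapB f (formMap k J p.1 q.1 + brB k J p.2 q.2) = _
      rw [map_add, map_formMap, map_brB]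
      rfl

theorem map_fst (f : J →ₙₐ[k] J') (p : TAG k J) :
    (map f p).1 = (f : J →ₗ[k] J').lTensor (Sl2 k) p.1 := rfl
theorem map_snd (f : J →ₙₐ[k] J') (p : TAG k J) : (map f p).2 = mapB f p.2 := rfl

theorem map_id (p : TAG k J) : map (NonUnitalAlgHom.id k J) p = p := by
  refine Prod.ext ?_ ?_
  · rw [map_fst]
    have : ((NonUnitalAlgHom.id k J : J →ₙₐ[k] J) : J →ₗ[k] J) = LinearMap.id := rfl
    rw [this, LinearMap.lTensor_id, LinearMap.id_apply]
  · rw [map_snd]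
    refine LinearMap.congr_fun (f := mapB (NonUnitalAlgHom.id k J)) (g := LinearMap.id)
      (B_ext fun a b => ?_) p.2
    rw [mapB_wedge]; rfl

theorem map_comp {J'' : Type u} [NonUnitalNonAssocCommRing J''] [Module k J'']
    [IsScalarTower k J'' J''] [SMulCommClass k J'' J''] [IsCommJordan J'']
    (g : J' →ₙₐ[k] J'') (f : J →ₙₐ[k] J') (p : TAG k J) :
    map (g.comp f) p = map g (map f p) := by
  refine Prod.ext ?_ ?_
  · simp only [map_fst]
    have : ((g.comp f : J →ₙₐ[k] J'') : J →ₗ[k] J'') = (g : J' →ₗ[k] J'') ∘ₗ (f : J →ₗ[k] J') := rfl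
    rw [this, LinearMap.lTensor_comp, LinearMap.comp_apply]
  · simp only [map_snd]
    refine LinearMap.congr_fun (f := mapB (g.comp f)) (g := mapB g ∘ₗ mapB f)
      (B_ext fun a b => ?_) p.2
    simp only [mapB_wedge, LinearMap.comp_apply]; rfl

end

/-- The Tits-Allison-Gao construction as a functor from Jordan algebras to Lie algebras. -/
def functor (k : Type u) [Field k] [CharZero k] : JordAlg k ⥤ LieAlgs k where
  obj A := ⟨TAG k A.carrier⟩
  map f := ⟨map f.hom⟩
  map_id _ := LieAlgs.Hom.ext <| LieHom.ext fun p => map_id p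
  map_comp f g := LieAlgs.Hom.ext <| LieHom.ext fun p => map_comp g.hom f.hom p

end TAG

/-! ### The twisted Lie algebra `TAG = sl₂ ⊗ Jord ⊕ B(Jord)` -/

namespace JordanOperad

open JordanLie

/-- The number of occurrences of the letter `i` in a nonassociative word. -/
def occ {n : ℕ} (i : Fin n) : FreeMagma (Fin n) → ℕ
  | .of j => if j = i then 1 else 0
  | .mul u v => occ i u + occ i v

/-- A nonassociative word in `x₁, …, xₙ` is multilinear if each letter occurs exactly once. -/
def IsMultilinear {n : ℕ} (u : FreeMagma (Fin n)) : Prop := ∀ i, occ i u = 1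

theorem occ_map_of_injective {n m : ℕ} (φ : Fin n → Fin m) (hφ : Function.Injective φ) (i : Fin n)
    (u : FreeMagma (Fin n)) : occ (φ i) (FreeMagma.map φ u) = occ i u := by
  induction u using FreeMagma.recOnMul with
  | ih1 j => change (if φ j = φ i then 1 else 0) = (if j = i then 1 else 0); simp [hφ.eq_iff]
  | ih2 u v hu hv =>
    rw [map_mul]
    exact congrArg₂ (· + ·) hu hv

theorem occ_map_of_notMem {n m : ℕ} (φ : Fin n → Fin m) (j : Fin m) (hj : ∀ i, φ i ≠ j)
    (u : FreeMagma (Fin n)) : occ j (FreeMagma.map φ u) = 0 := by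
  induction u using FreeMagma.recOnMul with
  | ih1 i => change (if φ i = j then 1 else 0) = 0; simp [hj]
  | ih2 u v hu hv =>
    rw [map_mul]
    exact congrArg₂ (· + ·) hu hv

theorem occ_mul {n : ℕ} (i : Fin n) (u v : FreeMagma (Fin n)) : occ i (u * v) = occ i u + occ i v :=
  rfl

variable (k : Type u) [Field k]

/-- The free Jordan algebra `Jord(x₁, …, xₙ)`. -/
abbrev FreeOn (n : ℕ) : Type u := FreeJordan k (Fin n →₀ k)

/-- The element of `Jord(x₁, …, xₙ)` represented by a nonassociative word. -/
def word {n : ℕ} : FreeMagma (Fin n) →ₙ* FreeOn k n :=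
  FreeMagma.lift fun i => FreeJordan.ι k (Fin n →₀ k) (Finsupp.single i 1)

/-- The substitution `x_i ↦ x_{φ(i)}`. -/
def rename {n m : ℕ} (φ : Fin n → Fin m) : FreeOn k n →ₙₐ[k] FreeOn k m :=
  FreeJordan.map (Finsupp.lmapDomain k k φ)

theorem rename_word {n m : ℕ} (φ : Fin n → Fin m) (u : FreeMagma (Fin n)) :
    rename k φ (word k u) = word k (FreeMagma.map φ u) := by
  induction u using FreeMagma.recOnMul with
  | ih1 i =>
    change FreeJordan.map _ (FreeJordan.ι k _ _) = FreeJordan.ι k _ _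
    simp [FreeJordan.map]
  | ih2 u v hu hv => simp only [map_mul, hu, hv]

theorem rename_id (n : ℕ) : rename k (id : Fin n → Fin n) = NonUnitalAlgHom.id k _ :=
  FreeJordan.hom_ext fun v => by
    simp [rename, FreeJordan.map]

theorem rename_comp {n m l : ℕ} (ψ : Fin m → Fin l) (φ : Fin n → Fin m) :
    rename k (ψ ∘ φ) = (rename k ψ).comp (rename k φ) :=
  FreeJordan.hom_ext fun v => by
    simp [rename, FreeJordan.map, Finsupp.mapDomain_comp]

/-- The subspace `Jord(n)` of `Jord(x₁, …, xₙ)` of the elements of degree exactly one in each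
generator. -/
def jordSub (n : ℕ) : Submodule k (FreeOn k n) :=
  Submodule.span k {z | ∃ u : FreeMagma (Fin n), IsMultilinear u ∧ z = word k u}

/-- The subspace `B(Jord)(n)` of `B(Jord(x₁, …, xₙ))` of the elements of degree exactly one in each
generator. -/
def bSub (n : ℕ) : Submodule k (B k (FreeOn k n)) :=
  Submodule.span k {z | ∃ u v : FreeMagma (Fin n), IsMultilinear (u * v) ∧
    z = wedge k (FreeOn k n) (word k u) (word k v)}

/-- The subspace `sl₂ ⊗ Jord(n) ⊕ B(Jord)(n)` of `TAG(Jord(x₁, …, xₙ))`. -/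
def tagSub (n : ℕ) : Submodule k (TAG k (FreeOn k n)) :=
  Submodule.prod (LinearMap.range ((jordSub k n).subtype.lTensor (Sl2 k))) (bSub k n)

variable {k}

theorem word_mem {n : ℕ} {u : FreeMagma (Fin n)} (hu : IsMultilinear u) : word k u ∈ jordSub k n :=
  Submodule.subset_span ⟨u, hu, rfl⟩

theorem IsMultilinear.map {n m : ℕ} {u : FreeMagma (Fin n)} (hu : IsMultilinear u)
    (σ : Fin n ≃ Fin m) : IsMultilinear (FreeMagma.map σ u) := fun i => by
  obtain ⟨i, rfl⟩ := σ.surjective i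
  rw [occ_map_of_injective σ σ.injective, hu]

theorem rename_mem_jordSub {n m : ℕ} (σ : Fin n ≃ Fin m) {z : FreeOn k n} (hz : z ∈ jordSub k n) :
    rename k σ z ∈ jordSub k m := by
  induction hz using Submodule.span_induction with
  | mem z h =>
    obtain ⟨u, hu, rfl⟩ := h
    rw [rename_word]; exact word_mem (hu.map σ)
  | zero => rw [map_zero]; exact zero_mem _
  | add a b _ _ ha hb => rw [map_add]; exact add_mem ha hb
  | smul c a _ ha => rw [map_smul]; exact Submodule.smul_mem _ _ ha

/-- The element `x ⊗ a` of `TAG(J)`. -/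
def _root_.TAG.inl {J : Type u} [NonUnitalNonAssocCommRing J] [Module k J]
    [IsScalarTower k J J] [SMulCommClass k J J] (x : Sl2 k) (a : J) : TAG k J := (x ⊗ₜ a, 0)

/-- The element `a ∧ b` of `TAG(J)`. -/
def _root_.TAG.inr {J : Type u} [NonUnitalNonAssocCommRing J] [Module k J]
    [IsScalarTower k J J] [SMulCommClass k J J] (a b : J) : TAG k J := (0, wedge k J a b)

theorem inl_mem {n : ℕ} (x : Sl2 k) {a : FreeOn k n} (ha : a ∈ jordSub k n) :
    TAG.inl x a ∈ tagSub k n :=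
  ⟨⟨x ⊗ₜ ⟨a, ha⟩, rfl⟩, zero_mem _⟩

theorem inr_mem {n : ℕ} {u v : FreeMagma (Fin n)} (h : IsMultilinear (u * v)) :
    TAG.inr (word k u) (word k v) ∈ tagSub k n :=
  ⟨zero_mem _, Submodule.subset_span ⟨u, v, h, rfl⟩⟩

theorem tagSub_induction {n : ℕ} {P : TAG k (FreeOn k n) → Prop} {p : TAG k (FreeOn k n)}
    (hp : p ∈ tagSub k n)
    (hl : ∀ x (u : FreeMagma (Fin n)), IsMultilinear u → P (TAG.inl x (word k u)))
    (hr : ∀ u v : FreeMagma (Fin n), IsMultilinear (u * v) → P (TAG.inr (word k u) (word k v)))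
    (h0 : P 0) (hadd : ∀ p q, P p → P q → P (p + q)) (hsmul : ∀ (c : k) p, P p → P (c • p)) :
    P p := by
  have key : P ((p.1, 0) : TAG k (FreeOn k n)) := by
    obtain ⟨t, ht⟩ := hp.1
    rw [← ht]
    clear ht
    induction t with
    | zero => rw [map_zero]; exact h0
    | add a b ha hb =>
      rw [map_add]
      have := hadd _ _ ha hb
      refine cast (congrArg P (Prod.ext rfl ?_)) this
      exact add_zero (0 : B k (FreeOn k n))
    | tmul x a =>
      obtain ⟨a, ha⟩ := a
      change P (TAG.inl x a)
      induction ha using Submodule.span_induction with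
      | mem z h => obtain ⟨u, hu, rfl⟩ := h; exact hl x u hu
      | zero =>
        have e : TAG.inl x (0 : FreeOn k n) = 0 := Prod.ext (TensorProduct.tmul_zero _ x) rfl
        rw [e]; exact h0
      | add a b _ _ ha hb =>
        refine cast (congrArg P (Prod.ext ?_ ?_)) (hadd _ _ ha hb)
        · exact (TensorProduct.tmul_add x a b).symm
        · exact add_zero (0 : B k (FreeOn k n))
      | smul c a _ ha =>
        refine cast (congrArg P (Prod.ext ?_ ?_)) (hsmul c _ ha)
        · exact (TensorProduct.tmul_smul c x a).symm
        · exact smul_zero c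
  have key2 : P ((0, p.2) : TAG k (FreeOn k n)) := by
    have h2 := hp.2
    change p.2 ∈ bSub k n at h2
    generalize p.2 = ω at h2
    induction h2 using Submodule.span_induction with
    | mem z h => obtain ⟨u, v, hu, rfl⟩ := h; exact hr u v hu
    | zero => exact h0
    | add a b _ _ ha hb =>
      refine cast (congrArg P (Prod.ext ?_ rfl)) (hadd _ _ ha hb)
      exact add_zero (0 : Sl2 k ⊗[k] FreeOn k n)
    | smul c a _ ha =>
      refine cast (congrArg P (Prod.ext ?_ rfl)) (hsmul c _ ha)
      exact smul_zero c
  refine cast (congrArg P (Prod.ext ?_ ?_)) (hadd _ _ key key2)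
  · exact add_zero p.1
  · exact zero_add p.2

variable [CharZero k]

theorem map_inl {n m : ℕ} (φ : Fin n → Fin m) (x : Sl2 k) (u : FreeMagma (Fin n)) :
    TAG.map (rename k φ) (TAG.inl x (word k u)) = TAG.inl x (word k (FreeMagma.map φ u)) := by
  rw [← rename_word]
  refine Prod.ext ?_ ?_
  · rfl
  · exact map_zero (mapB (rename k φ))

theorem map_inr {n m : ℕ} (φ : Fin n → Fin m) (u v : FreeMagma (Fin n)) :
    TAG.map (rename k φ) (TAG.inr (word k u) (word k v)) =
      TAG.inr (word k (FreeMagma.map φ u)) (word k (FreeMagma.map φ v)) := by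
  rw [← rename_word, ← rename_word]
  refine Prod.ext ?_ ?_
  · exact map_zero ((rename k φ : FreeOn k n →ₗ[k] FreeOn k m).lTensor (Sl2 k))
  · exact mapB_wedge _ _ _

theorem rename_mem_tagSub {n m : ℕ} (σ : Fin n ≃ Fin m) {p : TAG k (FreeOn k n)}
    (hp : p ∈ tagSub k n) : TAG.map (rename k σ) p ∈ tagSub k m := by
  refine tagSub_induction (P := fun p => TAG.map (rename k σ) p ∈ tagSub k m) hp
    (fun x u hu => ?_) (fun u v hu => ?_) ?_ (fun p q hp hq => ?_) (fun c p hp => ?_)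
  · rw [map_inl]; exact inl_mem x (word_mem (hu.map σ))
  · rw [map_inr]; refine inr_mem ?_; rw [← map_mul]; exact hu.map σ
  · rw [map_zero]; exact zero_mem _
  · rw [map_add]; exact add_mem hp hq
  · rw [map_smul]; exact Submodule.smul_mem _ _ hp

/-- Substituting `x₁, …, xₙ` in a word, resp. `xₙ₊₁, …, xₙ₊ₘ` in a second word. -/
theorem occ_append {n m : ℕ} {u : FreeMagma (Fin n)} {v : FreeMagma (Fin m)} (hu : IsMultilinear u)
    (hv : IsMultilinear v) (i : Fin (n + m)) :
    occ i (FreeMagma.map (Fin.castAdd m) u) + occ i (FreeMagma.map (Fin.natAdd n) v) = 1 := by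
  refine Fin.addCases (fun i => ?_) (fun i => ?_) i
  · rw [occ_map_of_injective _ (Fin.castAdd_injective n m), hu, occ_map_of_notMem]
    intro j h
    have := congrArg Fin.val h
    simp at this; omega
  · rw [occ_map_of_injective _ (Fin.natAdd_injective m n), hv, occ_map_of_notMem]
    intro j h
    have := congrArg Fin.val h
    simp at this; omega

theorem lie_inl_inl {J : Type u} [NonUnitalNonAssocCommRing J] [Module k J]
    [IsScalarTower k J J] [SMulCommClass k J J] [IsCommJordan J] (x y : Sl2 k) (a b : J) :
    ⁅TAG.inl (k := k) x a, TAG.inl y b⁆ = TAG.inl ⁅x, y⁆ (a * b) + Sl2.form k x y • TAG.inr (k := k) a b := by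
  refine Prod.ext ?_ ?_
  · rw [TAG.lie_fst, TAG.fst_add, TAG.fst_smul]
    simp [TAG.inl, TAG.inr]
  · rw [TAG.lie_snd, TAG.snd_add, TAG.snd_smul]
    simp [TAG.inl, TAG.inr]

theorem lie_inr_inl {J : Type u} [NonUnitalNonAssocCommRing J] [Module k J]
    [IsScalarTower k J J] [SMulCommClass k J J] [IsCommJordan J] (a b c : J) (x : Sl2 k) :
    ⁅TAG.inr (k := k) a b, TAG.inl x c⁆ = TAG.inl x (D k J a b c) := by
  refine Prod.ext ?_ ?_
  · rw [TAG.lie_fst]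
    simp [TAG.inl, TAG.inr, DB_wedge]
  · rw [TAG.lie_snd]
    simp [TAG.inl, TAG.inr]

theorem lie_inr_inr {J : Type u} [NonUnitalNonAssocCommRing J] [Module k J]
    [IsScalarTower k J J] [SMulCommClass k J J] [IsCommJordan J] (a b c d : J) :
    ⁅TAG.inr (k := k) a b, TAG.inr c d⁆ =
      TAG.inr (k := k) (D k J a b c) d + TAG.inr c (D k J a b d) := by
  refine Prod.ext ?_ ?_
  · rw [TAG.lie_fst, TAG.fst_add]
    simp [TAG.inr]
  · rw [TAG.lie_snd, TAG.snd_add]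
    simp [TAG.inr, brB_wedge, DB_wedge]

theorem inl_sub {J : Type u} [NonUnitalNonAssocCommRing J] [Module k J]
    [IsScalarTower k J J] [SMulCommClass k J J] (x : Sl2 k) (a b : J) :
    TAG.inl x (a - b) = TAG.inl x a - TAG.inl x b :=
  Prod.ext (TensorProduct.tmul_sub x a b) (sub_zero (0 : B k J)).symm

theorem inr_sub_left {J : Type u} [NonUnitalNonAssocCommRing J] [Module k J]
    [IsScalarTower k J J] [SMulCommClass k J J] (a b c : J) :
    TAG.inr (k := k) (a - b) c = TAG.inr a c - TAG.inr b c := by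
  refine Prod.ext (sub_zero (0 : Sl2 k ⊗[k] J)).symm ?_
  change wedge k J (a - b) c = wedge k J a c - wedge k J b c
  rw [map_sub, LinearMap.sub_apply]

theorem inr_sub_right {J : Type u} [NonUnitalNonAssocCommRing J] [Module k J]
    [IsScalarTower k J J] [SMulCommClass k J J] (a b c : J) :
    TAG.inr (k := k) a (b - c) = TAG.inr a b - TAG.inr a c := by
  refine Prod.ext (sub_zero (0 : Sl2 k ⊗[k] J)).symm ?_
  change wedge k J a (b - c) = wedge k J a b - wedge k J a c
  rw [map_sub]

theorem D_word {n : ℕ} (u v w : FreeMagma (Fin n)) :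
    D k (FreeOn k n) (word k u) (word k v) (word k w) =
      word k (u * (v * w)) - word k (v * (u * w)) := by
  simp only [D_apply, map_mul]

theorem lie_mem_tagSub {n m : ℕ} {p : TAG k (FreeOn k n)} (hp : p ∈ tagSub k n)
    {q : TAG k (FreeOn k m)} (hq : q ∈ tagSub k m) :
    ⁅TAG.map (rename k (Fin.castAdd m)) p, TAG.map (rename k (Fin.natAdd n)) q⁆ ∈
      tagSub k (n + m) := by
  refine tagSub_induction (P := fun p => ⁅TAG.map (rename k (Fin.castAdd m)) p,
    TAG.map (rename k (Fin.natAdd n)) q⁆ ∈ tagSub k (n + m)) hp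
    (fun x u hu => ?_) (fun u t hu => ?_) ?_ (fun p q hp hq => ?_) (fun c p hp => ?_)
  · refine tagSub_induction (P := fun q => ⁅TAG.map (rename k (Fin.castAdd m)) (TAG.inl x (word k u)),
      TAG.map (rename k (Fin.natAdd n)) q⁆ ∈ tagSub k (n + m)) hq
      (fun y v hv => ?_) (fun v w hv => ?_) ?_ (fun p q hp hq => ?_) (fun c p hp => ?_)
    · have h := occ_append hu hv
      rw [map_inl, map_inl, lie_inl_inl]
      refine add_mem ?_ (Submodule.smul_mem _ _ (inr_mem fun i => h i))
      rw [← map_mul]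
      exact inl_mem _ (word_mem fun i => h i)
    · have h := occ_append hu hv
      rw [map_inl, map_inr, ← lie_skew, lie_inr_inl, D_word, inl_sub]
      refine neg_mem (sub_mem (inl_mem _ (word_mem fun i => ?_)) (inl_mem _ (word_mem fun i => ?_)))
        <;> rw [← h i, map_mul] <;> simp only [occ_mul] <;> ring
    · rw [map_zero, lie_zero]; exact zero_mem _
    · rw [map_add, lie_add]; exact add_mem hp hq
    · rw [map_smul, lie_smul]; exact Submodule.smul_mem _ _ hp
  · refine tagSub_induction (P := fun q => ⁅TAG.map (rename k (Fin.castAdd m)) (TAG.inr (word k u) (word k t)),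
      TAG.map (rename k (Fin.natAdd n)) q⁆ ∈ tagSub k (n + m)) hq
      (fun y v hv => ?_) (fun v w hv => ?_) ?_ (fun p q hp hq => ?_) (fun c p hp => ?_)
    · have h := occ_append hu hv
      rw [map_inl, map_inr, lie_inr_inl, D_word, inl_sub]
      refine sub_mem (inl_mem _ (word_mem fun i => ?_)) (inl_mem _ (word_mem fun i => ?_))
        <;> rw [← h i, map_mul] <;> simp only [occ_mul] <;> ring
    · have h := occ_append hu hv
      rw [map_inr, map_inr, lie_inr_inr, D_word, D_word, inr_sub_left, inr_sub_right]
      refine add_mem (sub_mem (inr_mem fun i => ?_) (inr_mem fun i => ?_))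
        (sub_mem (inr_mem fun i => ?_) (inr_mem fun i => ?_))
        <;> rw [← h i, map_mul, map_mul] <;> simp only [occ_mul] <;> ring
    · rw [map_zero, lie_zero]; exact zero_mem _
    · rw [map_add, lie_add]; exact add_mem hp hq
    · rw [map_smul, lie_smul]; exact Submodule.smul_mem _ _ hp
  · rw [map_zero, zero_lie]; exact zero_mem _
  · rw [map_add, add_lie]; exact add_mem hp hq
  · rw [map_smul, smul_lie]; exact Submodule.smul_mem _ _ hp

variable (k) in
/-- The sequence `{Jord(n)}` of the Jordan operad, on which the symmetric groups act by permuting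
the generators. -/
def jordSeq : SymSeq k where
  obj n := jordSub k n
  map σ := (rename k σ : _ →ₗ[k] _).restrict fun _ hz => rename_mem_jordSub σ hz
  map_refl n := by
    ext z
    exact DFunLike.congr_fun (rename_id k n) z.1
  map_trans σ τ := by
    ext z
    exact DFunLike.congr_fun (rename_comp k τ σ) z.1

theorem map_rename_comp {n m l : ℕ} (ψ : Fin m → Fin l) (φ : Fin n → Fin m)
    (p : TAG k (FreeOn k n)) :
    TAG.map (rename k ψ) (TAG.map (rename k φ) p) = TAG.map (rename k (ψ ∘ φ)) p := by
  rw [rename_comp, TAG.map_comp]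

variable (k) in
/-- The twisted Lie algebra `TAG = sl₂ ⊗ Jord ⊕ B(Jord)`. The bracket of `p ∈ TAG(n)` and
`q ∈ TAG(m)` is the bracket of `p(x₁, …, xₙ)` and `q(xₙ₊₁, …, xₙ₊ₘ)` in
`TAG(Jord(x₁, …, xₙ₊ₘ))`. -/
def tag : TwistedLie k where
  obj n := tagSub k n
  map σ := ((TAG.map (rename k σ) : _ →ₗ⁅k⁆ _) : _ →ₗ[k] _).restrict
    fun _ hp => rename_mem_tagSub σ hp
  map_refl n := by
    ext1 p
    refine Subtype.ext ?_
    change TAG.map (rename k id) p.1 = p.1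
    rw [rename_id, TAG.map_id]
  map_trans σ τ := by
    ext1 p
    refine Subtype.ext ?_
    exact (map_rename_comp τ σ p.1).symm
  bracket n m := LinearMap.mk₂ k (fun p q =>
      ⟨⁅TAG.map (rename k (Fin.castAdd m)) p.1, TAG.map (rename k (Fin.natAdd n)) q.1⁆,
        lie_mem_tagSub p.2 q.2⟩)
    (fun p p' q => Subtype.ext (by simp only [Submodule.coe_add, map_add, add_lie]))
    (fun c p q => Subtype.ext (by simp only [Submodule.coe_smul, map_smul, smul_lie]))
    (fun p q q' => Subtype.ext (by simp only [Submodule.coe_add, map_add, lie_add]))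
    (fun c p q => Subtype.ext (by simp only [Submodule.coe_smul, map_smul, lie_smul]))
  equivariant {n n' m m'} σ τ p q := by
    refine Subtype.ext ?_
    change ⁅TAG.map (rename k (Fin.castAdd m')) (TAG.map (rename k σ) p.1),
      TAG.map (rename k (Fin.natAdd n')) (TAG.map (rename k τ) q.1)⁆ =
      TAG.map (rename k (finSumCongr σ τ)) ⁅TAG.map (rename k (Fin.castAdd m)) p.1,
        TAG.map (rename k (Fin.natAdd n)) q.1⁆
    rw [LieHom.map_lie]
    simp only [map_rename_comp]
    congr 4 <;> ext i <;> simp [finSumCongr]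
  skew {n m} p q := by
    refine Subtype.ext ?_
    change ⁅TAG.map (rename k (Fin.castAdd m)) p.1, TAG.map (rename k (Fin.natAdd n)) q.1⁆ =
      - TAG.map (rename k finAddFlip) ⁅TAG.map (rename k (Fin.castAdd n)) q.1,
        TAG.map (rename k (Fin.natAdd m)) p.1⁆
    rw [LieHom.map_lie, lie_skew]
    simp only [map_rename_comp]
    congr 4 <;> ext i <;> simp
  jacobi {n m l} p q r := by
    refine Subtype.ext ?_
    change ⁅TAG.map (rename k (Fin.castAdd (m + l))) p.1, TAG.map (rename k (Fin.natAdd n))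
        ⁅TAG.map (rename k (Fin.castAdd l)) q.1, TAG.map (rename k (Fin.natAdd m)) r.1⁆⁆
      + TAG.map (rename k (finRotL n m l))
        ⁅TAG.map (rename k (Fin.castAdd (l + n))) q.1, TAG.map (rename k (Fin.natAdd m))
        ⁅TAG.map (rename k (Fin.castAdd n)) r.1, TAG.map (rename k (Fin.natAdd l)) p.1⁆⁆
      + TAG.map (rename k (finRotR n m l))
        ⁅TAG.map (rename k (Fin.castAdd (n + m))) r.1, TAG.map (rename k (Fin.natAdd l))
        ⁅TAG.map (rename k (Fin.castAdd m)) p.1, TAG.map (rename k (Fin.natAdd n)) q.1⁆⁆ = 0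
    simp only [LieHom.map_lie, map_rename_comp]
    have e1 : ⇑(finRotL n m l) ∘ Fin.castAdd (l + n) = Fin.natAdd n ∘ Fin.castAdd l := by
      funext i
      have : (finCongr (Nat.add_assoc m l n).symm) (Fin.castAdd (l + n) i) =
        Fin.castAdd n (Fin.castAdd l i) := Fin.ext rfl
      simp [finRotL, this, -finCongr_apply]
    have e2 : ⇑(finRotL n m l) ∘ Fin.natAdd m ∘ Fin.castAdd n = Fin.natAdd n ∘ Fin.natAdd m := by
      funext i
      have : (finCongr (Nat.add_assoc m l n).symm) (Fin.natAdd m (Fin.castAdd n i)) =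
        Fin.castAdd n (Fin.natAdd m i) := Fin.ext rfl
      simp [finRotL, this, -finCongr_apply]
    have e3 : ⇑(finRotL n m l) ∘ Fin.natAdd m ∘ Fin.natAdd l = Fin.castAdd (m + l) := by
      funext i
      have : (finCongr (Nat.add_assoc m l n).symm) (Fin.natAdd m (Fin.natAdd l i)) =
        Fin.natAdd (m + l) i := Fin.ext (by simp [Nat.add_assoc])
      simp [finRotL, this, -finCongr_apply]
    have e4 : ⇑(finRotR n m l) ∘ Fin.castAdd (n + m) = Fin.natAdd n ∘ Fin.natAdd m := by
      ext i; simp [finRotR]; omega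
    have e5 : ⇑(finRotR n m l) ∘ Fin.natAdd l ∘ Fin.castAdd m = Fin.castAdd (m + l) := by
      ext i; simp [finRotR]
    have e6 : ⇑(finRotR n m l) ∘ Fin.natAdd l ∘ Fin.natAdd n = Fin.natAdd n ∘ Fin.castAdd l := by
      ext i; simp [finRotR]
    rw [e1, e2, e3, e4, e5, e6]
    exact lie_jacobi _ _ _

end JordanOperad

/-! ### Modules over monads and the relative composition product -/

section Modules

variable {C : Type*} [Category* C] {D : Type*} [Category* D]

/-- A right module over a monad (in particular, over an operad) `M`: a functor `F` with an action
`F ∘ M → F` that is compatible with the unit and the multiplication of `M`. If `F` takes values in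
Lie algebras, the action is by homomorphisms of Lie algebras; forgetting the brackets gives a right
module in vector spaces. -/
structure RightModule (M : CategoryTheory.Monad C) (F : C ⥤ D) where
  act : M.toFunctor ⋙ F ⟶ F
  unit : ∀ V, F.map (M.η.app V) ≫ act.app V = 𝟙 (F.obj V)
  assoc : ∀ V, F.map (M.μ.app V) ≫ act.app V = act.app (M.obj V) ≫ act.app V

/-- A left module over a monad `M`: a functor `L` with an action `M ∘ L → L` that is compatible with
the unit and the multiplication of `M`. Equivalently, each value `L(V)` has a structure of
an `M`-algebra, and all the maps `L(f)` are homomorphisms of `M`-algebras. -/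
abbrev LeftModule (M : CategoryTheory.Monad C) := C ⥤ M.Algebra

end Modules

namespace RightModule

variable {k : Type u} [Field k] {M : CategoryTheory.Monad (ModuleCat.{u} k)} {F : ModuleCat.{u} k ⥤ LieAlgs k}
  (R : RightModule M F)

/-- The right action `F(M(V)) → F(V)`. -/
def actHom (V : ModuleCat.{u} k) : (F.obj (M.obj V)).carrier →ₗ⁅k⁆ (F.obj V).carrier :=
  (R.act.app V).hom

/-- The map `F(V) → F(W)` induced by a linear map. -/
def mapHom (F : ModuleCat.{u} k ⥤ LieAlgs k) {V W : ModuleCat.{u} k} (f : V ⟶ W) :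
    (F.obj V).carrier →ₗ⁅k⁆ (F.obj W).carrier :=
  (F.map f).hom

theorem mapHom_comp {V W X : ModuleCat.{u} k} (f : V ⟶ W) (g : W ⟶ X) (x : (F.obj V).carrier) :
    mapHom F (f ≫ g) x = mapHom F g (mapHom F f x) :=
  LieHom.congr_fun (congrArg LieAlgs.Hom.hom (F.map_comp f g)) x

theorem mapHom_id (V : ModuleCat.{u} k) (x : (F.obj V).carrier) : mapHom F (𝟙 V) x = x :=
  LieHom.congr_fun (congrArg LieAlgs.Hom.hom (F.map_id V)) x

/-- The difference of the two maps `F(M(A)) → F(A)` induced by the right action of `M` on `F` and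
by the structure map `M(A) → A`. -/
def diff (A : M.Algebra) : (F.obj (M.obj A.A)).carrier →ₗ[k] (F.obj A.A).carrier :=
  (R.actHom A.A : (F.obj (M.obj A.A)).carrier →ₗ[k] (F.obj A.A).carrier) -
    (mapHom F A.a : (F.obj (M.obj A.A)).carrier →ₗ[k] (F.obj A.A).carrier)

theorem diff_apply (A : M.Algebra) (z : (F.obj (M.obj A.A)).carrier) :
    R.diff A z = R.actHom A.A z - mapHom F A.a z := rfl

/-- The image of `diff` is an ideal. -/
def ideal (A : M.Algebra) : LieIdeal k (F.obj A.A).carrier where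
  toSubmodule := LinearMap.range (R.diff A)
  lie_mem := by
    rintro x _ ⟨z, rfl⟩
    have h1 : R.actHom A.A (mapHom F (M.η.app A.A) x) = x :=
      LieHom.congr_fun (congrArg LieAlgs.Hom.hom (R.unit A.A)) x
    have h2 : mapHom F A.a (mapHom F (M.η.app A.A) x) = x := by
      rw [← mapHom_comp, A.unit]; exact mapHom_id _ _
    refine ⟨⁅mapHom F (M.η.app A.A) x, z⁆, ?_⟩
    rw [diff_apply, diff_apply, LieHom.map_lie, LieHom.map_lie, lie_sub]
    exact congrArg₂ (· - ·) (congrArg (⁅·, R.actHom A.A z⁆) h1) (congrArg (⁅·, mapHom F A.a z⁆) h2)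

theorem map_mem_ideal {A B : M.Algebra} (f : A ⟶ B) {x : (F.obj A.A).carrier} (hx : x ∈ R.ideal A) :
    mapHom F f.f x ∈ R.ideal B := by
  obtain ⟨z, rfl⟩ := hx
  refine ⟨mapHom F (M.map f.f) z, ?_⟩
  rw [diff_apply, diff_apply, map_sub, ← mapHom_comp, ← mapHom_comp, f.h]
  congr 1
  exact LieHom.congr_fun (congrArg LieAlgs.Hom.hom (R.act.naturality f.f)) z

/-- The relative composition product `F ∘_M A` for an `M`-algebra `A`: the coequalizer of the two
maps `F(M(A)) ⇉ F(A)` given by the right action of `M` on `F` and the left action of `M` on `A`,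
that is the quotient of `F(A)` by the image of their difference. -/
def relCompAlg : M.Algebra ⥤ LieAlgs k where
  obj A := ⟨(F.obj A.A).carrier ⧸ R.ideal A⟩
  map {A B} f := ⟨{
    toLinearMap := Submodule.mapQ (R.ideal A).toSubmodule (R.ideal B).toSubmodule
      (mapHom F f.f : (F.obj A.A).carrier →ₗ[k] (F.obj B.A).carrier)
      fun _ hx => R.map_mem_ideal f hx
    map_lie' {x y} := by
      obtain ⟨x, rfl⟩ := LieSubmodule.Quotient.surjective_mk' _ x
      obtain ⟨y, rfl⟩ := LieSubmodule.Quotient.surjective_mk' _ y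
      exact congrArg (LieSubmodule.Quotient.mk (N := R.ideal B)) (LieHom.map_lie (mapHom F f.f) x y) }⟩
  map_id A := LieAlgs.Hom.ext <| LieHom.ext fun x => by
    obtain ⟨x, rfl⟩ := LieSubmodule.Quotient.surjective_mk' _ x
    exact congrArg (LieSubmodule.Quotient.mk (N := R.ideal A))
      (mapHom_id A.A x)
  map_comp {A B C} f g := LieAlgs.Hom.ext <| LieHom.ext fun x => by
    obtain ⟨x, rfl⟩ := LieSubmodule.Quotient.surjective_mk' _ x
    exact congrArg (LieSubmodule.Quotient.mk (N := R.ideal C))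
      (mapHom_comp f.f g.f x)

/-- The relative composition product `L ↦ F ∘_M L` with left `M`-modules `L`, as a functor to
left modules over the Lie operad, that is functors from vector spaces to Lie algebras. -/
def relComp : LeftModule M ⥤ (ModuleCat.{u} k ⥤ LieAlgs k) :=
  (Functor.whiskeringRight _ _ _).obj R.relCompAlg

end RightModule

/-- The left module `1_J` over the Jordan operad: the constant analytic functor with the value `J`,
for a Jordan algebra `J`. -/
def oneJordan (k : Type u) [Field k] : JordAlg k ⥤ LeftModule (jordMonad k) :=
  Monad.comparison (JordAlg.adj k) ⋙ Functor.const (ModuleCat.{u} k)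

/-- The left module `1_L` over the Lie operad: the constant analytic functor with the value `L`,
for a Lie algebra `L`. -/
def oneLie (k : Type u) [Field k] : LieAlgs k ⥤ (ModuleCat.{u} k ⥤ LieAlgs k) :=
  Functor.const (ModuleCat.{u} k)

end

noncomputable section

set_option linter.unusedSectionVars false

/-! ### Bilinear pairings and evaluation on analytic functors -/

namespace SymSeq

variable {k : Type u} [Field k] {K L M : SymSeq k}
  {V : Type u} [AddCommGroup V] [Module k V]

theorem tensorPower_ext {n : ℕ} {Y : Type*} [AddCommGroup Y] [Module k Y]
    {f g : (⨂[k]^n V) →ₗ[k] Y}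
    (h : ∀ v : Fin n → V, f (PiTensorProduct.tprod k v) = g (PiTensorProduct.tprod k v)) : f = g :=
  PiTensorProduct.ext (MultilinearMap.ext h)

theorem eval_ext_tprod {Y : Type*} [AddCommGroup Y] [Module k Y] {f g : K.Eval V →ₗ[k] Y}
    (h : ∀ n (x : K.obj n) (v : Fin n → V), f (K.cls V n (x ⊗ₜ PiTensorProduct.tprod k v)) =
      g (K.cls V n (x ⊗ₜ PiTensorProduct.tprod k v))) : f = g :=
  eval_ext fun n x v => by
    have : (f ∘ₗ K.cls V n) ∘ₗ TensorProduct.mk k _ _ x =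
        (g ∘ₗ K.cls V n) ∘ₗ TensorProduct.mk k _ _ x := tensorPower_ext fun v => h n x v
    exact LinearMap.congr_fun this v

/-- A linear map out of `K(V)` given by compatible multilinear evaluations. -/
def evalOfMultilinear {Y : Type*} [AddCommGroup Y] [Module k Y]
    (ev : ∀ n, K.obj n →ₗ[k] MultilinearMap k (fun _ : Fin n => V) Y)
    (hev : ∀ n (σ : Fin n ≃ Fin n) (x : K.obj n) (v : Fin n → V),
      ev n (K.map σ x) (v ∘ σ.symm) = ev n x v) : K.Eval V →ₗ[k] Y :=
  evalLift (fun n => TensorProduct.lift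
      ((PiTensorProduct.lift (R := k) (s := fun _ : Fin n => V) (E := Y)).toLinearMap ∘ₗ ev n)) (by
    intro n σ x v
    have : PiTensorProduct.lift (ev n (K.map σ x)) ∘ₗ
        (PiTensorProduct.reindex k (fun _ => V) σ).toLinearMap =
        PiTensorProduct.lift (ev n x) := tensorPower_ext fun v => by
      rw [LinearMap.comp_apply, LinearEquiv.coe_coe, PiTensorProduct.reindex_tprod,
        PiTensorProduct.lift.tprod, PiTensorProduct.lift.tprod]
      exact hev n σ x v
    exact LinearMap.congr_fun this v)

theorem evalOfMultilinear_cls {Y : Type*} [AddCommGroup Y] [Module k Y]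
    (ev : ∀ n, K.obj n →ₗ[k] MultilinearMap k (fun _ : Fin n => V) Y) (hev)
    (n : ℕ) (x : K.obj n) (v : Fin n → V) :
    evalOfMultilinear ev hev (K.cls V n (x ⊗ₜ PiTensorProduct.tprod k v)) = ev n x v := by
  refine (evalLift_cls _ _ n _).trans ?_
  rw [TensorProduct.lift.tmul]
  exact PiTensorProduct.lift.tprod v

theorem cls_map_tprod (K : SymSeq k) {n m : ℕ} (σ : Fin n ≃ Fin m) (x : K.obj n) (v : Fin m → V) :
    K.cls V m (K.map σ x ⊗ₜ PiTensorProduct.tprod k v) =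
      K.cls V n (x ⊗ₜ PiTensorProduct.tprod k (v ∘ σ)) := by
  rw [← K.cls_map σ, PiTensorProduct.reindex_tprod]
  congr 4
  funext i
  simp

variable (V) in
/-- The bilinear map `K(V) × L(V) → M(V)` induced by equivariant bilinear maps
`K(n) × L(m) → M(n + m)`. -/
def evalPairing (b : ∀ n m, K.obj n →ₗ[k] L.obj m →ₗ[k] M.obj (n + m))
    (hb : ∀ {n n' m m' : ℕ} (σ : Fin n ≃ Fin n') (τ : Fin m ≃ Fin m') (x : K.obj n) (y : L.obj m),
      b n' m' (K.map σ x) (L.map τ y) = M.map (finSumCongr σ τ) (b n m x y)) :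
    K.Eval V →ₗ[k] L.Eval V →ₗ[k] M.Eval V :=
  evalLift (fun n => LinearMap.flip (evalLift
    (fun m => (LinearMap.flip
      ((TensorProduct.map₂ (b n m) (TwistedLie.tmulMap V n m)).compr₂ (M.cls V (n + m)))))
    (by
      intro m σ y w
      refine TensorProduct.ext' fun x v => ?_
      simp only [LinearMap.flip_apply, LinearMap.compr₂_apply, TensorProduct.map₂_apply_tmul]
      have h := hb (Equiv.refl (Fin n)) σ x y
      have h' := TwistedLie.tmulMap_reindex (k := k) (Equiv.refl (Fin n)) σ v w
      rw [K.map_refl, LinearMap.id_apply] at h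
      rw [PiTensorProduct.reindex_refl, LinearEquiv.refl_apply] at h'
      rw [TensorProduct.map_tmul, TensorProduct.map_tmul, h, h', M.cls_map])))
    (by
      intro n σ x v
      refine eval_ext fun m y w => ?_
      simp only [LinearMap.flip_apply, evalLift_cls, LinearMap.compr₂_apply,
        TensorProduct.map₂_apply_tmul]
      have h := hb σ (Equiv.refl (Fin m)) x y
      have h' := TwistedLie.tmulMap_reindex (k := k) σ (Equiv.refl (Fin m)) v w
      rw [L.map_refl, LinearMap.id_apply] at h
      rw [PiTensorProduct.reindex_refl, LinearEquiv.refl_apply] at h'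
      rw [TensorProduct.map_tmul, TensorProduct.map_tmul, h, h', M.cls_map])

theorem evalPairing_cls (b : ∀ n m, K.obj n →ₗ[k] L.obj m →ₗ[k] M.obj (n + m)) (hb) {n m : ℕ}
    (x : K.obj n) (v : Fin n → V) (y : L.obj m) (w : Fin m → V) :
    evalPairing V b hb (K.cls V n (x ⊗ₜ PiTensorProduct.tprod k v))
        (L.cls V m (y ⊗ₜ PiTensorProduct.tprod k w)) =
      M.cls V (n + m) (b n m x y ⊗ₜ PiTensorProduct.tprod k (Fin.append v w)) := by
  simp [evalPairing, TwistedLie.tmulMap_tprod]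

end SymSeq

namespace JordanOperad

open JordanLie

variable {k : Type u} [Field k] {V W : Type u} [AddCommGroup V] [Module k V] [AddCommGroup W]
  [Module k W]

/-! ### Substitution of vectors for the generators -/

variable (k) in
/-- The substitution `x_i ↦ v_i`. -/
def subst {n : ℕ} (v : Fin n → V) : FreeOn k n →ₙₐ[k] FreeJordan k V :=
  FreeJordan.map (Finsupp.linearCombination k v)

theorem subst_comp_rename {n m : ℕ} (v : Fin m → V) (φ : Fin n → Fin m) :
    (subst k v).comp (rename k φ) = subst k (v ∘ φ) :=
  FreeJordan.hom_ext fun x => by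
    simp [subst, rename, FreeJordan.map, Finsupp.linearCombination_mapDomain]

theorem subst_rename {n m : ℕ} (v : Fin m → V) (φ : Fin n → Fin m) (z : FreeOn k n) :
    subst k v (rename k φ z) = subst k (v ∘ φ) z :=
  DFunLike.congr_fun (subst_comp_rename v φ) z

theorem map_comp_subst {n : ℕ} (f : V →ₗ[k] W) (v : Fin n → V) :
    (FreeJordan.map f).comp (subst k v) = subst k (f ∘ v) :=
  FreeJordan.hom_ext fun x => by
    simp [subst, FreeJordan.map, Finsupp.linearCombination_apply, Finsupp.sum, map_sum]

theorem map_subst {n : ℕ} (f : V →ₗ[k] W) (v : Fin n → V) (z : FreeOn k n) :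
    FreeJordan.map f (subst k v z) = subst k (f ∘ v) z :=
  DFunLike.congr_fun (map_comp_subst f v) z

theorem word_of {n : ℕ} (i : Fin n) :
    word k (FreeMagma.of i) = FreeJordan.ι k (Fin n →₀ k) (Finsupp.single i 1) := rfl

theorem subst_word_of {n : ℕ} (v : Fin n → V) (i : Fin n) :
    subst k v (word k (FreeMagma.of i)) = FreeJordan.ι k V (v i) := by
  simp [word_of, subst, FreeJordan.map]

theorem subst_update_of_occ_eq_zero {n : ℕ} [DecidableEq (Fin n)] (v : Fin n → V) (i : Fin n)
    (x : V) (u : FreeMagma (Fin n)) (h : occ i u = 0) :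
    subst k (Function.update v i x) (word k u) = subst k v (word k u) := by
  induction u using FreeMagma.recOnMul with
  | ih1 j =>
    have hj : j ≠ i := fun e => by simp [occ, e] at h
    rw [subst_word_of, subst_word_of, Function.update_of_ne hj]
  | ih2 u w hu hw =>
    rw [occ_mul] at h
    rw [map_mul, map_mul, map_mul, hu (by omega), hw (by omega)]

theorem subst_update_linear {n : ℕ} [DecidableEq (Fin n)] (v : Fin n → V) (i : Fin n)
    (u : FreeMagma (Fin n)) (h : occ i u = 1) :
    ∃ L : V →ₗ[k] FreeJordan k V, ∀ x, subst k (Function.update v i x) (word k u) = L x := by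
  induction u using FreeMagma.recOnMul with
  | ih1 j =>
    have hj : j = i := by by_contra e; simp [occ, e] at h
    exact ⟨FreeJordan.ι k V, fun x => by rw [subst_word_of, hj, Function.update_self]⟩
  | ih2 u w hu hw =>
    rw [occ_mul] at h
    rcases Nat.eq_zero_or_pos (occ i u) with h0 | h0
    · obtain ⟨L, hL⟩ := hw (by omega)
      refine ⟨LinearMap.mul k _ (subst k v (word k u)) ∘ₗ L, fun x => ?_⟩
      rw [map_mul, map_mul, subst_update_of_occ_eq_zero _ _ _ _ h0, hL]; rfl
    · obtain ⟨L, hL⟩ := hu (by omega)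
      refine ⟨(LinearMap.mul k _).flip (subst k v (word k w)) ∘ₗ L, fun x => ?_⟩
      rw [map_mul, map_mul, subst_update_of_occ_eq_zero _ _ _ w (by omega), hL]; rfl

theorem subst_update_linear_of_mem {n : ℕ} [DecidableEq (Fin n)] (v : Fin n → V) (i : Fin n)
    {z : FreeOn k n} (hz : z ∈ jordSub k n) :
    ∃ L : V →ₗ[k] FreeJordan k V, ∀ x, subst k (Function.update v i x) z = L x := by
  induction hz using Submodule.span_induction with
  | mem z h => obtain ⟨u, hu, rfl⟩ := h; exact subst_update_linear v i u (hu i)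
  | zero => exact ⟨0, fun x => by simp⟩
  | add a b _ _ ha hb =>
    obtain ⟨L, hL⟩ := ha
    obtain ⟨L', hL'⟩ := hb
    exact ⟨L + L', fun x => by simp [hL, hL']⟩
  | smul c a _ ha =>
    obtain ⟨L, hL⟩ := ha
    exact ⟨c • L, fun x => by simp [hL]⟩

variable (k V) in
/-- The evaluation of the elements of `Jord(n)`. -/
def jordEv (n : ℕ) :
    (jordSeq k).obj n →ₗ[k] MultilinearMap k (fun _ : Fin n => V) (FreeJordan k V) where
  toFun a :=
    { toFun v := subst k v a.1
      map_update_add' v i x y := by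
        obtain ⟨L, hL⟩ := subst_update_linear_of_mem v i a.2
        simp only [hL, map_add]
      map_update_smul' v i c x := by
        obtain ⟨L, hL⟩ := subst_update_linear_of_mem v i a.2
        simp only [hL, map_smul] }
  map_add' a b := by ext v; exact map_add (subst k v) a.1 b.1
  map_smul' c a := by ext v; exact map_smul (subst k v) c a.1

variable (k V) in
/-- The evaluation map from the analytic functor of `{Jord(n)}` to free Jordan algebras. -/
def jordEval : (jordSeq k).Eval V →ₗ[k] FreeJordan k V :=
  SymSeq.evalOfMultilinear (jordEv k V) fun n σ x v => by
    change subst k (v ∘ σ.symm) (rename k σ x.1) = subst k v x.1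
    rw [subst_rename, Function.comp_assoc, Equiv.symm_comp_self, Function.comp_id]

theorem jordEval_cls {n : ℕ} (a : jordSub k n) (v : Fin n → V) :
    jordEval k V ((jordSeq k).cls V n (a ⊗ₜ PiTensorProduct.tprod k v)) = subst k v a.1 :=
  SymSeq.evalOfMultilinear_cls (jordEv k V) _ n a v

section TAG

variable [CharZero k]

theorem TAG_map_inl {J J' : Type u} [NonUnitalNonAssocCommRing J] [Module k J]
    [IsScalarTower k J J] [SMulCommClass k J J] [IsCommJordan J]
    [NonUnitalNonAssocCommRing J'] [Module k J'] [IsScalarTower k J' J'] [SMulCommClass k J' J']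
    [IsCommJordan J'] (f : J →ₙₐ[k] J') (x : Sl2 k) (a : J) :
    TAG.map f (TAG.inl x a) = TAG.inl x (f a) :=
  Prod.ext rfl (map_zero (mapB f))

theorem TAG_map_inr {J J' : Type u} [NonUnitalNonAssocCommRing J] [Module k J]
    [IsScalarTower k J J] [SMulCommClass k J J] [IsCommJordan J]
    [NonUnitalNonAssocCommRing J'] [Module k J'] [IsScalarTower k J' J'] [SMulCommClass k J' J']
    [IsCommJordan J'] (f : J →ₙₐ[k] J') (a b : J) :
    TAG.map f (TAG.inr a b) = TAG.inr (k := k) (f a) (f b) :=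
  Prod.ext (map_zero ((f : J →ₗ[k] J').lTensor (Sl2 k))) (mapB_wedge f a b)

variable (k) in
/-- The linear map `a ↦ x ⊗ a` from `J` to `TAG(J)`. -/
def inlHom {J : Type u} [NonUnitalNonAssocCommRing J] [Module k J]
    [IsScalarTower k J J] [SMulCommClass k J J] : Sl2 k →ₗ[k] J →ₗ[k] TAG k J :=
  (TensorProduct.mk k (Sl2 k) J).compr₂ (LinearMap.inl k (Sl2 k ⊗[k] J) (B k J))

variable (k) in
/-- The bilinear map `(a, b) ↦ a ∧ b` from `J` to `TAG(J)`. -/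
def inrHom {J : Type u} [NonUnitalNonAssocCommRing J] [Module k J]
    [IsScalarTower k J J] [SMulCommClass k J J] : J →ₗ[k] J →ₗ[k] TAG k J :=
  (wedge k J).compr₂ (LinearMap.inr k (Sl2 k ⊗[k] J) (B k J))

theorem TAG_map_subst_update_linear {n : ℕ} [DecidableEq (Fin n)] (v : Fin n → V) (i : Fin n)
    {p : TAG k (FreeOn k n)} (hp : p ∈ tagSub k n) :
    ∃ L : V →ₗ[k] TAG k (FreeJordan k V),
      ∀ x, TAG.map (subst k (Function.update v i x)) p = L x := by
  refine tagSub_induction (P := fun p => ∃ L : V →ₗ[k] TAG k (FreeJordan k V),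
      ∀ x, TAG.map (subst k (Function.update v i x)) p = L x) hp
    (fun x u hu => ?_) (fun u w hu => ?_) ?_ (fun p q hp hq => ?_) (fun c p hp => ?_)
  · obtain ⟨L, hL⟩ := subst_update_linear (k := k) v i u (hu i)
    exact ⟨inlHom k x ∘ₗ L, fun y => by rw [TAG_map_inl, hL]; rfl⟩
  · have h := hu i
    rw [occ_mul] at h
    rcases Nat.eq_zero_or_pos (occ i u) with h0 | h0
    · obtain ⟨L, hL⟩ := subst_update_linear (k := k) v i w (by omega)
      refine ⟨inrHom k (subst k v (word k u)) ∘ₗ L, fun x => ?_⟩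
      rw [TAG_map_inr, subst_update_of_occ_eq_zero _ _ _ _ h0, hL]; rfl
    · obtain ⟨L, hL⟩ := subst_update_linear (k := k) v i u (by omega)
      refine ⟨(inrHom k).flip (subst k v (word k w)) ∘ₗ L, fun x => ?_⟩
      rw [TAG_map_inr, subst_update_of_occ_eq_zero _ _ _ w (by omega), hL]; rfl
  · exact ⟨0, fun x => by simp⟩
  · obtain ⟨L, hL⟩ := hp
    obtain ⟨L', hL'⟩ := hq
    exact ⟨L + L', fun x => by rw [map_add, hL, hL']; rfl⟩
  · obtain ⟨L, hL⟩ := hp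
    exact ⟨c • L, fun x => by rw [map_smul, hL]; rfl⟩

variable (k V) in
/-- The evaluation of the elements of `TAG(n)`. -/
def tagEv (n : ℕ) :
    (tag k).obj n →ₗ[k] MultilinearMap k (fun _ : Fin n => V) (TAG k (FreeJordan k V)) where
  toFun p :=
    { toFun v := TAG.map (subst k v) p.1
      map_update_add' v i x y := by
        obtain ⟨L, hL⟩ := TAG_map_subst_update_linear v i p.2
        simp only [hL, map_add]
      map_update_smul' v i c x := by
        obtain ⟨L, hL⟩ := TAG_map_subst_update_linear v i p.2
        simp only [hL, map_smul] }
  map_add' a b := by ext v; exact map_add (TAG.map (subst k v)) a.1 b.1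
  map_smul' c a := by ext v; exact map_smul (TAG.map (subst k v)) c a.1

theorem TAG_map_subst_rename {n m : ℕ} (v : Fin m → V) (φ : Fin n → Fin m)
    (p : TAG k (FreeOn k n)) :
    TAG.map (subst k v) (TAG.map (rename k φ) p) = TAG.map (subst k (v ∘ φ)) p := by
  rw [← TAG.map_comp, subst_comp_rename]

variable (k V) in
/-- The evaluation map `TAG(V) → TAG(Jord(V))`. -/
def tagEval : (tag k).Eval V →ₗ[k] TAG k (FreeJordan k V) :=
  SymSeq.evalOfMultilinear (K := (tag k).toSymSeq) (tagEv k V) fun n σ p v => by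
    change TAG.map (subst k (v ∘ σ.symm)) (TAG.map (rename k σ) p.1) = TAG.map (subst k v) p.1
    rw [TAG_map_subst_rename, Function.comp_assoc, Equiv.symm_comp_self, Function.comp_id]

theorem tagEval_cls {n : ℕ} (p : tagSub k n) (v : Fin n → V) :
    tagEval k V ((tag k).cls V n (p ⊗ₜ PiTensorProduct.tprod k v)) = TAG.map (subst k v) p.1 :=
  SymSeq.evalOfMultilinear_cls (K := (tag k).toSymSeq) (tagEv k V) _ n p v

theorem append_comp_castAdd {α : Type*} {n m : ℕ} (v : Fin n → α) (w : Fin m → α) :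
    Fin.append v w ∘ Fin.castAdd m = v :=
  funext fun i => Fin.append_left v w i

theorem append_comp_natAdd {α : Type*} {n m : ℕ} (v : Fin n → α) (w : Fin m → α) :
    Fin.append v w ∘ Fin.natAdd n = w :=
  funext fun i => Fin.append_right v w i

theorem tagEval_lie (a b : (tag k).Eval V) :
    tagEval k V ⁅a, b⁆ = ⁅tagEval k V a, tagEval k V b⁆ := by
  let lieHom : TAG k (FreeJordan k V) →ₗ[k] TAG k (FreeJordan k V) →ₗ[k] TAG k (FreeJordan k V) :=
    LinearMap.mk₂ k (fun x y => ⁅x, y⁆) add_lie smul_lie lie_add (fun c x y => lie_smul c x y)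
  have : ((tag k).evalBracket V).compr₂ (tagEval k V) =
      lieHom.compl₁₂ (tagEval k V) (tagEval k V) := by
    refine SymSeq.eval_ext_tprod (K := (tag k).toSymSeq) fun n p v =>
      SymSeq.eval_ext_tprod (K := (tag k).toSymSeq) fun m q w => ?_
    rw [LinearMap.compr₂_apply, TwistedLie.evalBracket_cls, TwistedLie.tmulMap_tprod]
    refine (tagEval_cls _ _).trans ?_
    change TAG.map _ ⁅TAG.map (rename k (Fin.castAdd m)) p.1, TAG.map (rename k (Fin.natAdd n)) q.1⁆ =
      ⁅tagEval k V _, tagEval k V _⁆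
    erw [tagEval_cls p v, tagEval_cls q w]
    rw [LieHom.map_lie, TAG_map_subst_rename, TAG_map_subst_rename, append_comp_castAdd,
      append_comp_natAdd]
  exact LinearMap.congr_fun₂ this a b

end TAG

end JordanOperad

/-! ### The Jordan algebra structure on the analytic functor of `{Jord(n)}` -/

namespace JordanOperad

open JordanLie

variable {k : Type u} [Field k] {V W : Type u} [AddCommGroup V] [Module k V] [AddCommGroup W]
  [Module k W]

theorem bilinear_mem_of_word {n m : ℕ} {Y : Type*} [AddCommGroup Y] [Module k Y]
    (f : FreeOn k n →ₗ[k] FreeOn k m →ₗ[k] Y) (P : Submodule k Y)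
    (h : ∀ u w, IsMultilinear u → IsMultilinear w → f (word k u) (word k w) ∈ P)
    {a : FreeOn k n} (ha : a ∈ jordSub k n) {b : FreeOn k m} (hb : b ∈ jordSub k m) :
    f a b ∈ P := by
  refine LinearMap.BilinMap.apply_apply_mem_of_mem_span P _ _ f ?_ a b ha hb
  rintro _ ⟨u, hu, rfl⟩ _ ⟨w, hw, rfl⟩
  exact h u w hu hw

theorem mul_mem_jordSub {n m : ℕ} {a : FreeOn k n} (ha : a ∈ jordSub k n) {b : FreeOn k m}
    (hb : b ∈ jordSub k m) :
    rename k (Fin.castAdd m) a * rename k (Fin.natAdd n) b ∈ jordSub k (n + m) :=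
  bilinear_mem_of_word ((LinearMap.mul k (FreeOn k (n + m))).compl₁₂
    (rename k (Fin.castAdd m : Fin n → Fin (n + m)) : FreeOn k n →ₗ[k] FreeOn k (n + m))
    (rename k (Fin.natAdd n : Fin m → Fin (n + m)) : FreeOn k m →ₗ[k] FreeOn k (n + m)))
    (jordSub k (n + m)) (fun u w hu hw => by
      change rename k (Fin.castAdd m) (word k u) * rename k (Fin.natAdd n) (word k w) ∈
        jordSub k (n + m)
      rw [rename_word, rename_word, ← map_mul]
      exact word_mem fun i => occ_append hu hw i) ha hb

theorem inr_mem_tagSub {n m : ℕ} {a : FreeOn k n} (ha : a ∈ jordSub k n)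
    {b : FreeOn k m} (hb : b ∈ jordSub k m) :
    TAG.inr (rename k (Fin.castAdd m) a) (rename k (Fin.natAdd n) b) ∈ tagSub k (n + m) :=
  bilinear_mem_of_word ((inrHom (J := FreeOn k (n + m)) k).compl₁₂
    (rename k (Fin.castAdd m : Fin n → Fin (n + m)) : FreeOn k n →ₗ[k] FreeOn k (n + m))
    (rename k (Fin.natAdd n : Fin m → Fin (n + m)) : FreeOn k m →ₗ[k] FreeOn k (n + m)))
    (tagSub k (n + m)) (fun u w hu hw => by
      change TAG.inr (rename k (Fin.castAdd m) (word k u))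
        (rename k (Fin.natAdd n) (word k w)) ∈ tagSub k (n + m)
      rw [rename_word, rename_word]
      exact inr_mem fun i => occ_append hu hw i) ha hb

theorem rename_rename {n m l : ℕ} (ψ : Fin m → Fin l) (φ : Fin n → Fin m) (z : FreeOn k n) :
    rename k ψ (rename k φ z) = rename k (ψ ∘ φ) z := by
  rw [rename_comp]; rfl

theorem finSumCongr_comp_castAdd {n n' m m' : ℕ} (σ : Fin n ≃ Fin n') (τ : Fin m ≃ Fin m') :
    finSumCongr σ τ ∘ Fin.castAdd m = Fin.castAdd m' ∘ σ := by
  ext i; simp [finSumCongr]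

theorem finSumCongr_comp_natAdd {n n' m m' : ℕ} (σ : Fin n ≃ Fin n') (τ : Fin m ≃ Fin m') :
    finSumCongr σ τ ∘ Fin.natAdd n = Fin.natAdd n' ∘ τ := by
  ext i; simp [finSumCongr]

variable (k) in
/-- The product of multilinear elements in disjoint sets of variables. -/
def jordMul (n m : ℕ) : (jordSeq k).obj n →ₗ[k] (jordSeq k).obj m →ₗ[k] (jordSeq k).obj (n + m) :=
  LinearMap.mk₂ k (fun a b => (⟨rename k (Fin.castAdd m) a.1 * rename k (Fin.natAdd n) b.1,
      mul_mem_jordSub a.2 b.2⟩ : jordSub k (n + m)))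
    (fun a a' b => Subtype.ext <| by
      change rename k _ (a.1 + a'.1) * _ = _ * _ + _ * _
      rw [map_add, add_mul])
    (fun c a b => Subtype.ext <| by
      change rename k _ (c • a.1) * _ = c • (_ * _)
      rw [map_smul, smul_mul_assoc])
    (fun a b b' => Subtype.ext <| by
      change _ * rename k _ (b.1 + b'.1) = _ * _ + _ * _
      rw [map_add, mul_add])
    (fun c a b => Subtype.ext <| by
      change _ * rename k _ (c • b.1) = c • (_ * _)
      rw [map_smul, mul_smul_comm])

variable (k V) in
/-- The product of the analytic functor of `{Jord(n)}`. -/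
def evalMul : (jordSeq k).Eval V →ₗ[k] (jordSeq k).Eval V →ₗ[k] (jordSeq k).Eval V :=
  SymSeq.evalPairing V (jordMul k) (by
    intro n n' m m' σ τ a b
    refine Subtype.ext ?_
    change rename k (Fin.castAdd m') (rename k σ a.1) * rename k (Fin.natAdd n') (rename k τ b.1) =
      rename k (finSumCongr σ τ) (rename k (Fin.castAdd m) a.1 * rename k (Fin.natAdd n) b.1)
    rw [map_mul, rename_rename, rename_rename, rename_rename, rename_rename,
      finSumCongr_comp_castAdd, finSumCongr_comp_natAdd])

instance : NonUnitalNonAssocRing ((jordSeq k).Eval V) :=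
  { (inferInstance : AddCommGroup ((jordSeq k).Eval V)) with
    mul a b := evalMul k V a b
    left_distrib a b c := map_add (evalMul k V a) b c
    right_distrib a b c := LinearMap.map_add₂ (evalMul k V) a b c
    zero_mul a := LinearMap.map_zero₂ (evalMul k V) a
    mul_zero a := map_zero (evalMul k V a) }

instance : IsScalarTower k ((jordSeq k).Eval V) ((jordSeq k).Eval V) where
  smul_assoc c a b := LinearMap.map_smul₂ (evalMul k V) c a b

instance : SMulCommClass k ((jordSeq k).Eval V) ((jordSeq k).Eval V) where
  smul_comm c a b := (map_smul (evalMul k V a) c b).symm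

variable (k) in
/-- The class of an element of `Jord(n)` with a given substitution, as a linear map. -/
def clsAt {n : ℕ} (v : Fin n → V) : jordSub k n →ₗ[k] (jordSeq k).Eval V :=
  (jordSeq k).cls V n ∘ₗ
    (TensorProduct.mk k ((jordSeq k).obj n) (⨂[k]^n V)).flip (PiTensorProduct.tprod k v)

theorem clsAt_apply {n : ℕ} (v : Fin n → V) (a : jordSub k n) :
    clsAt k v a = (jordSeq k).cls V n (a ⊗ₜ PiTensorProduct.tprod k v) := rfl

theorem clsAt_mul {n m : ℕ} (v : Fin n → V) (a : jordSub k n) (w : Fin m → V) (b : jordSub k m) :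
    clsAt k v a * clsAt k w b = clsAt k (Fin.append v w)
      ⟨rename k (Fin.castAdd m) a.1 * rename k (Fin.natAdd n) b.1, mul_mem_jordSub a.2 b.2⟩ :=
  SymSeq.evalPairing_cls (jordMul k) _ a v b w

theorem clsAt_comp_equiv {n m : ℕ} (σ : Fin n ≃ Fin m) (v : Fin m → V) (a : jordSub k n) :
    clsAt k (v ∘ σ) a = clsAt k v ⟨rename k σ a.1, rename_mem_jordSub σ a.2⟩ :=
  ((jordSeq k).cls_map_tprod σ a v).symm

/-- `α` is the class of an element `z` that is multilinear in the variables `x_i` with `i ∈ S`,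
with `v_i` substituted for `x_i`. -/
def IsClass {N : ℕ} (v : Fin N → V) (S : Set (Fin N)) (z : FreeOn k N)
    (α : (jordSeq k).Eval V) : Prop :=
  ∃ (n : ℕ) (f : Fin n → Fin N) (a : jordSub k n), Function.Injective f ∧ Set.range f = S ∧
    rename k f a.1 = z ∧ clsAt k (v ∘ f) a = α

theorem append_comp {α β : Type*} {n m : ℕ} (v : α → β) (f : Fin n → α) (g : Fin m → α) :
    Fin.append (v ∘ f) (v ∘ g) = v ∘ Fin.append f g := by
  funext i
  refine Fin.addCases (fun i => ?_) (fun i => ?_) i <;> simp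

theorem range_append {α : Type*} {n m : ℕ} (f : Fin n → α) (g : Fin m → α) :
    Set.range (Fin.append f g) = Set.range f ∪ Set.range g := by
  ext x
  constructor
  · rintro ⟨i, rfl⟩
    refine Fin.addCases (fun i => ?_) (fun i => ?_) i <;> simp
  · rintro (⟨i, rfl⟩ | ⟨i, rfl⟩)
    · exact ⟨Fin.castAdd m i, Fin.append_left f g i⟩
    · exact ⟨Fin.natAdd n i, Fin.append_right f g i⟩

theorem append_injective {α : Type*} {n m : ℕ} {f : Fin n → α} {g : Fin m → α}
    (hf : Function.Injective f) (hg : Function.Injective g)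
    (h : Disjoint (Set.range f) (Set.range g)) : Function.Injective (Fin.append f g) := by
  have h' : ∀ i j, f i ≠ g j := fun i j e =>
    Set.disjoint_left.1 h ⟨i, rfl⟩ ⟨j, e.symm⟩
  intro i j
  refine Fin.addCases (fun i => ?_) (fun i => ?_) i <;>
    refine Fin.addCases (fun j => ?_) (fun j => ?_) j <;>
    simp only [Fin.append_left, Fin.append_right] <;> intro e
  · rw [hf e]
  · exact (h' _ _ e).elim
  · exact (h' _ _ e.symm).elim
  · rw [hg e]

theorem IsClass.mul {N : ℕ} {v : Fin N → V} {S T : Set (Fin N)} {z w : FreeOn k N}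
    {α β : (jordSeq k).Eval V} (h : IsClass v S z α) (h' : IsClass v T w β) (hd : Disjoint S T) :
    IsClass v (S ∪ T) (z * w) (α * β) := by
  obtain ⟨n, f, a, hf, rfl, rfl, rfl⟩ := h
  obtain ⟨m, g, b, hg, rfl, rfl, rfl⟩ := h'
  refine ⟨n + m, Fin.append f g, _, append_injective hf hg hd, range_append f g, ?_,
    (append_comp v f g ▸ clsAt_mul (v ∘ f) a (v ∘ g) b).symm⟩
  rw [map_mul, rename_rename, rename_rename, append_comp_castAdd, append_comp_natAdd]

theorem IsClass.exists_equiv {N : ℕ} {v : Fin N → V} {z : FreeOn k N} {α : (jordSeq k).Eval V}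
    (h : IsClass v Set.univ z α) : ∃ hz : z ∈ jordSub k N, α = clsAt k v ⟨z, hz⟩ := by
  obtain ⟨n, f, a, hf, hr, rfl, rfl⟩ := h
  let σ : Fin n ≃ Fin N := Equiv.ofBijective f ⟨hf, Set.range_eq_univ.1 hr⟩
  exact ⟨rename_mem_jordSub σ a.2, clsAt_comp_equiv σ v a⟩

theorem exists_isClass {ι : Type} [Fintype ι] (α : ι → (jordSeq k).Eval V)
    (h : ∀ i, ∃ (n : ℕ) (v : Fin n → V) (a : jordSub k n), α i = clsAt k v a) :
    ∃ (N : ℕ) (w : Fin N → V) (S : ι → Set (Fin N)) (z : ι → FreeOn k N),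
      (∀ i j, i ≠ j → Disjoint (S i) (S j)) ∧ (∀ x, ∃ i, x ∈ S i) ∧
        ∀ i, IsClass w (S i) (z i) (α i) := by
  choose n v a hα using h
  let e := Fintype.equivFin (Σ i, Fin (n i))
  refine ⟨_, (fun x => v x.1 x.2) ∘ e.symm, fun i => Set.range fun j => e ⟨i, j⟩,
    fun i => rename k (fun j => e ⟨i, j⟩) (a i).1, fun i j hij => ?_, fun x => ?_, fun i => ?_⟩
  · rw [Set.disjoint_left]
    rintro _ ⟨x, rfl⟩ ⟨y, hy⟩
    exact hij (congrArg Sigma.fst (e.injective hy)).symm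
  · exact ⟨(e.symm x).1, (e.symm x).2, e.apply_symm_apply x⟩
  · refine ⟨n i, _, a i, fun x y hxy => by simpa using hxy, rfl, rfl, ?_⟩
    rw [hα i]
    exact congrArg (fun w => clsAt k w (a i)) (funext fun j =>
      (congrArg (fun x : Σ i, Fin (n i) => v x.1 x.2) (e.symm_apply_apply ⟨i, j⟩)))

theorem eval_span_induction {p : (jordSeq k).Eval V → Prop} (z : (jordSeq k).Eval V)
    (h : ∀ n (v : Fin n → V) (a : jordSub k n), p (clsAt k v a))
    (h0 : p 0) (hadd : ∀ a b, p a → p b → p (a + b)) : p z := by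
  refine SymSeq.eval_induction z (fun n x v => ?_) h0 hadd
  induction v using PiTensorProduct.induction_on with
  | smul_tprod c v =>
    rw [← TensorProduct.smul_tmul]
    exact h n v _
  | add v w hv hw => rw [TensorProduct.tmul_add, map_add]; exact hadd _ _ hv hw

theorem eval_mul_comm (a b : (jordSeq k).Eval V) : a * b = b * a := by
  induction a using eval_span_induction with
  | h0 => simp
  | hadd a a' ha ha' => rw [add_mul, mul_add, ha, ha']
  | h n v x =>
  induction b using eval_span_induction with
  | h0 => simp
  | hadd a a' ha ha' => rw [add_mul, mul_add, ha, ha']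
  | h m w y =>
  obtain ⟨N, t, S, z, hd, hc, hz⟩ := exists_isClass ![clsAt k v x, clsAt k w y] (by
    intro i; fin_cases i <;> exact ⟨_, _, _, rfl⟩)
  have hu : S 0 ∪ S 1 = Set.univ := Set.eq_univ_of_forall fun x => by
    obtain ⟨i, hi⟩ := hc x
    fin_cases i <;> simp_all
  obtain ⟨h1, h1'⟩ := (hu ▸ (hz 0).mul (hz 1) (hd 0 1 (by decide))).exists_equiv
  obtain ⟨h2, h2'⟩ := (hu ▸ Set.union_comm _ _ ▸
    (hz 1).mul (hz 0) (hd 1 0 (by decide))).exists_equiv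
  refine h1'.trans (Eq.trans ?_ h2'.symm)
  congr 2
  exact mul_comm _ _

instance : NonUnitalNonAssocCommRing ((jordSeq k).Eval V) where
  mul_comm := eval_mul_comm

theorem eval_jordan_linearized [CharZero k] (a b c d : (jordSeq k).Eval V) :
    (a * (b * c * d) - b * c * (a * d)) + (b * (c * a * d) - c * a * (b * d))
      + (c * (a * b * d) - a * b * (c * d)) = 0 := by
  have key (P P' : (jordSeq k).Eval V) (Q : (jordSeq k).Eval V) (h : P = 0) (h' : P' = 0)
    (hQ : Q = P + P') : Q = 0 := by rw [hQ, h, h', add_zero]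
  induction a using eval_span_induction with
  | h0 => simp
  | hadd a a' ha ha' =>
    refine key _ _ _ ha ha' ?_
    simp only [add_mul, mul_add]; abel
  | h n₁ v₁ x₁ =>
  induction b using eval_span_induction with
  | h0 => simp
  | hadd a a' ha ha' =>
    refine key _ _ _ ha ha' ?_
    simp only [add_mul, mul_add]; abel
  | h n₂ v₂ x₂ =>
  induction c using eval_span_induction with
  | h0 => simp
  | hadd a a' ha ha' =>
    refine key _ _ _ ha ha' ?_
    simp only [add_mul, mul_add]; abel
  | h n₃ v₃ x₃ =>
  induction d using eval_span_induction with
  | h0 => simp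
  | hadd a a' ha ha' =>
    refine key _ _ _ ha ha' ?_
    simp only [mul_add]; abel
  | h n₄ v₄ x₄ =>
  obtain ⟨N, t, S, z, hd, hc, hz⟩ := exists_isClass
    ![clsAt k v₁ x₁, clsAt k v₂ x₂, clsAt k v₃ x₃, clsAt k v₄ x₄] (by
    intro i; fin_cases i <;> exact ⟨_, _, _, rfl⟩)
  have ha := hz 0
  have hb := hz 1
  have hc' := hz 2
  have hd' := hz 3
  simp only [Matrix.cons_val] at ha hb hc' hd'
  generalize clsAt k v₁ x₁ = a at *
  generalize clsAt k v₂ x₂ = b at *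
  generalize clsAt k v₃ x₃ = c at *
  generalize clsAt k v₄ x₄ = d at *
  have disj : ∀ i j : Fin 4, decide (i ≠ j) = true → Disjoint (S i) (S j) :=
    fun i j h => hd i j (of_decide_eq_true h)
  have left : ∀ {i j l : Fin 4} {p q r : (jordSeq k).Eval V}, IsClass t (S i) (z i) p →
      IsClass t (S j) (z j) q → IsClass t (S l) (z l) r →
      (∀ x : Fin 4, x = i ∨ x = j ∨ x = l ∨ x = 3) →
      decide (i ≠ j) = true → decide (i ≠ l) = true → decide (j ≠ l) = true →
      decide (i ≠ 3) = true → decide (j ≠ 3) = true → decide (l ≠ 3) = true →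
      ∃ h h', p * (q * r * d) = clsAt k t ⟨z i * (z j * z l * z 3), h⟩ ∧
        q * r * (p * d) = clsAt k t ⟨z j * z l * (z i * z 3), h'⟩ := by
    intro i j l p q r hp hq hr hcov h1 h2 h3 h4 h5 h6
    have hu1 : S i ∪ ((S j ∪ S l) ∪ S 3) = Set.univ := Set.eq_univ_of_forall fun x => by
      obtain ⟨m, hm⟩ := hc x
      rcases hcov m with rfl | rfl | rfl | rfl <;> simp [hm]
    have hu2 : (S j ∪ S l) ∪ (S i ∪ S 3) = Set.univ := Set.eq_univ_of_forall fun x => by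
      obtain ⟨m, hm⟩ := hc x
      rcases hcov m with rfl | rfl | rfl | rfl <;> simp [hm]
    have d1 := disj _ _ h1
    have d2 := disj _ _ h2
    have d3 := disj _ _ h3
    have d4 := disj _ _ h4
    have d5 := disj _ _ h5
    have d6 := disj _ _ h6
    obtain ⟨e, e'⟩ := (hu1 ▸ hp.mul ((hq.mul hr d3).mul hd' (by simp [d5, d6]))
      (by simp [d1, d2, d4])).exists_equiv
    obtain ⟨f, f'⟩ := (hu2 ▸ (hq.mul hr d3).mul (hp.mul hd' d4)
      (by simp [d1.symm, d2.symm, d5, d6])).exists_equiv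
    exact ⟨e, f, e', f'⟩
  obtain ⟨h1, h1', e1, e1'⟩ := left ha hb hc' (by decide) (by decide) (by decide) (by decide)
    (by decide) (by decide) (by decide)
  obtain ⟨h2, h2', e2, e2'⟩ := left hb hc' ha (by decide) (by decide) (by decide) (by decide)
    (by decide) (by decide) (by decide)
  obtain ⟨h3, h3', e3, e3'⟩ := left hc' ha hb (by decide) (by decide) (by decide) (by decide)
    (by decide) (by decide) (by decide)
  rw [e1, e1', e2, e2', e3, e3', ← map_sub, ← map_sub, ← map_sub, ← map_add, ← map_add]
  refine (congrArg _ (Subtype.ext ?_)).trans (map_zero (clsAt k t))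
  exact jordan_linearized k (z 0) (z 1) (z 2) (z 3)

instance [CharZero k] : IsCommJordan ((jordSeq k).Eval V) where
  lmul_comm_rmul_rmul a b := by
    have h := eval_jordan_linearized a a a b
    have h3 : (3 : k) • (a * (b * (a * a)) - a * b * (a * a)) = 0 := by
      rw [← h, mul_comm (a * a) b, mul_comm (a * a) (a * b),
        show (3 : k) = 1 + 1 + 1 by norm_num, add_smul, add_smul, one_smul]
    exact (sub_eq_zero.1 ((smul_eq_zero.1 h3).resolve_left three_ne_zero)).symm

end JordanOperad

/-! ### The evaluation isomorphisms -/

namespace JordanOperad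

open JordanLie

variable {k : Type u} [Field k] {V W : Type u} [AddCommGroup V] [Module k V] [AddCommGroup W]
  [Module k W]

theorem jordEval_clsAt {n : ℕ} (v : Fin n → V) (a : jordSub k n) :
    jordEval k V (clsAt k v a) = subst k v a.1 :=
  jordEval_cls a v

theorem eval_ext_clsAt {Y : Type*} [AddCommGroup Y] [Module k Y]
    {f g : (jordSeq k).Eval V →ₗ[k] Y}
    (h : ∀ n (v : Fin n → V) (a : jordSub k n), f (clsAt k v a) = g (clsAt k v a)) : f = g :=
  SymSeq.eval_ext_tprod fun n a v => h n v a

theorem jordEval_mul (α β : (jordSeq k).Eval V) :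
    jordEval k V (α * β) = jordEval k V α * jordEval k V β := by
  have : (evalMul k V).compr₂ (jordEval k V) =
      (LinearMap.mul k (FreeJordan k V)).compl₁₂ (jordEval k V) (jordEval k V) := by
    refine eval_ext_clsAt fun n v a => eval_ext_clsAt fun m w b => ?_
    change jordEval k V (clsAt k v a * clsAt k w b) =
      jordEval k V (clsAt k v a) * jordEval k V (clsAt k w b)
    rw [clsAt_mul, jordEval_clsAt, jordEval_clsAt, jordEval_clsAt, map_mul, subst_rename,
      subst_rename, append_comp_castAdd, append_comp_natAdd]
  exact LinearMap.congr_fun₂ this α β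

variable (k V) in
/-- The evaluation as a homomorphism of algebras. -/
def jordEvalHom : (jordSeq k).Eval V →ₙₐ[k] FreeJordan k V where
  toFun := jordEval k V
  map_smul' c α := map_smul (jordEval k V) c α
  map_zero' := map_zero (jordEval k V)
  map_add' := map_add (jordEval k V)
  map_mul' := jordEval_mul

theorem isMultilinear_of_zero : IsMultilinear (FreeMagma.of (0 : Fin 1)) := fun i => by
  simp [occ, Subsingleton.elim i 0]

variable (k V) in
/-- The inclusion of the generators in the analytic functor of `{Jord(n)}`. -/
def evalGen : V →ₗ[k] (jordSeq k).Eval V :=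
  (jordSeq k).cls V 1 ∘ₗ
    TensorProduct.mk k ((jordSeq k).obj 1) (⨂[k]^1 V)
      (⟨word k (FreeMagma.of 0), word_mem isMultilinear_of_zero⟩ : jordSub k 1) ∘ₗ
    (PiTensorProduct.subsingletonEquiv (R := k) (s := fun _ : Fin 1 => V) 0).symm.toLinearMap

theorem evalGen_apply (v : V) : evalGen k V v = clsAt k (fun _ : Fin 1 => v)
    ⟨word k (FreeMagma.of 0), word_mem isMultilinear_of_zero⟩ := by
  have h := PiTensorProduct.subsingletonEquiv_symm_apply' (R := k) (0 : Fin 1) v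
  rw [clsAt_apply, ← h]
  rfl

theorem jordEval_evalGen (v : V) : jordEval k V (evalGen k V v) = FreeJordan.ι k V v := by
  rw [evalGen_apply, jordEval_clsAt, subst_word_of]

section CharZero

variable [CharZero k]

variable (k V) in
/-- The inverse of the evaluation. -/
def jordInv : FreeJordan k V →ₙₐ[k] (jordSeq k).Eval V := FreeJordan.lift (evalGen k V)

theorem jordEval_jordInv (z : FreeJordan k V) : jordEval k V (jordInv k V z) = z := by
  have : (jordEvalHom k V).comp (jordInv k V) = NonUnitalAlgHom.id k _ :=
    FreeJordan.hom_ext fun v =>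
      (congrArg (jordEval k V) (FreeJordan.lift_ι (evalGen k V) v)).trans (jordEval_evalGen v)
  exact DFunLike.congr_fun this z

theorem isClass_word {n : ℕ} (v : Fin n → V) (u : FreeMagma (Fin n)) (h : ∀ i, occ i u ≤ 1) :
    IsClass v {i | occ i u = 1} (word k u) (jordInv k V (subst k v (word k u))) := by
  induction u using FreeMagma.recOnMul with
  | ih1 j =>
    refine ⟨1, fun _ => j, ⟨word k (FreeMagma.of 0), word_mem isMultilinear_of_zero⟩,
      Function.injective_of_subsingleton _, ?_, rename_word k _ _, ?_⟩
    · ext i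
      simp [occ]
    · rw [subst_word_of, jordInv, FreeJordan.lift_ι, evalGen_apply]
      rfl
  | ih2 u w hu hw =>
    simp only [occ_mul] at h
    have e : {i | occ i (u * w) = 1} = {i | occ i u = 1} ∪ {i | occ i w = 1} := by
      ext i
      have := h i
      simp only [occ_mul, Set.mem_ofPred_eq, Set.mem_union]
      omega
    rw [e, map_mul, map_mul, map_mul]
    refine (hu fun i => by have := h i; omega).mul (hw fun i => by have := h i; omega) ?_
    rw [Set.disjoint_left]
    intro i hi hi'
    have := h i
    simp only [Set.mem_ofPred_eq] at hi hi'
    omega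

theorem jordInv_subst_word {n : ℕ} (v : Fin n → V) {u : FreeMagma (Fin n)} (hu : IsMultilinear u) :
    jordInv k V (subst k v (word k u)) = clsAt k v ⟨word k u, word_mem hu⟩ := by
  have h := isClass_word (k := k) v u fun i => (hu i).le
  rw [show {i | occ i u = 1} = Set.univ from Set.eq_univ_of_forall hu] at h
  exact h.exists_equiv.2

theorem jordInv_jordEval (α : (jordSeq k).Eval V) : jordInv k V (jordEval k V α) = α := by
  have : (jordInv k V : FreeJordan k V →ₗ[k] (jordSeq k).Eval V) ∘ₗ jordEval k V =
      LinearMap.id := eval_ext_clsAt fun n v a => by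
    change jordInv k V (jordEval k V (clsAt k v a)) = clsAt k v a
    rw [jordEval_clsAt]
    obtain ⟨a, ha⟩ := a
    suffices ∃ ha : a ∈ jordSub k n, jordInv k V (subst k v a) = clsAt k v ⟨a, ha⟩ from this.2
    induction ha using Submodule.span_induction with
    | mem z h =>
      obtain ⟨u, hu, rfl⟩ := h
      exact ⟨word_mem hu, jordInv_subst_word v hu⟩
    | zero =>
      exact ⟨zero_mem _, by rw [map_zero, map_zero]; exact (map_zero (clsAt k v)).symm⟩
    | add a b _ _ ha hb =>
      obtain ⟨ha, ha'⟩ := ha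
      obtain ⟨hb, hb'⟩ := hb
      exact ⟨add_mem ha hb, by
        rw [map_add, map_add, ha', hb']; exact (map_add (clsAt k v) ⟨a, ha⟩ ⟨b, hb⟩).symm⟩
    | smul c a _ ha =>
      obtain ⟨ha, ha'⟩ := ha
      refine ⟨Submodule.smul_mem (jordSub k n) c ha, ?_⟩
      rw [map_smul, map_smul, ha']
      exact ((clsAt k v).map_smul c ⟨a, ha⟩).symm
  exact LinearMap.congr_fun this α

variable (k V) in
/-- The evaluation isomorphism of the analytic functor of `{Jord(n)}` with free Jordan algebras. -/
def jordEquiv : (jordSeq k).Eval V ≃ₗ[k] FreeJordan k V :=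
  { jordEval k V with
    invFun := jordInv k V
    left_inv := jordInv_jordEval
    right_inv := jordEval_jordInv }

/-! ### The inverse of the evaluation of `TAG(V)` -/

variable (k) in
/-- The linear map `(a, x) ↦ x ⊗ a` on multilinear elements. -/
def inlSub (n : ℕ) : (jordSeq k).obj n →ₗ[k] Sl2 k →ₗ[k] (tag k).obj n :=
  LinearMap.mk₂ k (fun a x => (⟨TAG.inl x a.1, inl_mem x a.2⟩ : tagSub k n))
    (fun a b x => Subtype.ext (map_add (inlHom k x) a.1 b.1))
    (fun c a x => Subtype.ext (map_smul (inlHom k x) c a.1))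
    (fun a x y => Subtype.ext (LinearMap.map_add₂ (inlHom k) x y a.1))
    (fun c a x => Subtype.ext (LinearMap.map_smul₂ (inlHom k) c x a.1))

variable (k V) in
/-- The linear map `(a, x) ↦ x ⊗ a` on analytic functors. -/
def evalInl : (jordSeq k).Eval V →ₗ[k] Sl2 k →ₗ[k] (tag k).Eval V :=
  SymSeq.evalLift (fun n => ((LinearMap.rTensorHom (⨂[k]^n V) ∘ₗ (inlSub k n).flip).compr₂
    ((tag k).cls V n)).flip) (by
    intro n σ a v
    ext x
    refine Eq.trans ?_ ((tag k).cls_map σ (inlSub k n a x) v)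
    have e : inlSub k n ((jordSeq k).map σ a) x = (tag k).map σ (inlSub k n a x) :=
      Subtype.ext (TAG_map_inl (rename k σ) x a.1).symm
    rw [← e]
    rfl)

variable (k) in
/-- The class of an element of `TAG(n)` with a given substitution, as a linear map. -/
def tagClsAt {n : ℕ} (v : Fin n → V) : tagSub k n →ₗ[k] (tag k).Eval V :=
  (tag k).cls V n ∘ₗ
    (TensorProduct.mk k ((tag k).obj n) (⨂[k]^n V)).flip (PiTensorProduct.tprod k v)

theorem tagClsAt_comp_equiv {n m : ℕ} (σ : Fin n ≃ Fin m) (v : Fin m → V) (p : tagSub k n) :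
    tagClsAt k (v ∘ σ) p = tagClsAt k v ⟨TAG.map (rename k σ) p.1, rename_mem_tagSub σ p.2⟩ :=
  ((tag k).toSymSeq.cls_map_tprod σ p v).symm

theorem tagEval_tagClsAt {n : ℕ} (v : Fin n → V) (p : tagSub k n) :
    tagEval k V (tagClsAt k v p) = TAG.map (subst k v) p.1 :=
  tagEval_cls p v

theorem tag_eval_ext {Y : Type*} [AddCommGroup Y] [Module k Y]
    {f g : (tag k).Eval V →ₗ[k] Y}
    (h : ∀ n (v : Fin n → V) (p : tagSub k n), f (tagClsAt k v p) = g (tagClsAt k v p)) : f = g :=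
  SymSeq.eval_ext_tprod (K := (tag k).toSymSeq) fun n p v => h n v p

theorem evalInl_clsAt {n : ℕ} (v : Fin n → V) (a : jordSub k n) (x : Sl2 k) :
    evalInl k V (clsAt k v a) x = tagClsAt k v ⟨TAG.inl x a.1, inl_mem x a.2⟩ :=
  LinearMap.congr_fun (SymSeq.evalLift_cls _ _ n _) x

variable (k) in
/-- The wedge of multilinear elements in disjoint sets of variables. -/
def jordWedge (n m : ℕ) : (jordSeq k).obj n →ₗ[k] (jordSeq k).obj m →ₗ[k] (tag k).obj (n + m) :=
  LinearMap.mk₂ k (fun a b =>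
      (⟨TAG.inr (rename k (Fin.castAdd m) a.1) (rename k (Fin.natAdd n) b.1),
        inr_mem_tagSub a.2 b.2⟩ : tagSub k (n + m)))
    (fun a a' b => Subtype.ext <| by
      change inrHom k (rename k _ (a.1 + a'.1)) _ = inrHom k _ _ + inrHom k _ _
      rw [map_add, LinearMap.map_add₂])
    (fun c a b => Subtype.ext <| by
      change inrHom k (rename k _ (c • a.1)) _ = c • inrHom k _ _
      rw [map_smul, LinearMap.map_smul₂])
    (fun a b b' => Subtype.ext <| by
      change inrHom k _ (rename k _ (b.1 + b'.1)) = inrHom k _ _ + inrHom k _ _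
      rw [map_add, map_add])
    (fun c a b => Subtype.ext <| by
      change inrHom k _ (rename k _ (c • b.1)) = c • inrHom k _ _
      rw [map_smul, map_smul])

variable (k V) in
/-- The bilinear map `(a, b) ↦ a ∧ b` on analytic functors. -/
def evalWedge : (jordSeq k).Eval V →ₗ[k] (jordSeq k).Eval V →ₗ[k] (tag k).Eval V :=
  SymSeq.evalPairing (M := (tag k).toSymSeq) V (jordWedge k) (by
    intro n n' m m' σ τ a b
    refine Subtype.ext ?_
    change TAG.inr (rename k (Fin.castAdd m') (rename k σ a.1))
        (rename k (Fin.natAdd n') (rename k τ b.1)) =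
      TAG.map (rename k (finSumCongr σ τ))
        (TAG.inr (rename k (Fin.castAdd m) a.1) (rename k (Fin.natAdd n) b.1))
    rw [TAG_map_inr, rename_rename, rename_rename, rename_rename, rename_rename,
      finSumCongr_comp_castAdd, finSumCongr_comp_natAdd])

theorem evalWedge_clsAt {n m : ℕ} (v : Fin n → V) (a : jordSub k n) (w : Fin m → V)
    (b : jordSub k m) :
    evalWedge k V (clsAt k v a) (clsAt k w b) = tagClsAt k (Fin.append v w)
      ⟨TAG.inr (rename k (Fin.castAdd m) a.1) (rename k (Fin.natAdd n) b.1),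
        inr_mem_tagSub a.2 b.2⟩ :=
  SymSeq.evalPairing_cls (M := (tag k).toSymSeq) (jordWedge k) _ a v b w

theorem IsClass.wedge {N : ℕ} {v : Fin N → V} {S T : Set (Fin N)} {z w : FreeOn k N}
    {α β : (jordSeq k).Eval V} (h : IsClass v S z α) (h' : IsClass v T w β) (hd : Disjoint S T)
    (hu : ∀ x, x ∈ S ∨ x ∈ T) :
    ∃ hz : TAG.inr z w ∈ tagSub k N, evalWedge k V α β = tagClsAt k v ⟨TAG.inr z w, hz⟩ := by
  obtain ⟨n, f, a, hf, rfl, rfl, rfl⟩ := h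
  obtain ⟨m, g, b, hg, rfl, rfl, rfl⟩ := h'
  let σ : Fin (n + m) ≃ Fin N := Equiv.ofBijective (Fin.append f g) ⟨append_injective hf hg hd,
    Set.range_eq_univ.1 (range_append f g ▸ Set.eq_univ_of_forall hu)⟩
  have e : TAG.map (rename k σ)
      (TAG.inr (rename k (Fin.castAdd m) a.1) (rename k (Fin.natAdd n) b.1)) =
      TAG.inr (rename k f a.1) (rename k g b.1) := by
    change TAG.map (rename k (Fin.append f g)) _ = _
    rw [TAG_map_inr, rename_rename, rename_rename, append_comp_castAdd, append_comp_natAdd]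
  refine ⟨e ▸ rename_mem_tagSub σ (inr_mem_tagSub a.2 b.2), ?_⟩
  rw [evalWedge_clsAt, append_comp]
  refine (tagClsAt_comp_equiv σ v _).trans ?_
  exact congrArg (tagClsAt k v) (Subtype.ext e)

theorem evalWedge_skew (a b : (jordSeq k).Eval V) :
    evalWedge k V a b = - evalWedge k V b a := by
  induction a using eval_span_induction with
  | h0 => simp
  | hadd a a' ha ha' => simp only [map_add, LinearMap.add_apply, ha, ha']; abel
  | h n v x =>
  induction b using eval_span_induction with
  | h0 => simp
  | hadd a a' ha ha' => simp only [map_add, LinearMap.add_apply, ha, ha']; abel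
  | h m w y =>
  obtain ⟨N, t, S, z, hd, hc, hz⟩ := exists_isClass ![clsAt k v x, clsAt k w y] (by
    intro i; fin_cases i <;> exact ⟨_, _, _, rfl⟩)
  have hu : ∀ x, x ∈ S 0 ∨ x ∈ S 1 := fun x => by
    obtain ⟨i, hi⟩ := hc x
    fin_cases i <;> simp_all
  obtain ⟨h1, h1'⟩ := (hz 0).wedge (hz 1) (hd 0 1 (by decide)) hu
  obtain ⟨h2, h2'⟩ := (hz 1).wedge (hz 0) (hd 1 0 (by decide)) fun x => (hu x).symm
  refine h1'.trans (Eq.trans ?_ (congrArg _ h2').symm)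
  rw [← map_neg]
  refine congrArg (tagClsAt k t) (Subtype.ext (Prod.ext ?_ ?_))
  · exact neg_zero.symm
  · exact wedge_skew (z 0) (z 1)

theorem evalWedge_cyclic (a b c : (jordSeq k).Eval V) :
    evalWedge k V (a * b) c + evalWedge k V (b * c) a + evalWedge k V (c * a) b = 0 := by
  have key (P P' : (tag k).Eval V) (Q : (tag k).Eval V) (h : P = 0) (h' : P' = 0)
    (hQ : Q = P + P') : Q = 0 := by rw [hQ, h, h', add_zero]
  induction a using eval_span_induction with
  | h0 => simp
  | hadd a a' ha ha' =>
    refine key _ _ _ ha ha' ?_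
    simp only [add_mul, mul_add, map_add, LinearMap.add_apply]; abel
  | h n₁ v₁ x₁ =>
  induction b using eval_span_induction with
  | h0 => simp
  | hadd a a' ha ha' =>
    refine key _ _ _ ha ha' ?_
    simp only [add_mul, mul_add, map_add, LinearMap.add_apply]; abel
  | h n₂ v₂ x₂ =>
  induction c using eval_span_induction with
  | h0 => simp
  | hadd a a' ha ha' =>
    refine key _ _ _ ha ha' ?_
    simp only [add_mul, mul_add, map_add, LinearMap.add_apply]; abel
  | h n₃ v₃ x₃ =>
  obtain ⟨N, t, S, z, hd, hc, hz⟩ := exists_isClass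
    ![clsAt k v₁ x₁, clsAt k v₂ x₂, clsAt k v₃ x₃] (by
    intro i; fin_cases i <;> exact ⟨_, _, _, rfl⟩)
  have wed : ∀ i j l : Fin 3, (∀ x : Fin 3, x = i ∨ x = j ∨ x = l) → i ≠ j → i ≠ l → j ≠ l →
      ∀ {p q r : (jordSeq k).Eval V}, IsClass t (S i) (z i) p → IsClass t (S j) (z j) q →
      IsClass t (S l) (z l) r → ∃ h, evalWedge k V (p * q) r =
        tagClsAt k t ⟨TAG.inr (z i * z j) (z l), h⟩ := by
    intro i j l hcov h1 h2 h3 p q r hp hq hr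
    refine (hp.mul hq (hd _ _ h1)).wedge hr (by simp [hd _ _ h2, hd _ _ h3]) fun x => ?_
    obtain ⟨m, hm⟩ := hc x
    rcases hcov m with rfl | rfl | rfl <;> simp [hm]
  obtain ⟨h1, e1⟩ := wed 0 1 2 (by decide) (by decide) (by decide) (by decide) (hz 0) (hz 1) (hz 2)
  obtain ⟨h2, e2⟩ := wed 1 2 0 (by decide) (by decide) (by decide) (by decide) (hz 1) (hz 2) (hz 0)
  obtain ⟨h3, e3⟩ := wed 2 0 1 (by decide) (by decide) (by decide) (by decide) (hz 2) (hz 0) (hz 1)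
  simp only [Matrix.cons_val] at e1 e2 e3
  rw [e1, e2, e3, ← map_add, ← map_add]
  refine (congrArg _ (Subtype.ext (Prod.ext ?_ ?_))).trans (map_zero (tagClsAt k t))
  · change (0 + 0 + 0 : Sl2 k ⊗[k] FreeOn k N) = 0
    simp
  · exact wedge_cyclic (z 0) (z 1) (z 2)

variable (k V) in
/-- The inverse of the evaluation `TAG(V) → TAG(Jord(V))`. -/
def tagInv : TAG k (FreeJordan k V) →ₗ[k] (tag k).Eval V :=
  LinearMap.coprod
    (TensorProduct.lift ((evalInl k V ∘ₗ
      (jordInv k V : FreeJordan k V →ₗ[k] (jordSeq k).Eval V)).flip))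
    (liftB ((evalWedge k V).compl₁₂ (jordInv k V : FreeJordan k V →ₗ[k] (jordSeq k).Eval V)
        (jordInv k V : FreeJordan k V →ₗ[k] (jordSeq k).Eval V))
      (fun a => TAG.eq_zero_of_eq_neg k (evalWedge_skew _ _))
      (fun a b c => by
        change evalWedge k V (jordInv k V (a * b)) (jordInv k V c) +
          evalWedge k V (jordInv k V (b * c)) (jordInv k V a) +
          evalWedge k V (jordInv k V (c * a)) (jordInv k V b) = 0
        simp only [map_mul (jordInv k V), evalWedge_cyclic]))

theorem tagInv_inl (x : Sl2 k) (a : FreeJordan k V) :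
    tagInv k V (TAG.inl x a) = evalInl k V (jordInv k V a) x := by
  refine (LinearMap.coprod_apply _ _ _).trans ?_
  refine (congrArg₂ (· + ·) (TensorProduct.lift.tmul x a) (map_zero _)).trans (add_zero _)

theorem tagInv_inr (a b : FreeJordan k V) :
    tagInv k V (TAG.inr a b) = evalWedge k V (jordInv k V a) (jordInv k V b) := by
  refine (LinearMap.coprod_apply _ _ _).trans ?_
  refine (congrArg₂ (· + ·) (map_zero _) (liftB_wedge _ _ _ a b)).trans (zero_add _)

theorem tagEval_evalInl (α : (jordSeq k).Eval V) (x : Sl2 k) :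
    tagEval k V (evalInl k V α x) = TAG.inl x (jordEval k V α) := by
  have : tagEval k V ∘ₗ (evalInl k V).flip x = inlHom k x ∘ₗ jordEval k V :=
    eval_ext_clsAt fun n v a => by
      change tagEval k V (evalInl k V (clsAt k v a) x) = TAG.inl x (jordEval k V (clsAt k v a))
      rw [evalInl_clsAt, tagEval_tagClsAt, jordEval_clsAt, TAG_map_inl]
  exact LinearMap.congr_fun this α

theorem tagEval_evalWedge (α β : (jordSeq k).Eval V) :
    tagEval k V (evalWedge k V α β) = TAG.inr (jordEval k V α) (jordEval k V β) := by
  have : (evalWedge k V).compr₂ (tagEval k V) =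
      (inrHom k).compl₁₂ (jordEval k V) (jordEval k V) := by
    refine eval_ext_clsAt fun n v a => eval_ext_clsAt fun m w b => ?_
    change tagEval k V (evalWedge k V (clsAt k v a) (clsAt k w b)) =
      TAG.inr (jordEval k V (clsAt k v a)) (jordEval k V (clsAt k w b))
    rw [evalWedge_clsAt, tagEval_tagClsAt, jordEval_clsAt, jordEval_clsAt, TAG_map_inr,
      subst_rename, subst_rename, append_comp_castAdd, append_comp_natAdd]
  exact LinearMap.congr_fun₂ this α β

theorem TAG_linearMap_ext {J : Type u} {Y : Type*} [NonUnitalNonAssocCommRing J] [Module k J]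
    [IsScalarTower k J J] [SMulCommClass k J J] [AddCommGroup Y] [Module k Y]
    {f g : TAG k J →ₗ[k] Y} (hl : ∀ x a, f (TAG.inl x a) = g (TAG.inl x a))
    (hr : ∀ a b, f (TAG.inr a b) = g (TAG.inr a b)) : f = g :=
  LinearMap.prod_ext (TensorProduct.ext' hl) (B_ext hr)

theorem tagEval_tagInv (p : TAG k (FreeJordan k V)) : tagEval k V (tagInv k V p) = p := by
  have : tagEval k V ∘ₗ tagInv k V = LinearMap.id := TAG_linearMap_ext
    (fun x a => by
      rw [LinearMap.comp_apply, tagInv_inl, tagEval_evalInl, jordEval_jordInv]; rfl)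
    (fun a b => by
      rw [LinearMap.comp_apply, tagInv_inr, tagEval_evalWedge, jordEval_jordInv,
        jordEval_jordInv]; rfl)
  exact LinearMap.congr_fun this p

theorem tagInv_map_subst {n : ℕ} (v : Fin n → V) {p : TAG k (FreeOn k n)} (hp : p ∈ tagSub k n) :
    ∃ hp : p ∈ tagSub k n, tagInv k V (TAG.map (subst k v) p) = tagClsAt k v ⟨p, hp⟩ := by
  refine tagSub_induction (P := fun p => ∃ hp : p ∈ tagSub k n,
      tagInv k V (TAG.map (subst k v) p) = tagClsAt k v ⟨p, hp⟩) hp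
    (fun x u hu => ?_) (fun u w hu => ?_) ?_ (fun p q hp hq => ?_) (fun c p hp => ?_)
  · refine ⟨inl_mem x (word_mem hu), ?_⟩
    rw [TAG_map_inl, tagInv_inl, jordInv_subst_word v hu, evalInl_clsAt]
  · rw [TAG_map_inr, tagInv_inr]
    have h : ∀ i, occ i u + occ i w = 1 := hu
    refine (isClass_word v u fun i => by have := h i; omega).wedge
      (isClass_word v w fun i => by have := h i; omega) ?_ fun i => ?_
    · rw [Set.disjoint_left]
      intro i hi hi'
      have := h i
      simp only [Set.mem_ofPred_eq] at hi hi'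
      omega
    · have := h i
      simp only [Set.mem_ofPred_eq]
      omega
  · exact ⟨zero_mem _, by rw [map_zero, map_zero]; exact (map_zero (tagClsAt k v)).symm⟩
  · obtain ⟨hp, hp'⟩ := hp
    obtain ⟨hq, hq'⟩ := hq
    exact ⟨add_mem hp hq, by
      rw [map_add, map_add, hp', hq']; exact (map_add (tagClsAt k v) ⟨p, hp⟩ ⟨q, hq⟩).symm⟩
  · obtain ⟨hp, hp'⟩ := hp
    refine ⟨Submodule.smul_mem (tagSub k n) c hp, ?_⟩
    rw [map_smul, map_smul, hp']
    exact ((tagClsAt k v).map_smul c ⟨p, hp⟩).symm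

theorem tagInv_tagEval (α : (tag k).Eval V) : tagInv k V (tagEval k V α) = α := by
  have : tagInv k V ∘ₗ tagEval k V = LinearMap.id := tag_eval_ext fun n v p => by
    rw [LinearMap.comp_apply, tagEval_tagClsAt]
    exact (tagInv_map_subst v p.2).2
  exact LinearMap.congr_fun this α

variable (k V) in
/-- The evaluation `TAG(V) → TAG(Jord(V))` as a homomorphism of Lie algebras. -/
def tagEvalHom : (tag k).Eval V →ₗ⁅k⁆ TAG k (FreeJordan k V) where
  toLinearMap := tagEval k V
  map_lie' {a b} := tagEval_lie a b

variable (k V) in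
/-- The inverse of the evaluation as a homomorphism of Lie algebras. -/
def tagInvHom : TAG k (FreeJordan k V) →ₗ⁅k⁆ (tag k).Eval V where
  toLinearMap := tagInv k V
  map_lie' {a b} := by
    change tagInv k V ⁅a, b⁆ = ⁅tagInv k V a, tagInv k V b⁆
    rw [← tagInv_tagEval ⁅tagInv k V a, tagInv k V b⁆, tagEval_lie, tagEval_tagInv,
      tagEval_tagInv]

theorem jordEval_evalMap (f : V →ₗ[k] W) (α : (jordSeq k).Eval V) :
    jordEval k W ((jordSeq k).evalMap f α) = FreeJordan.map f (jordEval k V α) := by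
  have : jordEval k W ∘ₗ (jordSeq k).evalMap f =
      (FreeJordan.map f : FreeJordan k V →ₗ[k] FreeJordan k W) ∘ₗ jordEval k V :=
    SymSeq.eval_ext_tprod fun n a v => by
      rw [LinearMap.comp_apply, SymSeq.evalMap_cls, PiTensorProduct.map_tprod]
      refine (jordEval_cls a _).trans ?_
      refine Eq.trans ?_ (congrArg (FreeJordan.map f) (jordEval_cls a v)).symm
      rw [map_subst]; rfl
  exact LinearMap.congr_fun this α

theorem tagEval_evalMap (f : V →ₗ[k] W) (α : (tag k).Eval V) :
    tagEval k W ((tag k).evalMap f α) = TAG.map (FreeJordan.map f) (tagEval k V α) := by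
  have : tagEval k W ∘ₗ (tag k).evalMap f =
      (TAG.map (FreeJordan.map f) : TAG k (FreeJordan k V) →ₗ[k] TAG k (FreeJordan k W)) ∘ₗ
        tagEval k V :=
    SymSeq.eval_ext_tprod (K := (tag k).toSymSeq) fun n p v => by
      rw [LinearMap.comp_apply, SymSeq.evalMap_cls, PiTensorProduct.map_tprod]
      refine (tagEval_cls p _).trans ?_
      refine Eq.trans ?_ (congrArg (TAG.map (FreeJordan.map f)) (tagEval_cls p v)).symm
      rw [← TAG.map_comp, map_comp_subst]; rfl
  exact LinearMap.congr_fun this α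

end CharZero

end JordanOperad

/-! ### The right module structure and the relative composition product -/

namespace JordanOperad

open JordanLie

variable (k : Type u) [Field k] [CharZero k]

/-- The functor `V ↦ Jord(V)` is the analytic functor of `{Jord(n)}`. -/
def jordIso : (jordSeq k).functor ≅ (jordMonad k).toFunctor :=
  NatIso.ofComponents (fun V => (jordEquiv k V).toModuleIso)
    (fun f => ModuleCat.hom_ext (LinearMap.ext fun α => jordEval_evalMap f.hom α))

/-- The evaluation isomorphism of the analytic functor of `TAG` with `TAG(Jord(V))`. -/
def tagIso : (tag k).lieFunctor ≅ JordAlg.free k ⋙ TAG.functor k :=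
  NatIso.ofComponents
    (fun V =>
      { hom := ⟨tagEvalHom k V⟩
        inv := ⟨tagInvHom k V⟩
        hom_inv_id := LieAlgs.Hom.ext (LieHom.ext fun α => tagInv_tagEval α)
        inv_hom_id := LieAlgs.Hom.ext (LieHom.ext fun p => tagEval_tagInv p) })
    (fun f => LieAlgs.Hom.ext (LieHom.ext fun α => tagEval_evalMap f.hom α))

/-- The map of `TAG(Jord(Jord(V)))` to `TAG(Jord(V))` induced by the composition of the operad. -/
def counitMap : (jordMonad k).toFunctor ⋙ JordAlg.free k ⋙ TAG.functor k ⟶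
    JordAlg.free k ⋙ TAG.functor k where
  app V := (TAG.functor k).map ((JordAlg.adj k).counit.app ((JordAlg.free k).obj V))
  naturality V W f := by
    have h := (JordAlg.adj k).counit.naturality ((JordAlg.free k).map f)
    have h' := congrArg (TAG.functor k).map h
    rw [Functor.map_comp, Functor.map_comp] at h'
    exact h'

/-- The right module structure of the analytic functor of `TAG` over the Jordan operad. -/
def tagModule : RightModule (jordMonad k) (tag k).lieFunctor where
  act := Functor.whiskerLeft (jordMonad k).toFunctor (tagIso k).hom ≫ counitMap k ≫ (tagIso k).inv
  unit V := by
    have h := (tagIso k).hom.naturality ((jordMonad k).η.app V)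
    have h' := congrArg (TAG.functor k).map ((JordAlg.adj k).left_triangle_components V)
    rw [Functor.map_comp, CategoryTheory.Functor.map_id] at h'
    change (tag k).lieFunctor.map ((jordMonad k).η.app V) ≫
      (tagIso k).hom.app ((jordMonad k).obj V) ≫ (counitMap k).app V ≫ (tagIso k).inv.app V = _
    rw [← Category.assoc, h, Category.assoc]
    refine (congrArg (fun t => (tagIso k).hom.app V ≫ t)
      ((Category.assoc _ _ _).symm.trans (congrArg (· ≫ (tagIso k).inv.app V) h'))).trans ?_
    refine (congrArg (fun t => (tagIso k).hom.app V ≫ t) (Category.id_comp _)).trans ?_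
    exact (tagIso k).hom_inv_id_app V
  assoc V := by
    have h := (tagIso k).hom.naturality ((jordMonad k).μ.app V)
    have h' := congrArg (TAG.functor k).map
      ((JordAlg.adj k).counit.naturality ((JordAlg.adj k).counit.app ((JordAlg.free k).obj V)))
    rw [Functor.map_comp, Functor.map_comp] at h'
    change (tag k).lieFunctor.map ((jordMonad k).μ.app V) ≫
      (tagIso k).hom.app ((jordMonad k).obj V) ≫ (counitMap k).app V ≫ (tagIso k).inv.app V =
      ((tagIso k).hom.app ((jordMonad k).obj ((jordMonad k).obj V)) ≫
        (counitMap k).app ((jordMonad k).obj V) ≫ (tagIso k).inv.app ((jordMonad k).obj V)) ≫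
      (tagIso k).hom.app ((jordMonad k).obj V) ≫ (counitMap k).app V ≫ (tagIso k).inv.app V
    rw [← Category.assoc, h]
    simp only [Category.assoc, Iso.inv_hom_id_app_assoc]
    refine congrArg (fun t => (tagIso k).hom.app _ ≫ t) ?_
    refine (Category.assoc _ _ _).symm.trans (Eq.trans ?_ (Category.assoc _ _ _))
    exact congrArg (· ≫ (tagIso k).inv.app V) h'

theorem tagModule_act (V : ModuleCat.{u} k) : (tagModule k).act.app V ≫ (tagIso k).hom.app V =
    (tagIso k).hom.app ((jordMonad k).obj V) ≫
      (TAG.functor k).map ((JordAlg.adj k).counit.app ((JordAlg.free k).obj V)) := by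
  change ((tagIso k).hom.app ((jordMonad k).obj V) ≫ (counitMap k).app V ≫
    (tagIso k).inv.app V) ≫ (tagIso k).hom.app V = _
  rw [Category.assoc, Category.assoc, Iso.inv_hom_id_app, Category.comp_id]
  rfl

section Presentation

variable {k} {J : Type u} [NonUnitalNonAssocCommRing J] [Module k J] [IsScalarTower k J J]
  [SMulCommClass k J J] [IsCommJordan J]

variable (k J) in
/-- The homomorphism `Jord(J) → J` that is the identity on the generators. -/
def ev : FreeJordan k J →ₙₐ[k] J := FreeJordan.lift LinearMap.id

theorem ev_ι (a : J) : ev k J (FreeJordan.ι k J a) = a := FreeJordan.lift_ι _ a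

theorem map_ev_ι (a : FreeJordan k J) :
    FreeJordan.map (ev k J : FreeJordan k J →ₗ[k] J) (FreeJordan.ι k (FreeJordan k J) a) =
      FreeJordan.ι k J (ev k J a) := by
  simp [FreeJordan.map]

variable (k J) in
/-- The difference of the two maps `TAG(Jord(Jord(J))) ⇉ TAG(Jord(J))`. -/
def tagDiff : TAG k (FreeJordan k (FreeJordan k J)) →ₗ[k] TAG k (FreeJordan k J) :=
  (TAG.map (ev k (FreeJordan k J)) : _ →ₗ[k] TAG k (FreeJordan k J)) -
    (TAG.map (FreeJordan.map (ev k J : FreeJordan k J →ₗ[k] J)) : _ →ₗ[k] TAG k (FreeJordan k J))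

theorem tagDiff_apply (z : TAG k (FreeJordan k (FreeJordan k J))) :
    tagDiff k J z = TAG.map (ev k (FreeJordan k J)) z -
      TAG.map (FreeJordan.map (ev k J : FreeJordan k J →ₗ[k] J)) z := rfl

theorem tagDiff_inl (x : Sl2 k) (a : FreeJordan k J) :
    tagDiff k J (TAG.inl x (FreeJordan.ι k _ a)) =
      TAG.inl x a - TAG.inl x (FreeJordan.ι k J (ev k J a)) := by
  rw [tagDiff_apply, TAG_map_inl, TAG_map_inl, ev_ι, map_ev_ι]

theorem tagDiff_inr (a b : FreeJordan k J) :
    tagDiff k J (TAG.inr (FreeJordan.ι k _ a) (FreeJordan.ι k _ b)) =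
      TAG.inr a b - TAG.inr (FreeJordan.ι k J (ev k J a)) (FreeJordan.ι k J (ev k J b)) := by
  rw [tagDiff_apply, TAG_map_inr, TAG_map_inr, ev_ι, ev_ι, map_ev_ι, map_ev_ι]

theorem map_ev_tagDiff (z : TAG k (FreeJordan k (FreeJordan k J))) :
    TAG.map (ev k J) (tagDiff k J z) = 0 := by
  have : (ev k J).comp (ev k (FreeJordan k J)) =
      (ev k J).comp (FreeJordan.map (ev k J : FreeJordan k J →ₗ[k] J)) :=
    FreeJordan.hom_ext fun a => by
      rw [NonUnitalAlgHom.comp_apply, NonUnitalAlgHom.comp_apply, ev_ι, map_ev_ι, ev_ι]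
  rw [tagDiff_apply, map_sub, ← TAG.map_comp, ← TAG.map_comp, this, sub_self]

theorem wedge_ev_eq (a b : FreeJordan k J) :
    (LinearMap.range (tagDiff k J)).mkQ
        (TAG.inr (FreeJordan.ι k J (ev k J a)) (FreeJordan.ι k J (ev k J b))) =
      (LinearMap.range (tagDiff k J)).mkQ (TAG.inr a b) := by
  symm
  exact (Submodule.Quotient.eq _).2 ⟨_, tagDiff_inr a b⟩

variable (k J) in
/-- The inverse `TAG(J) → TAG(Jord(J)) / range` of the map induced by `Jord(J) → J`. -/
def tagSection : TAG k J →ₗ[k] TAG k (FreeJordan k J) ⧸ LinearMap.range (tagDiff k J) :=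
  LinearMap.coprod
    (TensorProduct.lift (((inlHom k).compl₂ (FreeJordan.ι k J)).compr₂
      (LinearMap.range (tagDiff k J)).mkQ))
    (liftB (((inrHom k).compl₁₂ (FreeJordan.ι k J) (FreeJordan.ι k J)).compr₂
      (LinearMap.range (tagDiff k J)).mkQ)
      (fun a => by
        refine (congrArg (LinearMap.range (tagDiff k J)).mkQ ?_).trans (map_zero _)
        exact Prod.ext rfl (wedge_self _))
      (fun a b c => by
        have h : ∀ a b c : J, (LinearMap.range (tagDiff k J)).mkQ
            (TAG.inr (FreeJordan.ι k J (a * b)) (FreeJordan.ι k J c)) =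
            (LinearMap.range (tagDiff k J)).mkQ
              (TAG.inr (FreeJordan.ι k J a * FreeJordan.ι k J b) (FreeJordan.ι k J c)) :=
          fun a b c => by
            rw [← wedge_ev_eq (FreeJordan.ι k J a * FreeJordan.ι k J b), map_mul (ev k J), ev_ι, ev_ι, ev_ι]
        change (LinearMap.range (tagDiff k J)).mkQ (TAG.inr (FreeJordan.ι k J (a * b)) _) +
          (LinearMap.range (tagDiff k J)).mkQ (TAG.inr (FreeJordan.ι k J (b * c)) _) +
          (LinearMap.range (tagDiff k J)).mkQ (TAG.inr (FreeJordan.ι k J (c * a)) _) = 0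
        rw [h, h, h, ← map_add, ← map_add]
        refine (congrArg (LinearMap.range (tagDiff k J)).mkQ (Prod.ext ?_ ?_)).trans (map_zero _)
        · change (0 + 0 + 0 : Sl2 k ⊗[k] FreeJordan k J) = 0
          simp
        · exact wedge_cyclic _ _ _))

theorem tagSection_inl (x : Sl2 k) (a : J) : tagSection k J (TAG.inl x a) =
    (LinearMap.range (tagDiff k J)).mkQ (TAG.inl x (FreeJordan.ι k J a)) := by
  refine (LinearMap.coprod_apply _ _ _).trans ?_
  exact (congrArg₂ (· + ·) (TensorProduct.lift.tmul x a) (map_zero _)).trans (add_zero _)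

theorem tagSection_inr (a b : J) : tagSection k J (TAG.inr a b) =
    (LinearMap.range (tagDiff k J)).mkQ
      (TAG.inr (FreeJordan.ι k J a) (FreeJordan.ι k J b)) := by
  refine (LinearMap.coprod_apply _ _ _).trans ?_
  exact (congrArg₂ (· + ·) (map_zero _) (liftB_wedge _ _ _ a b)).trans (zero_add _)

theorem tagSection_map_ev (p : TAG k (FreeJordan k J)) :
    tagSection k J (TAG.map (ev k J) p) = (LinearMap.range (tagDiff k J)).mkQ p := by
  have : tagSection k J ∘ₗ (TAG.map (ev k J) : TAG k (FreeJordan k J) →ₗ[k] TAG k J) =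
      (LinearMap.range (tagDiff k J)).mkQ := TAG_linearMap_ext
    (fun x a => by
      change tagSection k J (TAG.map (ev k J) _) = _
      rw [TAG_map_inl, tagSection_inl]
      symm
      exact (Submodule.Quotient.eq _).2 ⟨_, tagDiff_inl x a⟩)
    (fun a b => by
      change tagSection k J (TAG.map (ev k J) _) = _
      rw [TAG_map_inr, tagSection_inr, wedge_ev_eq])
  exact LinearMap.congr_fun this p

theorem mem_range_tagDiff {p : TAG k (FreeJordan k J)} (hp : TAG.map (ev k J) p = 0) :
    p ∈ LinearMap.range (tagDiff k J) := by
  have h := tagSection_map_ev p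
  rw [hp, map_zero] at h
  exact (Submodule.Quotient.mk_eq_zero _).1 h.symm

theorem map_ev_surjective : Function.Surjective (TAG.map (k := k) (ev k J)) := by
  have h : Function.Surjective (ev k J) := fun a => ⟨_, ev_ι a⟩
  rintro ⟨s, ω⟩
  obtain ⟨s', hs⟩ := LinearMap.lTensor_surjective (Sl2 k) (g := (ev k J : FreeJordan k J →ₗ[k] J)) h s
  suffices ∃ ω', mapB (ev k J) ω' = ω by
    obtain ⟨ω', hω⟩ := this
    exact ⟨(s', ω'), Prod.ext hs hω⟩
  induction ω using B_induction with
  | h a b => exact ⟨wedge k _ (FreeJordan.ι k J a) (FreeJordan.ι k J b), by simp [ev_ι]⟩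
  | h0 => exact ⟨0, map_zero _⟩
  | hadd a b ha hb =>
    obtain ⟨a, rfl⟩ := ha
    obtain ⟨b, rfl⟩ := hb
    exact ⟨a + b, map_add _ a b⟩

end Presentation

/-- The algebra over the Jordan monad given by a Jordan algebra. -/
abbrev toAlgebra (A : JordAlg k) : (jordMonad k).Algebra :=
  (Monad.comparison (JordAlg.adj k)).obj A

/-- The evaluation `TAG(J) → TAG(Jord(J)) → TAG(J)` of the analytic functor of `TAG` on
a Jordan algebra. -/
def algEval (A : JordAlg k) : (tag k).Eval A.carrier →ₗ⁅k⁆ TAG k A.carrier :=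
  (TAG.map (ev k A.carrier)).comp (tagEvalHom k A.carrier)

variable {k}

theorem tagEval_diff (A : JordAlg k)
    (z : ((tag k).lieFunctor.obj ((jordMonad k).obj (toAlgebra k A).A)).carrier) :
    tagEval k A.carrier ((tagModule k).diff (toAlgebra k A) z) =
      tagDiff k A.carrier (tagEval k (FreeJordan k A.carrier) z) := by
  have h1 : tagEval k A.carrier ((tagModule k).actHom (toAlgebra k A).A z) =
      TAG.map (ev k (FreeJordan k A.carrier)) (tagEval k (FreeJordan k A.carrier) z) :=
    LieHom.congr_fun (congrArg LieAlgs.Hom.hom (tagModule_act k (toAlgebra k A).A)) z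
  have h2 : tagEval k A.carrier (RightModule.mapHom (tag k).lieFunctor (toAlgebra k A).a z) =
      TAG.map (FreeJordan.map (ev k A.carrier : FreeJordan k A.carrier →ₗ[k] A.carrier))
        (tagEval k (FreeJordan k A.carrier) z) :=
    tagEval_evalMap (ev k A.carrier : FreeJordan k A.carrier →ₗ[k] A.carrier) z
  rw [RightModule.diff_apply]
  exact (map_sub (tagEval k A.carrier) _ _).trans (congrArg₂ (· - ·) h1 h2)

theorem mem_ideal_iff (A : JordAlg k) (x : (tag k).Eval A.carrier) :
    x ∈ (tagModule k).ideal (toAlgebra k A) ↔ algEval k A x = 0 := by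
  constructor
  · rintro ⟨z, rfl⟩
    exact (congrArg (TAG.map (ev k A.carrier)) (tagEval_diff A z)).trans (map_ev_tagDiff _)
  · intro h
    obtain ⟨y, hy⟩ := mem_range_tagDiff (p := tagEval k A.carrier x) h
    refine ⟨tagInv k (FreeJordan k A.carrier) y, ?_⟩
    have e := tagEval_diff A (tagInv k (FreeJordan k A.carrier) y)
    rw [tagEval_tagInv, hy] at e
    exact (tagInv_tagEval _).symm.trans ((congrArg (tagInv k A.carrier) e).trans (tagInv_tagEval x))

theorem algEval_surjective (A : JordAlg k) : Function.Surjective (algEval k A) := fun p => by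
  obtain ⟨q, rfl⟩ := map_ev_surjective p
  exact ⟨tagInv k A.carrier q, congrArg (TAG.map (ev k A.carrier)) (tagEval_tagInv q)⟩

/-- The homomorphism from the relative composition product with `J` to `TAG(J)`. -/
def relHom (A : JordAlg k) :
    ((tagModule k).relCompAlg.obj (toAlgebra k A)).carrier →ₗ⁅k⁆ TAG k A.carrier where
  toLinearMap := ((tagModule k).ideal (toAlgebra k A)).toSubmodule.liftQ
    (algEval k A : (tag k).Eval A.carrier →ₗ[k] TAG k A.carrier)
    fun x hx => (mem_ideal_iff A x).1 hx
  map_lie' {x y} := by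
    obtain ⟨x, rfl⟩ := LieSubmodule.Quotient.surjective_mk' _ x
    obtain ⟨y, rfl⟩ := LieSubmodule.Quotient.surjective_mk' _ y
    exact LieHom.map_lie (algEval k A) x y

theorem relHom_mk (A : JordAlg k) (x : (tag k).Eval A.carrier) :
    relHom A (LieSubmodule.Quotient.mk (N := (tagModule k).ideal (toAlgebra k A)) x) =
      algEval k A x := rfl

theorem relHom_bijective (A : JordAlg k) : Function.Bijective (relHom A) := by
  constructor
  · refine (injective_iff_map_eq_zero _).2 fun x hx => ?_
    obtain ⟨x, rfl⟩ := LieSubmodule.Quotient.surjective_mk' _ x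
    exact (LieSubmodule.Quotient.mk_eq_zero' ..).2 ((mem_ideal_iff A x).2 hx)
  · intro p
    obtain ⟨x, rfl⟩ := algEval_surjective A p
    exact ⟨_, relHom_mk A x⟩

/-- A bijective homomorphism of Lie algebras is an isomorphism. -/
def _root_.LieAlgs.isoOfBijective {A B : LieAlgs k} (f : A.carrier →ₗ⁅k⁆ B.carrier)
    (hf : Function.Bijective f) : A ≅ B where
  hom := ⟨f⟩
  inv := ⟨(LieEquiv.ofBijective f hf).symm.toLieHom⟩
  hom_inv_id := LieAlgs.Hom.ext (LieHom.ext (LieEquiv.ofBijective f hf).symm_apply_apply)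
  inv_hom_id := LieAlgs.Hom.ext (LieHom.ext (LieEquiv.ofBijective f hf).apply_symm_apply)

theorem ev_naturality {A B : JordAlg k} (f : A ⟶ B) :
    (ev k B.carrier).comp (FreeJordan.map (f.hom : A.carrier →ₗ[k] B.carrier)) =
      f.hom.comp (ev k A.carrier) :=
  FreeJordan.hom_ext fun a => by
    rw [NonUnitalAlgHom.comp_apply, NonUnitalAlgHom.comp_apply, FreeJordan.map,
      FreeJordan.lift_ι, LinearMap.comp_apply, ev_ι, ev_ι]
    rfl

theorem algEval_naturality {A B : JordAlg k} (f : A ⟶ B) (x : (tag k).Eval A.carrier) :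
    algEval k B ((tag k).evalMap (f.hom : A.carrier →ₗ[k] B.carrier) x) =
      TAG.map f.hom (algEval k A x) := by
  change TAG.map (ev k B.carrier) (tagEval k _ _) = TAG.map f.hom (TAG.map _ (tagEval k _ x))
  rw [tagEval_evalMap, ← TAG.map_comp, ← TAG.map_comp, ev_naturality]

variable (k)

/-- The relative composition product of `TAG` with a Jordan algebra `J` is `TAG(J)`. -/
def relCompAlgIso :
    Monad.comparison (JordAlg.adj k) ⋙ (tagModule k).relCompAlg ≅ TAG.functor k :=
  NatIso.ofComponents
    (fun A => LieAlgs.isoOfBijective (B := (TAG.functor k).obj A) (relHom A) (relHom_bijective A))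
    (fun f => LieAlgs.Hom.ext (LieHom.ext fun x => by
      obtain ⟨x, rfl⟩ := LieSubmodule.Quotient.surjective_mk' _ x
      exact algEval_naturality f x))

/-- The relative composition product of `TAG` with the constant left module `1_J` is `1_{TAG(J)}`. -/
def relCompIso : oneJordan k ⋙ (tagModule k).relComp ≅ TAG.functor k ⋙ oneLie k :=
  NatIso.ofComponents
    (fun A => NatIso.ofComponents (fun _ => (relCompAlgIso k).app A) (fun _ => by
      refine (congrArg (· ≫ (relCompAlgIso k).hom.app A)
        ((tagModule k).relCompAlg.map_id (toAlgebra k A))).trans ?_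
      exact (Category.id_comp _).trans (Category.comp_id _).symm))
    (fun f => by
      ext V : 2
      exact (relCompAlgIso k).hom.naturality f)

end JordanOperad

end

theorem mainTheorem7 (k : Type u) [Field k] [CharZero k] :
    -- the monad `V ↦ Jord(V)` is the analytic functor of the sequence `{Jord(n)}`
    (∃ e₀ : (JordanOperad.jordSeq k).functor ≅ (jordMonad k).toFunctor,
      ∀ (V : ModuleCat.{u} k) (n : ℕ) (a : JordanOperad.jordSub k n) (v : Fin n → V),
        (e₀.hom.app V).hom ((JordanOperad.jordSeq k).cls V n (a ⊗ₜ PiTensorProduct.tprod k v)) =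
          FreeJordan.map (Finsupp.linearCombination k v) a.1) ∧
    ∃ (e : (JordanOperad.tag k).lieFunctor ≅ JordAlg.free k ⋙ TAG.functor k)
      (R : RightModule (jordMonad k) (JordanOperad.tag k).lieFunctor),
      -- the isomorphism `TAG(V) ≅ TAG(Jord(V))` is the evaluation of elements of `TAG(n)`
      (∀ (V : ModuleCat.{u} k) (n : ℕ) (p : JordanOperad.tagSub k n) (v : Fin n → V),
        (e.hom.app V).hom ((JordanOperad.tag k).cls V n (p ⊗ₜ PiTensorProduct.tprod k v)) =
          TAG.map (FreeJordan.map (Finsupp.linearCombination k v)) p.1) ∧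
      (∀ V : ModuleCat.{u} k, R.act.app V ≫ e.hom.app V =
        e.hom.app ((jordMonad k).obj V) ≫
          (TAG.functor k).map ((JordAlg.adj k).counit.app ((JordAlg.free k).obj V))) ∧
      Nonempty (oneJordan k ⋙ R.relComp ≅ TAG.functor k ⋙ oneLie k) := by
  refine ⟨⟨JordanOperad.jordIso k, fun V n a v => JordanOperad.jordEval_cls a v⟩,
    JordanOperad.tagIso k, JordanOperad.tagModule k,
    fun V n p v => JordanOperad.tagEval_cls p v, JordanOperad.tagModule_act k,
    ⟨JordanOperad.relCompIso k⟩⟩
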